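/- Let $\mathcal X,\mathcal Y$ be finite sets, let $P$ be a probability distribution on $\mathcal X$ with rational values, and let $W(y|x)$ be a discrete memoryless channel with $W(y|x)>0$ for all $y$ and all $x$ with $P(x)>0$. Logarithms are natural. Let $Q,\tilde Q,Q'$ range over the joint distributions on $\mathcal X\times\mathcal Y$ with $\mathcal X$-marginal $P$; write $Q_Y$ for the $\mathcal Y$-marginal, $I(Q)$ for the mutual information, $D(Q_{Y|X}\|W|P)$ for the conditional divergence, $[t]_+=\max\{t,0\}$, and $f(Q)=\sum_{x,y}Q(x,y)\log W(y|x)$. Let $R>0$. For each block length $n$ for which the type class of $P$ (the set of words in $\mathcal X^n$ with empirical distribution exactly $P$) is not empty, draw $M=\lceil e^{nR}\rceil$ codewords $\mathbf x_1,\dots,\mathbf x_M$ independently and uniformly from this type class. For $T\in\mathbb R$, let $\phi_T$ be the list decoder which, given the output word $\mathbf y\in\mathcal Y^n$, puts message $m$ on the list if and only if $$f(\hat Q_{\mathbf x_m\mathbf y})\ \ge\ T+\max_{l\ne m}f(\hat Q_{\mathbf x_l\mathbf y}),$$ where $\hat Q_{\mathbf x\mathbf y}$ is the joint empirical distribution;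 let $\Lambda_2=\{\phi_T: T\in\mathbb R\}$. Let $\overline{P_e}$ be the probability that the transmitted message (uniformly distributed) is not on the list, and $\overline L$ the expected number of other messages on the list, both averaged over the random codebook. Let $E_e(R,T)=\liminf_{n}-\frac1n\log\overline{P_e}$ and $E_l(R,T)=\liminf_{n}-\frac1n\log\overline{L}$, where $n$ runs over the block lengths above and $-\log 0=+\infty$. For $E>0$ put $$g^*(q,s)=\min_{Q':\,Q'_Y=q,\ D(Q'_{Y|X}\|W|P)\le s}f(Q')\quad(=+\infty\text{ if infeasible}),\qquad h^*(Q,R,E)=g^*\bigl(Q_Y,\,E-[I(Q)-R]_+\bigr).$$ **Theorem.** For all $R>0$ and $E>0$ the minimum $$T^*=T^*(R,E)=\min_{Q}\{h^*(Q,R,E)-f(Q)\}$$ exists and is a real number, and it is an optimal parameter for the class $\Lambda_2$: $E_e(R,T^*)\ge E$, and $E_l(R,T)\le E_l(R,T^*)$ for every $T\in\mathbb R$ with $E_e(R,T)\ge E$. The resulting list size exponent is $$E_l(R,T^*)=\min_{\tilde Q}\ \min_{Q\in\mathcal D(\tilde Q,R,T^*)}\bigl\{D(\tilde Q_{Y|X}\|W|P)+I(Q)-R\bigr\},$$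 where the minimum is attained and $$\mathcal D(\tilde Q,R,T)=\Bigl\{Q:\ Q_Y=\tilde Q_Y,\ f(Q)\ge T+\max\bigl\{\max_{Q':\,Q'_Y=Q_Y,\ I(Q')\le R}f(Q'),\ f(\tilde Q)\bigr\}\Bigr\}.$$ -/

import Mathlib

open Filter

noncomputable section

namespace ErasureList

variable {X Y : Type*} [Fintype X] [Fintype Y]

/-! ### Single-letter quantities

A joint distribution on `X × Y` is a function `Q : X → Y → ℝ`; a channel is a function
`W : X → Y → ℝ`, where `W x y` stands for `W(y|x)`. -/

/-- Joint distributions on `X × Y` whose `X`-marginal is `P`. -/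
def jointDists (P : X → ℝ) : Set (X → Y → ℝ) :=
  {Q | (∀ x y, 0 ≤ Q x y) ∧ ∀ x, ∑ y, Q x y = P x}

/-- The `X`-marginal. -/
def margX (Q : X → Y → ℝ) : X → ℝ := fun x => ∑ y, Q x y

/-- The `Y`-marginal. -/
def margY (Q : X → Y → ℝ) : Y → ℝ := fun y => ∑ x, Q x y

/-- Mutual information `I(Q)`, in nats (`0 log 0 = 0`). -/
def mutualInfo (Q : X → Y → ℝ) : ℝ :=
  ∑ x, ∑ y, Q x y * Real.log (Q x y / (margX Q x * margY Q y))

/-- Conditional divergence `D(Q_{Y|X} ‖ W | Q_X)`, in nats, for `W` positive on the support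
of `Q`; here `Q_{Y|X}(y|x) = Q(x,y) / Q_X(x)`. -/
def condDiv (W Q : X → Y → ℝ) : ℝ :=
  ∑ x, ∑ y, Q x y * Real.log (Q x y / (margX Q x * W x y))

/-- Normalized log-likelihood `f(Q) = ∑ Q(x,y) log W(y|x)`. -/
def logLik (W Q : X → Y → ℝ) : ℝ :=
  ∑ x, ∑ y, Q x y * Real.log (W x y)

/-- `g*(q, s) = min { f(Q') : Q'_Y = q, D(Q'_{Y|X} ‖ W | P) ≤ s }`,
which is `⊤` when the minimization is infeasible. -/
def gStar (P : X → ℝ) (W : X → Y → ℝ) (q : Y → ℝ) (s : ℝ) : EReal :=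
  ⨅ Q' ∈ {Q' ∈ jointDists (Y := Y) P | margY Q' = q ∧ condDiv W Q' ≤ s},
    (logLik W Q' : EReal)

/-- `h*(Q, R, E) = g*(Q_Y, E - [I(Q) - R]₊)`. -/
def hStar (P : X → ℝ) (W : X → Y → ℝ) (R E : ℝ) (Q : X → Y → ℝ) : EReal :=
  gStar P W (margY Q) (E - max (mutualInfo Q - R) 0)

/-- `V(q, R) = max { f(Q') : Q'_Y = q, I(Q') ≤ R }`. -/
def maxLogLik (P : X → ℝ) (W : X → Y → ℝ) (R : ℝ) (q : Y → ℝ) : ℝ :=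
  sSup (logLik W '' {Q' ∈ jointDists (Y := Y) P | margY Q' = q ∧ mutualInfo Q' ≤ R})

/-- The set `D(Q̃, R, T)` of all `Q` with `Q_Y = Q̃_Y` and
`f(Q) ≥ T + max { V(Q_Y, R), f(Q̃) }`. -/
def listSet (P : X → ℝ) (W : X → Y → ℝ) (R T : ℝ) (Qt : X → Y → ℝ) :
    Set (X → Y → ℝ) :=
  {Q ∈ jointDists P | margY Q = margY Qt ∧
    T + max (maxLogLik P W R (margY Q)) (logLik W Qt) ≤ logLik W Q}

/-- The values `D(Q̃_{Y|X} ‖ W | P) + I(Q) - R` for `Q̃` any joint distribution and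
`Q ∈ D(Q̃, R, T)`. -/
def listCosts (P : X → ℝ) (W : X → Y → ℝ) (R T : ℝ) : Set ℝ :=
  {v | ∃ Qt ∈ jointDists (Y := Y) P, ∃ Q ∈ listSet P W R T Qt,
    v = condDiv W Qt + mutualInfo Q - R}

/-! ### Codes, decoders and random coding exponents -/

/-- The type class of `P`: the words of length `n` with empirical distribution `P`. -/
def typeClass [DecidableEq X] (P : X → ℝ) (n : ℕ) : Finset (Fin n → X) :=
  {x | ∀ a, ((Finset.univ.filter fun i => x i = a).card : ℝ) / n = P a}

/-- The joint empirical distribution of two words. -/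
def jointType [DecidableEq X] [DecidableEq Y] {n : ℕ} (x : Fin n → X) (y : Fin n → Y) :
    X → Y → ℝ :=
  fun a b => ((Finset.univ.filter fun i => x i = a ∧ y i = b).card : ℝ) / n

/-- The memoryless channel: probability of output word `y` given input word `x`. -/
def wordProb (W : X → Y → ℝ) {n : ℕ} (x : Fin n → X) (y : Fin n → Y) : ℝ :=
  ∏ i, W (x i) (y i)

/-- The decoding region of message `m`, for the decoder with parameter `T`: the words `y` with
`f(x_m, y) ≥ T + max_{l ≠ m} f(x_l, y)`. -/
def region [DecidableEq X] [DecidableEq Y] (W : X → Y → ℝ) (T : ℝ) {n M : ℕ}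
    (C : Fin M → Fin n → X) (m : Fin M) : Set (Fin n → Y) :=
  {y | ∀ l, l ≠ m → T + logLik W (jointType (C l) y) ≤ logLik W (jointType (C m) y)}

/-- The average error probability of codebook `C`: the sent codeword is not on the list. -/
def errorProb [DecidableEq X] [DecidableEq Y] (W : X → Y → ℝ) (T : ℝ) {n M : ℕ}
    (C : Fin M → Fin n → X) : ℝ :=
  (1 / M : ℝ) * ∑ m, ∑ y, (region W T C m)ᶜ.indicator (wordProb W (C m)) y

/-- The average number of erroneous codewords on the list, for codebook `C`. -/
def listSize [DecidableEq X] [DecidableEq Y] (W : X → Y → ℝ) (T : ℝ) {n M : ℕ}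
    (C : Fin M → Fin n → X) : ℝ :=
  (1 / M : ℝ) * ∑ m, ∑ l ∈ Finset.univ.erase m,
    ∑ y, (region W T C l).indicator (wordProb W (C m)) y

/-- The number of codewords at rate `R` (in nats) and block length `n`. -/
def numCodewords (R : ℝ) (n : ℕ) : ℕ := ⌈Real.exp (n * R)⌉₊

/-- The average over the fixed composition ensemble: the codewords are drawn independently and
uniformly from the type class of `P`, so that the codebook is uniform on the `M`-fold product. -/
def ensembleAvg [DecidableEq X] (P : X → ℝ) (n M : ℕ) (F : (Fin M → Fin n → X) → ℝ) : ℝ :=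
  Finset.expect (Fintype.piFinset fun _ : Fin M => typeClass P n) F

/-- `-(1/n) log a`, with the value `+∞` at `a = 0`. -/
def negRate (n : ℕ) (a : ℝ) : EReal :=
  if a = 0 then ⊤ else ((-(1 / n) * Real.log a : ℝ) : EReal)

/-- Block lengths tending to infinity, among those for which the type class of `P`
is not empty. -/
def blockLengths [DecidableEq X] (P : X → ℝ) : Filter ℕ :=
  atTop ⊓ 𝓟 {n | (typeClass P n).Nonempty}

/-- The random coding error exponent of the decoder with parameter `T`. -/
def errorExponent [DecidableEq X] [DecidableEq Y] (P : X → ℝ) (W : X → Y → ℝ)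
    (R T : ℝ) : EReal :=
  liminf (fun n : ℕ =>
    negRate n (ensembleAvg P n (numCodewords R n) (errorProb W T))) (blockLengths P)

/-- The random coding list size exponent of the decoder with parameter `T`. -/
def listExponent [DecidableEq X] [DecidableEq Y] (P : X → ℝ) (W : X → Y → ℝ)
    (R T : ℝ) : EReal :=
  liminf (fun n : ℕ =>
    negRate n (ensembleAvg P n (numCodewords R n) (listSize W T))) (blockLengths P)

/-- `T` is an optimal parameter: its decoder has error exponent at least `E`, and among all
parameters with this property it has the largest list size exponent. -/
def IsOptimalParameter [DecidableEq X] [DecidableEq Y] (P : X → ℝ) (W : X → Y → ℝ)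
    (R E T : ℝ) : Prop :=
  (E : EReal) ≤ errorExponent P W R T ∧
    ∀ T' : ℝ, (E : EReal) ≤ errorExponent P W R T' →
      listExponent P W R T' ≤ listExponent P W R T

end ErasureList

end

/-! The objects are pairs (Q̃, Q) with a common output margin (`marginPairs`): Q̃ is the joint type
of the sent word and the output, Q that of another codeword and the same output. By the method of
types, the occurrence of such a pair has exponent `errorCost`, D(Q̃) + [I(Q) - R]₊, and the expected
number of wrong codewords of type Q has exponent `listCost`, D(Q̃) + I(Q) - R. Such a codeword is
listed only if it also survives all its competitors.

Threshold. The nested minimum T* is a single minimum of f(Q̃) - f(Q) over the compact set of pairs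
with `errorCost` at most E (`IsThresholdPair.isLeast`). So at T* every pair that produces an error
costs more than E, and `le_errorExponent` applies. Above T*, mixing the minimizing pair with the
pair (channel, product), whose cost is zero, gives by convexity an error pair of cost strictly below
E (`IsThresholdPair.exists_lt`). Rational approximation realizes it by types, so the error exponent
is below E (`errorExponent_lt`). Admissible thresholds are thus at most T*, and the list shrinks as
T grows.

List exponent, lower bound. If Q is beaten, with some slack, by a distribution of information at
most R, then exponentially many blocking codewords are expected and Q survives with doubly
exponentially small probability (`eventually_passProb_pow_le`). The remaining pairs satisfy the
constraints at a slightly smaller threshold, where the minimal cost is almost the same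
(`exists_listCost_ge`).

List exponent, upper bound. A minimizing pair must be approximated by types that are on the list and
whose blockers have information exceeding R by a fixed margin (`HasRatApprox`). This is easy when a
small mixture makes the constraints strict. The obstruction is a rigid minimizer: Q maximizes f in
its output margin class, and some V with I(V) ≤ R satisfies f(Q) = T + f(V), which forces T ≥ 0. For
T = 0, maximality depends only on the support (`logLik_le_of_support`), and the rational
approximation does not enlarge supports. For T > 0 rigidity is impossible
(`IsThresholdPair.not_rigid`): exchanging the components of the threshold pair and using
`condDiv_swap` bounds the minimal list cost by E + T, while rigidity makes it larger. -/

noncomputable section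

namespace ErasureList

variable {X Y : Type*} [Fintype X] [Fintype Y]

set_option linter.unusedSectionVars false

/-! ### Counting words with prescribed letter frequencies -/

/-- The number of occurrences of the letter `a` in `z`. -/
def cnt {ι Z : Type*} [Fintype ι] [DecidableEq Z] (z : ι → Z) (a : Z) : ℕ :=
  (Finset.univ.filter fun i => z i = a).card

theorem cnt_comp_perm {ι Z : Type*} [Fintype ι] [DecidableEq Z] (z : ι → Z)
    (σ : Equiv.Perm ι) : cnt (z ∘ σ) = cnt z := by
  funext a
  unfold cnt
  refine Finset.card_bij (fun i _ => σ i) ?_ ?_ ?_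
  · simp
  · intro i _ j _ h
    exact σ.injective h
  · intro j hj
    exact ⟨σ.symm j, by simpa using hj, by simp⟩

theorem sum_cnt {ι Z : Type*} [Fintype ι] [Fintype Z] [DecidableEq Z] (z : ι → Z) :
    ∑ a, cnt z a = Fintype.card ι := by
  unfold cnt
  rw [← Finset.card_univ,
    Finset.card_eq_sum_card_fiberwise (f := z) (t := Finset.univ) (fun _ _ => by simp)]

theorem cnt_le {ι Z : Type*} [Fintype ι] [DecidableEq Z] (z : ι → Z) (a : Z) :
    cnt z a ≤ Fintype.card ι := Finset.card_le_univ _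

/-- Fibres over each letter have equal size; bijections between them glue to a permutation. Words of
one type thus form a single orbit, which is what makes all later quantities depend on types only. -/
theorem exists_perm_of_cnt_eq {ι Z : Type*} [Fintype ι] [DecidableEq Z]
    {z z' : ι → Z} (h : cnt z = cnt z') : ∃ σ : Equiv.Perm ι, z' = z ∘ σ := by
  have e : ∀ a, Nonempty ({i // z' i = a} ≃ {i // z i = a}) := by
    intro a
    refine ⟨Fintype.equivOfCardEq ?_⟩
    have := congrFun h a
    simp only [cnt] at this
    simp only [Fintype.card_subtype]
    convert this.symm
  refine ⟨Equiv.ofFiberEquiv fun a => (e a).some, ?_⟩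
  funext i
  exact (Equiv.ofFiberEquiv_map (fun a => (e a).some) i).symm

/-- Orbit counting: permutations map onto the words with the counts of `z`, and each fibre is a
coset of the stabilizer, which has `∏ (cnt z a)!` elements. -/
theorem card_cnt_eq_mul {ι Z : Type*} [Fintype ι] [DecidableEq ι] [Fintype Z] [DecidableEq Z]
    (z : ι → Z) :
    (Finset.univ.filter fun z' : ι → Z => cnt z' = cnt z).card * ∏ a, (cnt z a).factorial
      = (Fintype.card ι).factorial := by
  have hstab : (Finset.univ.filter fun g : Equiv.Perm ι => z ∘ g = z).card
      = ∏ a, (cnt z a).factorial := by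
    have := DomMulAct.stabilizer_card z
    rw [Fintype.card_subtype] at this
    rw [this]
    refine Finset.prod_congr rfl fun a _ => ?_
    rw [Fintype.card_subtype]; rfl
  rw [← Fintype.card_perm, ← Finset.card_univ,
    Finset.card_eq_sum_card_fiberwise (f := fun g : Equiv.Perm ι => z ∘ g)
      (t := Finset.univ.filter fun z' : ι → Z => cnt z' = cnt z)
      (fun g _ => by simpa using cnt_comp_perm z g)]
  rw [Finset.sum_const_nat (m := ∏ a, (cnt z a).factorial)]
  intro z' hz'
  rw [← hstab]
  obtain ⟨σ, rfl⟩ := exists_perm_of_cnt_eq (Finset.mem_filter.1 hz').2.symm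
  refine Finset.card_bij (fun g _ => g * σ⁻¹) ?_ ?_ ?_
  · intro g hg
    have hg' : z ∘ g = z ∘ σ := by simpa using hg
    simp only [Finset.mem_filter, Finset.mem_univ, true_and]
    funext i
    have := congrFun hg' (σ⁻¹ i)
    simpa using this
  · intro g _ g' _ h
    exact mul_right_cancel h
  · intro g hg
    have hg' : z ∘ g = z := by simpa using hg
    refine ⟨g * σ, ?_, by simp⟩
    simp only [Finset.mem_filter, Finset.mem_univ, true_and]
    funext i
    exact congrFun hg' (σ i)

/-! ### Factorial bounds and the sizes of type classes -/

theorem exp_le_factorial (k : ℕ) :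
    Real.exp (k * Real.log k - k) ≤ (k.factorial : ℝ) := by
  rcases Nat.eq_zero_or_pos k with rfl | hk
  · simp
  have hk' : (0 : ℝ) < k := by exact_mod_cast hk
  -- `k ^ k / k!` is a single term of the exponential series at `k`.
  have h := Real.pow_div_factorial_le_exp (k : ℝ) hk'.le k
  have hf : (0 : ℝ) < k.factorial := by exact_mod_cast k.factorial_pos
  rw [div_le_iff₀ hf] at h
  rw [Real.exp_sub, mul_comm, Real.exp_mul, Real.exp_log hk', div_le_iff₀ (Real.exp_pos _),
    Real.rpow_natCast]
  linarith

theorem factorial_succ_le_exp (k : ℕ) :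
    ((k + 1).factorial : ℝ)
      ≤ Real.exp 1 * (k + 1) * Real.exp ((k + 1) * Real.log (k + 1) - (k + 1)) := by
  induction k with
  | zero =>
    simp only [zero_add, Nat.factorial_one, Nat.cast_one, CharP.cast_eq_zero, Real.log_one,
      mul_zero, zero_sub]
    rw [mul_right_comm, ← Real.exp_add]; norm_num
  | succ k ih =>
    have hk : (0 : ℝ) < (k : ℝ) + 1 := by positivity
    have hk1 : (0 : ℝ) < (k : ℝ) + 1 + 1 := by positivity
    rw [Nat.factorial_succ]
    push_cast
    -- This is `log x ≤ x - 1` at `x = (k + 1) / (k + 2)`, multiplied by `k + 2`.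
    have key : ((k : ℝ) + 1) * Real.log (k + 1) - (k + 1)
        ≤ (k + 1 + 1) * Real.log (k + 1 + 1) - (k + 1 + 1) - Real.log (k + 1) := by
      have := Real.log_le_sub_one_of_pos (x := ((k : ℝ) + 1) / (k + 1 + 1)) (by positivity)
      rw [Real.log_div hk.ne' hk1.ne'] at this
      have h3 : ((k : ℝ) + 1 + 1) * (Real.log (k + 1) - Real.log (k + 1 + 1)) ≤ -1 := by
        calc _ ≤ ((k : ℝ) + 1 + 1) * (((k : ℝ) + 1) / (k + 1 + 1) - 1) := by gcongr
          _ = -1 := by field_simp; ring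
      linarith
    have key2 : ((k : ℝ) + 1) * Real.exp ((k + 1) * Real.log (k + 1) - (k + 1))
        ≤ Real.exp ((k + 1 + 1) * Real.log (k + 1 + 1) - (k + 1 + 1)) := by
      have := Real.exp_le_exp.2 key
      rw [Real.exp_sub _ (Real.log _), Real.exp_log hk, le_div_iff₀ hk] at this
      linarith
    calc ((k : ℝ) + 1 + 1) * ((k + 1).factorial : ℝ)
        ≤ (k + 1 + 1) * (Real.exp 1 * (k + 1)
          * Real.exp ((k + 1) * Real.log (k + 1) - (k + 1))) := by gcongr
      _ = Real.exp 1 * (k + 1 + 1) * ((k + 1)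
          * Real.exp ((k + 1) * Real.log (k + 1) - (k + 1))) := by ring
      _ ≤ _ := by gcongr

/-- The polynomial correction factor in the bounds for factorials. -/
def polyFactor (n : ℕ) : ℝ := Real.exp 1 * (n + 1)

theorem one_le_polyFactor (n : ℕ) : 1 ≤ polyFactor n := by
  unfold polyFactor
  have h1 : (1 : ℝ) ≤ Real.exp 1 := Real.one_le_exp zero_le_one
  have h2 : (1 : ℝ) ≤ (n : ℝ) + 1 := by linarith [n.cast_nonneg (α := ℝ)]
  nlinarith

theorem polyFactor_pos (n : ℕ) : 0 < polyFactor n :=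
  zero_lt_one.trans_le (one_le_polyFactor n)

theorem polyFactor_mono : Monotone polyFactor := by
  intro a b h
  unfold polyFactor
  have : (a : ℝ) ≤ b := by exact_mod_cast h
  gcongr

theorem factorial_le_exp (k : ℕ) :
    (k.factorial : ℝ) ≤ polyFactor k * Real.exp (k * Real.log k - k) := by
  rcases k with _ | k
  · simpa using one_le_polyFactor 0
  refine (factorial_succ_le_exp k).trans ?_
  unfold polyFactor
  push_cast
  gcongr
  linarith

/-- The type (empirical distribution) of a word. -/
def wtype {n : ℕ} {Z : Type*} [DecidableEq Z] (z : Fin n → Z) (a : Z) : ℝ := (cnt z a : ℝ) / n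

/-- `∑ p log p`, the negative of the Shannon entropy. -/
def negEnt {Z : Type*} [Fintype Z] (p : Z → ℝ) : ℝ := ∑ a, p a * Real.log (p a)

theorem nat_mul_negEnt_wtype {n : ℕ} (hn : n ≠ 0) {Z : Type*} [Fintype Z] [DecidableEq Z]
    (z : Fin n → Z) :
    n * negEnt (wtype z) = ∑ a, (cnt z a : ℝ) * Real.log (cnt z a) - n * Real.log n := by
  have hn' : (n : ℝ) ≠ 0 := by exact_mod_cast hn
  have hs : ∑ a, (cnt z a : ℝ) = n := by
    have := sum_cnt z
    rw [Fintype.card_fin] at this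
    exact_mod_cast this
  unfold negEnt
  calc _ = ∑ a, ((cnt z a : ℝ) * Real.log (cnt z a) - cnt z a * Real.log n) := by
        rw [Finset.mul_sum]
        refine Finset.sum_congr rfl fun a _ => ?_
        unfold wtype
        rcases Nat.eq_zero_or_pos (cnt z a) with h | h
        · simp [h]
        · have : (cnt z a : ℝ) ≠ 0 := by exact_mod_cast h.ne'
          rw [Real.log_div this hn']
          field_simp
    _ = _ := by rw [Finset.sum_sub_distrib, ← Finset.sum_mul, hs]

theorem wtype_eq_iff {n : ℕ} {Z : Type*} [DecidableEq Z] (z z' : Fin n → Z) :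
    wtype z = wtype z' ↔ cnt z = cnt z' := by
  refine ⟨fun h => ?_, fun h => by unfold wtype; rw [h]⟩
  -- At length zero, types carry no information, since division by zero gives 0; but there is only
  -- one word.
  rcases Nat.eq_zero_or_pos n with rfl | hn
  · congr 1; exact Subsingleton.elim _ _
  funext a
  have := congrFun h a
  unfold wtype at this
  have hn' : (n : ℝ) ≠ 0 := by exact_mod_cast hn.ne'
  rw [div_left_inj' hn'] at this
  exact_mod_cast this

/-- The number of words with the same type as `z`. -/
def classSize {n : ℕ} {Z : Type*} [Fintype Z] [DecidableEq Z] (z : Fin n → Z) : ℕ :=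
  (Finset.univ.filter fun z' : Fin n → Z => wtype z' = wtype z).card

theorem classSize_mul {n : ℕ} {Z : Type*} [Fintype Z] [DecidableEq Z] (z : Fin n → Z) :
    (classSize z : ℝ) * ∏ a, ((cnt z a).factorial : ℝ) = (n.factorial : ℝ) := by
  have := card_cnt_eq_mul z
  simp only [← wtype_eq_iff, Fintype.card_fin] at this
  unfold classSize
  exact_mod_cast this

theorem classSize_pos {n : ℕ} {Z : Type*} [Fintype Z] [DecidableEq Z] (z : Fin n → Z) :
    0 < classSize z :=
  Finset.card_pos.2 ⟨z, by simp⟩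

theorem exp_sum_cnt {n : ℕ} {Z : Type*} [Fintype Z] [DecidableEq Z] (z : Fin n → Z) :
    ∏ a, Real.exp ((cnt z a : ℝ) * Real.log (cnt z a) - cnt z a)
      = Real.exp (∑ a, (cnt z a : ℝ) * Real.log (cnt z a) - n) := by
  have hs : ∑ a, (cnt z a : ℝ) = n := by
    have := sum_cnt z
    rw [Fintype.card_fin] at this
    exact_mod_cast this
  rw [← Real.exp_sum, Finset.sum_sub_distrib, hs]

/-- The class size is `n! / ∏ (cnt z a)!`. The factors `exp (-n)` and `∏ exp (-cnt z a)` cancel, so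
one polynomial factor, from the numerator, is enough; the reverse bound needs one for each letter.
-/
theorem classSize_le {n : ℕ} (hn : n ≠ 0) {Z : Type*} [Fintype Z] [DecidableEq Z]
    (z : Fin n → Z) :
    (classSize z : ℝ) ≤ polyFactor n * Real.exp (-(n * negEnt (wtype z))) := by
  have h1 : Real.exp (∑ a, (cnt z a : ℝ) * Real.log (cnt z a) - n)
      ≤ ∏ a, ((cnt z a).factorial : ℝ) := by
    rw [← exp_sum_cnt]
    exact Finset.prod_le_prod (fun _ _ => (Real.exp_pos _).le) fun a _ => exp_le_factorial _
  have h2 := classSize_mul z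
  have h3 := factorial_le_exp n
  have h4 : (classSize z : ℝ) * Real.exp (∑ a, (cnt z a : ℝ) * Real.log (cnt z a) - n)
      ≤ polyFactor n * Real.exp (n * Real.log n - n) := by
    calc _ ≤ (classSize z : ℝ) * ∏ a, ((cnt z a).factorial : ℝ) := by gcongr
      _ ≤ _ := by rw [h2]; exact h3
  rw [← le_div_iff₀ (Real.exp_pos _), mul_div_assoc, ← Real.exp_sub] at h4
  refine h4.trans (le_of_eq ?_)
  rw [nat_mul_negEnt_wtype hn]
  congr 2; ring

theorem le_classSize {n : ℕ} (hn : n ≠ 0) {Z : Type*} [Fintype Z] [DecidableEq Z]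
    (z : Fin n → Z) :
    Real.exp (-(n * negEnt (wtype z))) ≤ polyFactor n ^ Fintype.card Z * classSize z := by
  have h1 : ∏ a, ((cnt z a).factorial : ℝ) ≤ polyFactor n ^ Fintype.card Z *
      Real.exp (∑ a, (cnt z a : ℝ) * Real.log (cnt z a) - n) := by
    rw [← exp_sum_cnt, ← Finset.card_univ, ← Finset.prod_const, ← Finset.prod_mul_distrib]
    refine Finset.prod_le_prod (fun _ _ => by positivity) fun a _ => ?_
    refine (factorial_le_exp _).trans ?_
    gcongr
    exact polyFactor_mono (by simpa using cnt_le z a)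
  have h2 := classSize_mul z
  have h3 := exp_le_factorial n
  have h4 : Real.exp (n * Real.log n - n) ≤ polyFactor n ^ Fintype.card Z * classSize z *
      Real.exp (∑ a, (cnt z a : ℝ) * Real.log (cnt z a) - n) := by
    calc _ ≤ (classSize z : ℝ) * ∏ a, ((cnt z a).factorial : ℝ) := by rw [h2]; exact h3
      _ ≤ (classSize z : ℝ) * (polyFactor n ^ Fintype.card Z *
        Real.exp (∑ a, (cnt z a : ℝ) * Real.log (cnt z a) - n)) := by gcongr
      _ = _ := by ring
  rw [← div_le_iff₀ (Real.exp_pos _), ← Real.exp_sub] at h4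
  refine le_trans (le_of_eq ?_) h4
  rw [nat_mul_negEnt_wtype hn]
  congr 1; ring

theorem card_image_wtype_le {n : ℕ} {Z : Type*} [Fintype Z] [DecidableEq Z] :
    ((Finset.univ.image fun z : Fin n → Z => wtype z).card : ℝ)
      ≤ polyFactor n ^ Fintype.card Z := by
  classical
  have h1 : (Finset.univ.image fun z : Fin n → Z => wtype z).card
      ≤ (Finset.univ : Finset (Z → Fin (n + 1))).card := by
    refine (Finset.card_le_card ?_).trans (Finset.card_image_le (s := Finset.univ)
      (f := fun k : Z → Fin (n + 1) => fun a => ((k a : ℕ) : ℝ) / n))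
    intro p hp
    obtain ⟨z, -, rfl⟩ := Finset.mem_image.1 hp
    exact Finset.mem_image.2 ⟨fun a => ⟨cnt z a, Nat.lt_succ_of_le (by simpa using cnt_le z a)⟩,
      Finset.mem_univ _, rfl⟩
  have h2 : (Finset.univ : Finset (Z → Fin (n + 1))).card = (n + 1) ^ Fintype.card Z := by
    simp
  calc _ ≤ (((n + 1) ^ Fintype.card Z : ℕ) : ℝ) := by exact_mod_cast h1.trans_eq h2
    _ = ((n : ℝ) + 1) ^ Fintype.card Z := by push_cast; rfl
    _ ≤ _ := by
      gcongr
      unfold polyFactor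
      have h1 : (1 : ℝ) ≤ Real.exp 1 := Real.one_le_exp zero_le_one
      have h2 : (0 : ℝ) ≤ (n : ℝ) + 1 := by positivity
      nlinarith

/-- Weighted by its exponent, each type class contributes at most `polyFactor n`, and there are
polynomially many types. All union bounds below reduce to this sum. -/
theorem sum_exp_negEnt_le {n : ℕ} (hn : n ≠ 0) {Z : Type*} [Fintype Z] [DecidableEq Z] :
    ∑ z : Fin n → Z, Real.exp (n * negEnt (wtype z)) ≤ polyFactor n ^ (Fintype.card Z + 1) := by
  classical
  rw [Finset.sum_comp (fun p => Real.exp (n * negEnt p)) wtype]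
  calc _ ≤ ∑ p ∈ Finset.univ.image fun z : Fin n → Z => wtype z, polyFactor n := by
        refine Finset.sum_le_sum fun p hp => ?_
        obtain ⟨z, -, rfl⟩ := Finset.mem_image.1 hp
        have := classSize_le hn z
        rw [Real.exp_neg, ← div_eq_mul_inv, le_div_iff₀ (Real.exp_pos _)] at this
        rw [nsmul_eq_mul]
        exact this
    _ ≤ _ := by
        rw [Finset.sum_const, nsmul_eq_mul, pow_succ]
        have := polyFactor_pos n
        gcongr
        exact card_image_wtype_le

/-! ### Joint types -/

/-- `∑ Q log Q`, the negative of the joint entropy. -/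
def jointNegEnt (Q : X → Y → ℝ) : ℝ := ∑ x, ∑ y, Q x y * Real.log (Q x y)

theorem margX_of_mem {P : X → ℝ} {Q : X → Y → ℝ} (hQ : Q ∈ jointDists P) : margX Q = P :=
  funext hQ.2

theorem le_margX {Q : X → Y → ℝ} (hQ : ∀ x y, 0 ≤ Q x y) (x : X) (y : Y) :
    Q x y ≤ margX Q x :=
  Finset.single_le_sum (f := fun y => Q x y) (fun y _ => hQ x y) (Finset.mem_univ y)

theorem le_margY {Q : X → Y → ℝ} (hQ : ∀ x y, 0 ≤ Q x y) (x : X) (y : Y) :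
    Q x y ≤ margY Q y :=
  Finset.single_le_sum (f := fun x => Q x y) (fun x _ => hQ x y) (Finset.mem_univ x)

theorem mutualInfo_eq {P : X → ℝ} {Q : X → Y → ℝ} (hQ : Q ∈ jointDists P) :
    mutualInfo Q = jointNegEnt Q - negEnt P - negEnt (margY Q) := by
  have h : ∀ x y, Q x y * Real.log (Q x y / (margX Q x * margY Q y))
      = Q x y * Real.log (Q x y) - Q x y * Real.log (margX Q x)
        - Q x y * Real.log (margY Q y) := by
    intro x y
    rcases (hQ.1 x y).eq_or_lt with h0 | h0
    · simp [← h0]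
    · have h1 := h0.trans_le (le_margX hQ.1 x y)
      have h2 := h0.trans_le (le_margY hQ.1 x y)
      rw [Real.log_div h0.ne' (by positivity), Real.log_mul h1.ne' h2.ne']
      ring
  unfold mutualInfo jointNegEnt negEnt
  simp only [h, Finset.sum_sub_distrib]
  rw [Finset.sum_comm (f := fun x y => Q x y * Real.log (margY Q y))]
  simp only [← Finset.sum_mul]
  rw [← margX_of_mem hQ]
  rfl

/-- Terms with `Q x y = 0` vanish; elsewhere `P x` is positive, hence so is `W x y`, and the
logarithm splits. This form gives continuity on `jointDists P`, and differs from the one for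
`mutualInfo` only by a margin term and a linear term. -/
theorem condDiv_eq {P : X → ℝ} {W : X → Y → ℝ} (hW : ∀ x, 0 < P x → ∀ y, 0 < W x y)
    {Q : X → Y → ℝ} (hQ : Q ∈ jointDists P) :
    condDiv W Q = jointNegEnt Q - negEnt P - logLik W Q := by
  have h : ∀ x y, Q x y * Real.log (Q x y / (margX Q x * W x y))
      = Q x y * Real.log (Q x y) - Q x y * Real.log (margX Q x)
        - Q x y * Real.log (W x y) := by
    intro x y
    rcases (hQ.1 x y).eq_or_lt with h0 | h0
    · simp [← h0]
    · have h1 := h0.trans_le (le_margX hQ.1 x y)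
      have h2 := hW x (by rwa [margX_of_mem hQ] at h1) y
      rw [Real.log_div h0.ne' (by positivity), Real.log_mul h1.ne' h2.ne']
      ring
  unfold condDiv jointNegEnt negEnt logLik
  simp only [h, Finset.sum_sub_distrib]
  simp only [← Finset.sum_mul]
  rw [← margX_of_mem hQ]
  rfl

section Types

variable [DecidableEq X] [DecidableEq Y]

theorem mem_typeClass {P : X → ℝ} {n : ℕ} {x : Fin n → X} :
    x ∈ typeClass P n ↔ wtype x = P := by
  simp only [typeClass, Finset.mem_filter, Finset.mem_univ, true_and, funext_iff]
  rfl

theorem jointType_eq_wtype {n : ℕ} (x : Fin n → X) (y : Fin n → Y) (a : X) (b : Y) :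
    jointType x y a b = wtype (fun i => (x i, y i)) (a, b) := by
  simp [jointType, wtype, cnt, Prod.ext_iff]

theorem jointType_eq_iff {n : ℕ} {x x' : Fin n → X} {y y' : Fin n → Y} :
    jointType x y = jointType x' y' ↔
      wtype (fun i => (x i, y i)) = wtype (fun i => (x' i, y' i)) := by
  simp only [funext_iff, jointType_eq_wtype, Prod.forall]

theorem jointNegEnt_jointType {n : ℕ} (x : Fin n → X) (y : Fin n → Y) :
    jointNegEnt (jointType x y) = negEnt (wtype (fun i => (x i, y i))) := by
  simp only [jointNegEnt, negEnt, jointType_eq_wtype, Fintype.sum_prod_type]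

theorem margX_jointType {n : ℕ} (x : Fin n → X) (y : Fin n → Y) :
    margX (jointType x y) = wtype x := by
  funext a
  simp only [margX, jointType, wtype, ← Finset.sum_div, cnt]
  congr 1
  rw [Finset.card_eq_sum_card_fiberwise (f := y) (t := Finset.univ) (fun _ _ => by simp)]
  push_cast
  refine Finset.sum_congr rfl fun b _ => ?_
  rw [Finset.filter_filter]

theorem margY_jointType {n : ℕ} (x : Fin n → X) (y : Fin n → Y) :
    margY (jointType x y) = wtype y := by
  funext b
  simp only [margY, jointType, wtype, ← Finset.sum_div, cnt]
  congr 1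
  rw [Finset.card_eq_sum_card_fiberwise (f := x) (t := Finset.univ) (fun _ _ => by simp)]
  push_cast
  refine Finset.sum_congr rfl fun b _ => ?_
  rw [Finset.filter_filter]
  simp only [and_comm]

theorem jointType_nonneg {n : ℕ} (x : Fin n → X) (y : Fin n → Y) (a : X) (b : Y) :
    0 ≤ jointType x y a b := by
  unfold jointType; positivity

theorem jointType_mem {P : X → ℝ} {n : ℕ} {x : Fin n → X} (hx : x ∈ typeClass P n)
    (y : Fin n → Y) : jointType x y ∈ jointDists (Y := Y) P := by
  refine ⟨jointType_nonneg x y, fun a => ?_⟩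
  have := congrFun (margX_jointType x y) a
  rw [mem_typeClass.1 hx] at this
  exact this

theorem jointType_comp {n : ℕ} (x : Fin n → X) (y : Fin n → Y) (σ : Equiv.Perm (Fin n)) :
    jointType (x ∘ σ) (y ∘ σ) = jointType x y := by
  rw [jointType_eq_iff, wtype_eq_iff]
  exact cnt_comp_perm (fun i => (x i, y i)) σ

/-- A letter that occurs in `x` has positive frequency, so every channel factor is positive and the
product may be turned into a sum of logarithms, grouped by letter pairs. -/
theorem wordProb_eq_exp {P : X → ℝ} {W : X → Y → ℝ}
    (hW : ∀ x, 0 < P x → ∀ y, 0 < W x y)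
    {n : ℕ} {x : Fin n → X} (hx : x ∈ typeClass P n) (y : Fin n → Y) :
    wordProb W x y = Real.exp (n * logLik W (jointType x y)) := by
  have hpos : ∀ i, 0 < W (x i) (y i) := by
    intro i
    refine hW _ ?_ _
    have hn : (0 : ℝ) < n := by exact_mod_cast (Nat.zero_le _).trans_lt i.2
    rw [← mem_typeClass.1 hx]
    unfold wtype cnt
    refine div_pos ?_ hn
    exact_mod_cast Finset.card_pos.2 ⟨i, by simp⟩
  have h1 : wordProb W x y = Real.exp (∑ i, Real.log (W (x i) (y i))) := by
    rw [Real.exp_sum]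
    exact Finset.prod_congr rfl fun i _ => (Real.exp_log (hpos i)).symm
  rw [h1]
  congr 1
  rcases Nat.eq_zero_or_pos n with rfl | hn
  · simp
  have hn' : (n : ℝ) ≠ 0 := by exact_mod_cast hn.ne'
  unfold logLik jointType
  rw [Finset.mul_sum, ← Finset.sum_fiberwise (s := Finset.univ) (g := x)]
  refine Finset.sum_congr rfl fun a _ => ?_
  rw [Finset.mul_sum, ← Finset.sum_fiberwise (s := Finset.univ.filter _) (g := y)]
  refine Finset.sum_congr rfl fun b _ => ?_
  rw [Finset.filter_filter, Finset.sum_congr rfl (g := fun _ => Real.log (W a b)),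
    Finset.sum_const, nsmul_eq_mul]
  · field_simp
  · intro i hi
    obtain ⟨-, h1, h2⟩ := Finset.mem_filter.1 hi
    rw [h1, h2]

theorem card_typeClass {P : X → ℝ} {n : ℕ} {x : Fin n → X} (hx : x ∈ typeClass P n) :
    (typeClass P n).card = classSize x := by
  unfold classSize
  congr 1
  ext x'
  rw [mem_typeClass, Finset.mem_filter, mem_typeClass.1 hx]
  simp

/-- The number of pairs of words with the same joint type as `(x, y)`. -/
theorem card_jointType_eq {n : ℕ} (x : Fin n → X) (y : Fin n → Y) :
    ∑ x' : Fin n → X, ∑ y' : Fin n → Y,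
        (if jointType x' y' = jointType x y then (1 : ℝ) else 0)
      = classSize (fun i => (x i, y i)) := by
  rw [← Fintype.sum_prod_type']
  rw [← (Equiv.arrowProdEquivProdArrow (Fin n) (fun _ => X) (fun _ => Y)).sum_comp]
  unfold classSize
  rw [Finset.card_filter]
  push_cast
  refine Finset.sum_congr rfl fun z _ => ?_
  simp only [jointType_eq_iff]
  rfl

theorem sum_exp_jointNegEnt_le {n : ℕ} (hn : n ≠ 0) :
    ∑ x : Fin n → X, ∑ y : Fin n → Y, Real.exp (n * jointNegEnt (jointType x y))
      ≤ polyFactor n ^ (Fintype.card (X × Y) + 1) := by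
  rw [← Fintype.sum_prod_type']
  rw [← (Equiv.arrowProdEquivProdArrow (Fin n) (fun _ => X) (fun _ => Y)).sum_comp]
  refine le_trans (le_of_eq ?_) (sum_exp_negEnt_le hn (Z := X × Y))
  refine Finset.sum_congr rfl fun z _ => ?_
  simp only [jointNegEnt_jointType]
  rfl

/-- A sum over the type class of `P` that depends on the joint type only takes the same value
on all output words of one type. -/
theorem sum_jointType_eq_of_wtype_eq (P : X → ℝ) (F : (X → Y → ℝ) → ℝ) {n : ℕ}
    {y y' : Fin n → Y} (h : wtype y' = wtype y) :
    ∑ x ∈ typeClass P n, F (jointType x y') = ∑ x ∈ typeClass P n, F (jointType x y) := by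
  obtain ⟨σ, rfl⟩ := exists_perm_of_cnt_eq ((wtype_eq_iff _ _).1 h.symm)
  symm
  refine Finset.sum_bij (fun x _ => x ∘ σ) ?_ ?_ ?_ ?_
  · intro x hx
    rw [mem_typeClass] at hx ⊢
    rw [← hx, wtype_eq_iff]
    exact cnt_comp_perm x σ
  · intro x _ x' _ hxx
    exact σ.surjective.injective_comp_right hxx
  · intro x hx
    refine ⟨x ∘ σ.symm, ?_, ?_⟩
    · rw [mem_typeClass] at hx ⊢
      rw [← hx, wtype_eq_iff]
      exact cnt_comp_perm x σ.symm
    · funext i; simp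
  · intro x _
    rw [jointType_comp]

/-- The sum is constant over outputs of the type of `y`. A problem with fixed output thereby becomes
a count of pairs of words. -/
theorem classSize_mul_sum (P : X → ℝ) (F : (X → Y → ℝ) → ℝ) {n : ℕ} (y : Fin n → Y) :
    classSize y * ∑ x ∈ typeClass P n, F (jointType x y)
      = ∑ x ∈ typeClass P n, ∑ y' ∈ Finset.univ.filter (fun y' => wtype y' = wtype y),
          F (jointType x y') := by
  have h : ∀ y' ∈ Finset.univ.filter (fun y' => wtype y' = wtype y),
      ∑ x ∈ typeClass P n, F (jointType x y') = ∑ x ∈ typeClass P n, F (jointType x y) :=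
    fun y' hy' => sum_jointType_eq_of_wtype_eq P F (Finset.mem_filter.1 hy').2
  rw [Finset.sum_comm (s := typeClass P n), Finset.sum_congr rfl h, Finset.sum_const,
    nsmul_eq_mul]
  rfl

/-- The likelihood cancels: each summand equals `exp (-n * negEnt P) * exp (n * jointNegEnt _)`. A
bound on a conditional probability by a constant times `exp (n * condDiv _)` thus integrates to that
constant, up to a polynomial. -/
theorem sum_wordProb_exp_condDiv_le {P : X → ℝ} {W : X → Y → ℝ}
    (hW : ∀ x, 0 < P x → ∀ y, 0 < W x y) {n : ℕ} (hn : n ≠ 0)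
    (hne : (typeClass P n).Nonempty) :
    ∑ x ∈ typeClass P n, ∑ y, wordProb W x y * Real.exp (n * condDiv W (jointType x y))
      ≤ (typeClass P n).card *
        polyFactor n ^ (Fintype.card (X × Y) + 1 + Fintype.card X) := by
  obtain ⟨x0, hx0⟩ := hne
  have h1 : ∀ x ∈ typeClass P n, ∀ y : Fin n → Y,
      wordProb W x y * Real.exp (n * condDiv W (jointType x y))
        = Real.exp (-(n * negEnt P)) * Real.exp (n * jointNegEnt (jointType x y)) := by
    intro x hx y
    rw [wordProb_eq_exp hW hx, condDiv_eq hW (jointType_mem hx y), ← Real.exp_add,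
      ← Real.exp_add]
    congr 1; ring
  have h2 : ∑ x ∈ typeClass P n, ∑ y, wordProb W x y * Real.exp (n * condDiv W (jointType x y))
      ≤ Real.exp (-(n * negEnt P)) * polyFactor n ^ (Fintype.card (X × Y) + 1) := by
    calc _ = Real.exp (-(n * negEnt P)) *
          ∑ x ∈ typeClass P n, ∑ y : Fin n → Y, Real.exp (n * jointNegEnt (jointType x y)) := by
          rw [Finset.mul_sum]
          refine Finset.sum_congr rfl fun x hx => ?_
          rw [Finset.mul_sum]
          exact Finset.sum_congr rfl fun y _ => h1 x hx y
      _ ≤ Real.exp (-(n * negEnt P)) *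
          ∑ x : Fin n → X, ∑ y : Fin n → Y, Real.exp (n * jointNegEnt (jointType x y)) := by
          gcongr
          exact Finset.subset_univ _
      _ ≤ _ := by gcongr; exact sum_exp_jointNegEnt_le hn
  refine h2.trans ?_
  have h3 := le_classSize hn x0
  rw [mem_typeClass.1 hx0, ← card_typeClass hx0] at h3
  calc _ ≤ (polyFactor n ^ Fintype.card X * ((typeClass P n).card : ℝ))
        * polyFactor n ^ (Fintype.card (X × Y) + 1) := by
        have := polyFactor_pos n
        gcongr
    _ = _ := by ring

/-- The analogue for an independently drawn codeword and a fixed output: its joint type has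
probability about `exp (-n * mutualInfo _)`, which the weight compensates. -/
theorem sum_exp_mutualInfo_le {P : X → ℝ} {n : ℕ} (hn : n ≠ 0)
    (hne : (typeClass P n).Nonempty) (y : Fin n → Y) :
    ∑ x ∈ typeClass P n, Real.exp (n * mutualInfo (jointType x y))
      ≤ (typeClass P n).card *
        polyFactor n ^ (Fintype.card (X × Y) + 1 + Fintype.card X + Fintype.card Y) := by
  obtain ⟨x0, hx0⟩ := hne
  have hp := polyFactor_pos n
  have hcY : (0 : ℝ) < classSize y := by exact_mod_cast classSize_pos y
  have h2 : (classSize y : ℝ) * ∑ x ∈ typeClass P n, Real.exp (n * mutualInfo (jointType x y))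
      ≤ Real.exp (-(n * negEnt P)) * Real.exp (-(n * negEnt (wtype y))) *
        polyFactor n ^ (Fintype.card (X × Y) + 1) := by
    rw [classSize_mul_sum P (fun Q => Real.exp (n * mutualInfo Q))]
    calc _ = Real.exp (-(n * negEnt P)) * Real.exp (-(n * negEnt (wtype y))) *
          ∑ x ∈ typeClass P n, ∑ y' ∈ Finset.univ.filter (fun y' => wtype y' = wtype y),
            Real.exp (n * jointNegEnt (jointType x y')) := by
          rw [Finset.mul_sum]
          refine Finset.sum_congr rfl fun x hx => ?_
          rw [Finset.mul_sum]
          refine Finset.sum_congr rfl fun y' hy' => ?_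
          rw [mutualInfo_eq (jointType_mem hx y'), margY_jointType, (Finset.mem_filter.1 hy').2,
            ← Real.exp_add, ← Real.exp_add]
          congr 1; ring
      _ ≤ Real.exp (-(n * negEnt P)) * Real.exp (-(n * negEnt (wtype y))) *
          ∑ x : Fin n → X, ∑ y' : Fin n → Y, Real.exp (n * jointNegEnt (jointType x y')) := by
          gcongr
          refine (Finset.sum_le_sum_of_subset_of_nonneg (Finset.subset_univ _)
            fun _ _ _ => Finset.sum_nonneg fun _ _ => (Real.exp_pos _).le).trans ?_
          gcongr
          exact Finset.subset_univ _
      _ ≤ _ := by gcongr; exact sum_exp_jointNegEnt_le hn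
  have h3 := le_classSize hn x0
  rw [mem_typeClass.1 hx0, ← card_typeClass hx0] at h3
  have h4 := le_classSize hn y
  refine le_of_mul_le_mul_left (h2.trans ?_) hcY
  calc _ ≤ (polyFactor n ^ Fintype.card X * ((typeClass P n).card : ℝ))
        * (polyFactor n ^ Fintype.card Y * classSize y)
        * polyFactor n ^ (Fintype.card (X × Y) + 1) := by gcongr
    _ = _ := by ring

/-- The matching lower bound for a single joint type: all its word pairs have the same probability,
and their number is the class size of the pair word. -/
theorem exp_neg_condDiv_le {P : X → ℝ} {W : X → Y → ℝ}
    (hW : ∀ x, 0 < P x → ∀ y, 0 < W x y) {n : ℕ} (hn : n ≠ 0)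
    {x0 : Fin n → X} (hx0 : x0 ∈ typeClass P n) (y0 : Fin n → Y) :
    (typeClass P n).card * Real.exp (-(n * condDiv W (jointType x0 y0)))
      ≤ polyFactor n ^ (Fintype.card (X × Y) + 1) *
        ∑ x ∈ typeClass P n, ∑ y,
          (if jointType x y = jointType x0 y0 then wordProb W x y else 0) := by
  have hp := polyFactor_pos n
  have h1 : ∑ x ∈ typeClass P n, ∑ y,
      (if jointType x y = jointType x0 y0 then wordProb W x y else 0)
      = Real.exp (n * logLik W (jointType x0 y0)) * classSize (fun i => (x0 i, y0 i)) := by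
    rw [← card_jointType_eq, Finset.mul_sum, ← Finset.sum_subset (Finset.subset_univ _)]
    · refine Finset.sum_congr rfl fun x hx => ?_
      rw [Finset.mul_sum]
      refine Finset.sum_congr rfl fun y _ => ?_
      split_ifs with h
      · rw [wordProb_eq_exp hW hx, h, mul_one]
      · simp
    · intro x _ hx
      rw [Finset.mul_sum]
      refine Finset.sum_eq_zero fun y _ => ?_
      rw [if_neg, mul_zero]
      intro h
      apply hx
      rw [mem_typeClass] at hx0 ⊢
      rw [← hx0, ← margX_jointType x y, h, margX_jointType]
  rw [h1, condDiv_eq hW (jointType_mem hx0 y0), card_typeClass hx0]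
  have h2 := classSize_le hn x0
  have h3 := le_classSize hn (fun i => (x0 i, y0 i))
  rw [← jointNegEnt_jointType] at h3
  rw [mem_typeClass.1 hx0] at h2
  have e : Real.exp (-(n * (jointNegEnt (jointType x0 y0) - negEnt P - logLik W (jointType x0 y0))))
      = Real.exp (-(n * jointNegEnt (jointType x0 y0))) * Real.exp (n * negEnt P)
        * Real.exp (n * logLik W (jointType x0 y0)) := by
    rw [← Real.exp_add, ← Real.exp_add]; congr 1; ring
  rw [e]
  calc _ ≤ (polyFactor n * Real.exp (-(n * negEnt P))) *
        ((polyFactor n ^ Fintype.card (X × Y) * classSize (fun i => (x0 i, y0 i)))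
        * Real.exp (n * negEnt P) * Real.exp (n * logLik W (jointType x0 y0))) := by gcongr
    _ = polyFactor n ^ (Fintype.card (X × Y) + 1) * (Real.exp (n * logLik W (jointType x0 y0)) *
        classSize (fun i => (x0 i, y0 i)))
        * (Real.exp (-(n * negEnt P)) * Real.exp (n * negEnt P)) := by ring
    _ = _ := by rw [← Real.exp_add, neg_add_cancel, Real.exp_zero, mul_one]

theorem exp_neg_mutualInfo_le {P : X → ℝ} {n : ℕ} (hn : n ≠ 0)
    {x0 : Fin n → X} (hx0 : x0 ∈ typeClass P n) (y : Fin n → Y) :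
    (typeClass P n).card * Real.exp (-(n * mutualInfo (jointType x0 y)))
      ≤ polyFactor n ^ (Fintype.card (X × Y) + 2) *
        ((typeClass P n).filter fun x => jointType x y = jointType x0 y).card := by
  have hp := polyFactor_pos n
  have hcY : (0 : ℝ) < classSize y := by exact_mod_cast classSize_pos y
  have h1 : (classSize y : ℝ) *
      ((typeClass P n).filter fun x => jointType x y = jointType x0 y).card
      = classSize (fun i => (x0 i, y i)) := by
    have := classSize_mul_sum P (fun Q => if Q = jointType x0 y then 1 else 0) y
    rw [Finset.card_filter]
    push_cast
    rw [this, ← card_jointType_eq, ← Finset.sum_subset (Finset.subset_univ (typeClass P n))]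
    · refine Finset.sum_congr rfl fun x hx => ?_
      rw [← Finset.sum_subset (Finset.subset_univ
        (Finset.univ.filter fun y' : Fin n → Y => wtype y' = wtype y))]
      intro y' _ hy'
      rw [if_neg]
      intro h
      apply hy'
      simp only [Finset.mem_filter, Finset.mem_univ, true_and]
      rw [← margY_jointType x y', h, margY_jointType]
    · intro x _ hx
      refine Finset.sum_eq_zero fun y' _ => ?_
      rw [if_neg]
      intro h
      apply hx
      rw [mem_typeClass] at hx0 ⊢
      rw [← hx0, ← margX_jointType x y', h, margX_jointType]
  have h2 := classSize_le hn x0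
  have h3 := le_classSize hn (fun i => (x0 i, y i))
  have h4 := classSize_le hn y
  rw [← jointNegEnt_jointType] at h3
  rw [mem_typeClass.1 hx0] at h2
  rw [mutualInfo_eq (jointType_mem hx0 y), margY_jointType]
  have e : Real.exp (-(n * (jointNegEnt (jointType x0 y) - negEnt P - negEnt (wtype y))))
      = Real.exp (-(n * jointNegEnt (jointType x0 y))) * Real.exp (n * negEnt P)
        * Real.exp (n * negEnt (wtype y)) := by
    rw [← Real.exp_add, ← Real.exp_add]; congr 1; ring
  rw [e]
  refine le_of_mul_le_mul_left ?_ hcY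
  rw [card_typeClass hx0]
  calc _ ≤ (polyFactor n * Real.exp (-(n * negEnt (wtype y)))) *
        ((polyFactor n * Real.exp (-(n * negEnt P))) *
        ((polyFactor n ^ Fintype.card (X × Y) * classSize (fun i => (x0 i, y i)))
        * Real.exp (n * negEnt P) * Real.exp (n * negEnt (wtype y)))) := by gcongr
    _ = polyFactor n ^ (Fintype.card (X × Y) + 2) * classSize (fun i => (x0 i, y i))
        * (Real.exp (-(n * negEnt P)) * Real.exp (n * negEnt P))
        * (Real.exp (-(n * negEnt (wtype y))) * Real.exp (n * negEnt (wtype y))) := by ring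
    _ = _ := by
      rw [← Real.exp_add, ← Real.exp_add, neg_add_cancel, neg_add_cancel, Real.exp_zero, mul_one,
        mul_one, ← h1]
      ring

end Types

/-! ### Averages over the random codebook -/

section Ensemble

variable [DecidableEq X] [DecidableEq Y]

theorem sum_piFinset_prod {A : Type*} [DecidableEq A] (S : Finset A) (M : ℕ)
    (h : Fin M → A → ℝ) :
    ∑ C ∈ Fintype.piFinset (fun _ : Fin M => S), ∏ l, h l (C l) = ∏ l, ∑ a ∈ S, h l a :=
  (Finset.prod_univ_sum (fun _ => S) h).symm

theorem sum_piFinset_one {A : Type*} [DecidableEq A] (S : Finset A) {M : ℕ} (m : Fin M)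
    (G : A → ℝ) (H : A → A → ℝ) :
    ∑ C ∈ Fintype.piFinset (fun _ : Fin M => S),
        G (C m) * ∏ l ∈ Finset.univ.erase m, H (C m) (C l)
      = ∑ a ∈ S, G a * (∑ b ∈ S, H a b) ^ (M - 1) := by
  -- Summing over a value `a` that is forced to equal codeword `m` decouples the remaining factors,
  -- so the sum over codebooks factorizes.
  have h1 : ∀ C ∈ Fintype.piFinset (fun _ : Fin M => S),
      G (C m) * ∏ l ∈ Finset.univ.erase m, H (C m) (C l)
        = ∑ a ∈ S, G a * ∏ l, if l = m then (if C l = a then (1 : ℝ) else 0) else H a (C l) := by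
    intro C hC
    rw [Finset.sum_eq_single_of_mem (C m) (Fintype.mem_piFinset.1 hC m)]
    · rw [← Finset.mul_prod_erase _ _ (Finset.mem_univ m)]
      simp only [if_true, one_mul]
      congr 1
      refine Finset.prod_congr rfl fun l hl => ?_
      rw [if_neg (Finset.ne_of_mem_erase hl)]
    · intro a _ ha
      rw [← Finset.mul_prod_erase _ _ (Finset.mem_univ m)]
      simp [ha.symm]
  rw [Finset.sum_congr rfl h1, Finset.sum_comm]
  refine Finset.sum_congr rfl fun a ha => ?_
  rw [← Finset.mul_sum, sum_piFinset_prod S M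
    (fun l b => if l = m then (if b = a then (1 : ℝ) else 0) else H a b)]
  congr 1
  rw [← Finset.mul_prod_erase _ _ (Finset.mem_univ m)]
  have h2 : ∀ l ∈ Finset.univ.erase m,
      ∑ b ∈ S, (if l = m then (if b = a then (1 : ℝ) else 0) else H a b) = ∑ b ∈ S, H a b := by
    intro l hl
    simp only [if_neg (Finset.ne_of_mem_erase hl)]
  rw [Finset.prod_congr rfl h2, Finset.prod_const, Finset.card_erase_of_mem (Finset.mem_univ m)]
  simp [ha]

theorem sum_piFinset_two {A : Type*} [DecidableEq A] (S : Finset A) {M : ℕ} {m l : Fin M}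
    (hml : l ≠ m) (G : A → A → ℝ) (H : A → A → ℝ) :
    ∑ C ∈ Fintype.piFinset (fun _ : Fin M => S),
        G (C m) (C l) * ∏ k ∈ (Finset.univ.erase m).erase l, H (C l) (C k)
      = ∑ a ∈ S, ∑ b ∈ S, G a b * (∑ c ∈ S, H b c) ^ (M - 2) := by
  have hl : l ∈ Finset.univ.erase m := Finset.mem_erase.2 ⟨hml, Finset.mem_univ l⟩
  have h1 : ∀ C ∈ Fintype.piFinset (fun _ : Fin M => S),
      G (C m) (C l) * ∏ k ∈ (Finset.univ.erase m).erase l, H (C l) (C k)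
        = ∑ a ∈ S, ∑ b ∈ S, G a b * ∏ k, if k = m then (if C k = a then (1 : ℝ) else 0) else
            if k = l then (if C k = b then (1 : ℝ) else 0) else H b (C k) := by
    intro C hC
    rw [Finset.sum_eq_single_of_mem (C m) (Fintype.mem_piFinset.1 hC m)]
    · rw [Finset.sum_eq_single_of_mem (C l) (Fintype.mem_piFinset.1 hC l)]
      · rw [← Finset.mul_prod_erase _ _ (Finset.mem_univ m), ← Finset.mul_prod_erase _ _ hl]
        simp only [if_true, one_mul, if_neg hml]
        congr 1
        refine Finset.prod_congr rfl fun k hk => ?_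
        rw [if_neg (Finset.ne_of_mem_erase (Finset.mem_of_mem_erase hk)),
          if_neg (Finset.ne_of_mem_erase hk)]
      · intro b _ hb
        rw [← Finset.mul_prod_erase _ _ (Finset.mem_univ m), ← Finset.mul_prod_erase _ _ hl]
        simp [hb.symm, hml]
    · intro a _ ha
      refine Finset.sum_eq_zero fun b _ => ?_
      rw [← Finset.mul_prod_erase _ _ (Finset.mem_univ m)]
      simp [ha.symm]
  rw [Finset.sum_congr rfl h1, Finset.sum_comm]
  refine Finset.sum_congr rfl fun a ha => ?_
  rw [Finset.sum_comm]
  refine Finset.sum_congr rfl fun b hb => ?_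
  rw [← Finset.mul_sum, sum_piFinset_prod S M
    (fun k c => if k = m then (if c = a then (1 : ℝ) else 0) else
      if k = l then (if c = b then (1 : ℝ) else 0) else H b c)]
  congr 1
  rw [← Finset.mul_prod_erase _ _ (Finset.mem_univ m), ← Finset.mul_prod_erase _ _ hl]
  have h2 : ∀ k ∈ (Finset.univ.erase m).erase l,
      ∑ c ∈ S, (if k = m then (if c = a then (1 : ℝ) else 0) else
        if k = l then (if c = b then (1 : ℝ) else 0) else H b c) = ∑ c ∈ S, H b c := by
    intro k hk
    simp only [if_neg (Finset.ne_of_mem_erase (Finset.mem_of_mem_erase hk)),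
      if_neg (Finset.ne_of_mem_erase hk)]
  rw [Finset.prod_congr rfl h2, Finset.prod_const, Finset.card_erase_of_mem hl,
    Finset.card_erase_of_mem (Finset.mem_univ m)]
  simp [ha, hb, hml, Nat.sub_sub]

/-- The fraction of the words in the type class of `P` that do not keep `x` off the list
when `y` is received. -/
def passProb (P : X → ℝ) (W : X → Y → ℝ) (T : ℝ) {n : ℕ} (x : Fin n → X) (y : Fin n → Y) : ℝ :=
  (((typeClass P n).filter fun z =>
    T + logLik W (jointType z y) ≤ logLik W (jointType x y)).card : ℝ) / (typeClass P n).card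

/-- The fraction of the words in the type class of `P` that keep `x` off the list
when `y` is received. -/
def blockProb (P : X → ℝ) (W : X → Y → ℝ) (T : ℝ) {n : ℕ} (x : Fin n → X) (y : Fin n → Y) : ℝ :=
  (((typeClass P n).filter fun z =>
    logLik W (jointType x y) < T + logLik W (jointType z y)).card : ℝ) / (typeClass P n).card

theorem passProb_eq {P : X → ℝ} {W : X → Y → ℝ} {T : ℝ} {n : ℕ}
    (hne : (typeClass P n).Nonempty) (x : Fin n → X) (y : Fin n → Y) :
    passProb P W T x y = 1 - blockProb P W T x y := by
  have hK : ((typeClass P n).card : ℝ) ≠ 0 := by exact_mod_cast (Finset.card_pos.2 hne).ne'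
  unfold passProb blockProb
  rw [eq_sub_iff_add_eq, ← add_div, div_eq_one_iff_eq hK]
  have := Finset.card_filter_add_card_filter_not (s := typeClass P n)
    (fun z => T + logLik W (jointType z y) ≤ logLik W (jointType x y))
  simp only [not_le] at this
  exact_mod_cast this

theorem passProb_nonneg (P : X → ℝ) (W : X → Y → ℝ) (T : ℝ) {n : ℕ} (x : Fin n → X)
    (y : Fin n → Y) : 0 ≤ passProb P W T x y := by unfold passProb; positivity

theorem blockProb_nonneg (P : X → ℝ) (W : X → Y → ℝ) (T : ℝ) {n : ℕ} (x : Fin n → X)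
    (y : Fin n → Y) : 0 ≤ blockProb P W T x y := by unfold blockProb; positivity

theorem blockProb_le_one {P : X → ℝ} {W : X → Y → ℝ} {T : ℝ} {n : ℕ}
    (hne : (typeClass P n).Nonempty) (x : Fin n → X) (y : Fin n → Y) :
    blockProb P W T x y ≤ 1 := by
  have := passProb_eq (W := W) (T := T) hne x y
  linarith [passProb_nonneg P W T x y]

theorem ensembleAvg_eq (P : X → ℝ) (n M : ℕ) (F : (Fin M → Fin n → X) → ℝ) :
    ensembleAvg P n M F = (∑ C ∈ Fintype.piFinset (fun _ : Fin M => typeClass P n), F C)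
      / ((typeClass P n).card : ℝ) ^ M := by
  unfold ensembleAvg
  rw [Finset.expect_eq_sum_div_card]
  simp

theorem region_indicator (W : X → Y → ℝ) (T : ℝ) {n M : ℕ} (C : Fin M → Fin n → X) (m : Fin M)
    (g : (Fin n → Y) → ℝ) (y : Fin n → Y) :
    (region W T C m).indicator g y = g y * ∏ l ∈ Finset.univ.erase m,
      if T + logLik W (jointType (C l) y) ≤ logLik W (jointType (C m) y) then 1 else 0 := by
  by_cases h : y ∈ region W T C m
  · rw [Set.indicator_of_mem h, Finset.prod_eq_one, mul_one]
    intro l hl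
    exact if_pos (h l (Finset.ne_of_mem_erase hl))
  · rw [Set.indicator_of_notMem h]
    simp only [region, Set.mem_ofPred_eq, not_forall] at h
    obtain ⟨l, hl, h⟩ := h
    rw [Finset.prod_eq_zero (Finset.mem_erase.2 ⟨hl, Finset.mem_univ l⟩) (if_neg h), mul_zero]

theorem sum_ite_pass (P : X → ℝ) (W : X → Y → ℝ) (T : ℝ) {n : ℕ}
    (hne : (typeClass P n).Nonempty) (x : Fin n → X) (y : Fin n → Y) :
    ∑ z ∈ typeClass P n,
      (if T + logLik W (jointType z y) ≤ logLik W (jointType x y) then (1 : ℝ) else 0)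
      = passProb P W T x y * (typeClass P n).card := by
  have hK : ((typeClass P n).card : ℝ) ≠ 0 := by exact_mod_cast (Finset.card_pos.2 hne).ne'
  unfold passProb
  rw [div_mul_cancel₀ _ hK, Finset.card_filter]
  push_cast
  rfl

/-- Given the sent word and the output, the other `M - 1` codewords are independent, and the sent
word stays on the list exactly when none of them blocks it. -/
theorem ensembleAvg_errorProb (P : X → ℝ) (W : X → Y → ℝ) (T : ℝ) {n M : ℕ} (hM : 1 ≤ M)
    (hne : (typeClass P n).Nonempty) :
    ensembleAvg P n M (errorProb W T) = (∑ x ∈ typeClass P n, ∑ y,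
      wordProb W x y * (1 - passProb P W T x y ^ (M - 1))) / (typeClass P n).card := by
  have hK : ((typeClass P n).card : ℝ) ≠ 0 := by exact_mod_cast (Finset.card_pos.2 hne).ne'
  have hM' : (M : ℝ) ≠ 0 := by exact_mod_cast (by omega : M ≠ 0)
  set K : ℝ := ((typeClass P n).card : ℝ)
  have hKM : K ^ M = K ^ (M - 1) * K := by rw [← pow_succ]; congr 1; omega
  have h1 : ∀ m : Fin M, ∀ y : Fin n → Y,
      ∑ C ∈ Fintype.piFinset (fun _ : Fin M => typeClass P n),
        (region W T C m)ᶜ.indicator (wordProb W (C m)) y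
      = (∑ x ∈ typeClass P n, wordProb W x y * (1 - passProb P W T x y ^ (M - 1)))
          * K ^ (M - 1) := by
    intro m y
    have e1 := sum_piFinset_one (typeClass P n) m (fun x => wordProb W x y) (fun _ _ => 1)
    have e2 := sum_piFinset_one (typeClass P n) m (fun x => wordProb W x y)
      (fun x z => if T + logLik W (jointType z y) ≤ logLik W (jointType x y) then 1 else 0)
    have e3 : ∀ C : Fin M → Fin n → X, (region W T C m)ᶜ.indicator (wordProb W (C m)) y
        = wordProb W (C m) y * (∏ l ∈ Finset.univ.erase m, 1)
          - wordProb W (C m) y * (∏ l ∈ Finset.univ.erase m,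
            if T + logLik W (jointType (C l) y) ≤ logLik W (jointType (C m) y)
              then (1 : ℝ) else 0) := by
      intro C
      rw [← region_indicator, Set.indicator_compl]
      simp
    simp only [e3, Finset.sum_sub_distrib, e1, e2, sum_ite_pass P W T hne]
    rw [Finset.sum_mul, ← Finset.sum_sub_distrib]
    refine Finset.sum_congr rfl fun x _ => ?_
    simp only [Finset.sum_const, nsmul_eq_mul, mul_one]
    rw [mul_pow]; ring
  rw [ensembleAvg_eq]
  unfold errorProb
  rw [← Finset.mul_sum, Finset.sum_comm]
  simp_rw [Finset.sum_comm (s := Fintype.piFinset _), h1]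
  rw [Finset.sum_const, Finset.card_univ, Fintype.card_fin, nsmul_eq_mul, ← Finset.sum_mul,
    Finset.sum_comm, hKM]
  have := pow_ne_zero (M - 1) hK
  field_simp

/-- For a wrong word `z`, the sent word imposes the explicit condition, and the other `M - 2`
codewords must independently fail to block. The factor `M - 1` counts the possible wrong messages.
-/
theorem ensembleAvg_listSize (P : X → ℝ) (W : X → Y → ℝ) (T : ℝ) {n M : ℕ} (hM : 2 ≤ M)
    (hne : (typeClass P n).Nonempty) :
    ensembleAvg P n M (listSize W T) = ((M - 1 : ℕ) : ℝ) * (∑ x ∈ typeClass P n, ∑ y,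
      wordProb W x y * ((∑ z ∈ typeClass P n,
        if T + logLik W (jointType x y) ≤ logLik W (jointType z y)
          then passProb P W T z y ^ (M - 2) else 0)
        / (typeClass P n).card)) / (typeClass P n).card := by
  have hK : ((typeClass P n).card : ℝ) ≠ 0 := by exact_mod_cast (Finset.card_pos.2 hne).ne'
  have hM' : (M : ℝ) ≠ 0 := by exact_mod_cast (by omega : M ≠ 0)
  set K : ℝ := ((typeClass P n).card : ℝ)
  have hKM : K ^ M = K ^ (M - 2) * (K * K) := by rw [← pow_two, ← pow_add]; congr 1; omega
  set A : ℝ := ∑ x ∈ typeClass P n, ∑ y,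
      wordProb W x y * (∑ z ∈ typeClass P n,
        if T + logLik W (jointType x y) ≤ logLik W (jointType z y)
          then passProb P W T z y ^ (M - 2) else 0) with hA
  have h1 : ∀ m : Fin M, ∀ l ∈ Finset.univ.erase m,
      ∑ y : Fin n → Y, ∑ C ∈ Fintype.piFinset (fun _ : Fin M => typeClass P n),
        (region W T C l).indicator (wordProb W (C m)) y
      = A * K ^ (M - 2) := by
    intro m l hl
    have hlm := Finset.ne_of_mem_erase hl
    have hm : m ∈ Finset.univ.erase l := Finset.mem_erase.2 ⟨hlm.symm, Finset.mem_univ m⟩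
    rw [hA, Finset.sum_mul]
    simp_rw [Finset.sum_mul]
    rw [Finset.sum_comm (s := typeClass P n)]
    refine Finset.sum_congr rfl fun y _ => ?_
    have e2 := sum_piFinset_two (typeClass P n) hlm
      (fun x z => wordProb W x y *
        (if T + logLik W (jointType x y) ≤ logLik W (jointType z y) then 1 else 0))
      (fun z z' => if T + logLik W (jointType z' y) ≤ logLik W (jointType z y) then 1 else 0)
    have e3 : ∀ C : Fin M → Fin n → X, (region W T C l).indicator (wordProb W (C m)) y
        = wordProb W (C m) y *
          (if T + logLik W (jointType (C m) y) ≤ logLik W (jointType (C l) y) then 1 else 0) *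
          (∏ k ∈ (Finset.univ.erase m).erase l,
            if T + logLik W (jointType (C k) y) ≤ logLik W (jointType (C l) y)
              then (1 : ℝ) else 0) := by
      intro C
      rw [region_indicator, ← Finset.mul_prod_erase _ _ hm, Finset.erase_right_comm]
      ring
    simp only [e3, e2, sum_ite_pass P W T hne]
    refine Finset.sum_congr rfl fun x _ => ?_
    rw [Finset.mul_sum, Finset.sum_mul]
    refine Finset.sum_congr rfl fun z _ => ?_
    split_ifs
    · rw [mul_pow]; ring
    · ring
  rw [ensembleAvg_eq]
  unfold listSize
  rw [← Finset.mul_sum, Finset.sum_comm]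
  have h2 : ∀ m : Fin M, ∑ C ∈ Fintype.piFinset (fun _ : Fin M => typeClass P n),
      ∑ l ∈ Finset.univ.erase m, ∑ y, (region W T C l).indicator (wordProb W (C m)) y
      = ((M - 1 : ℕ) : ℝ) * (A * K ^ (M - 2)) := by
    intro m
    rw [Finset.sum_comm]
    simp_rw [Finset.sum_comm (s := Fintype.piFinset _)]
    rw [Finset.sum_congr rfl (h1 m), Finset.sum_const,
      Finset.card_erase_of_mem (Finset.mem_univ m), Finset.card_univ, Fintype.card_fin,
      nsmul_eq_mul]
  simp_rw [h2]
  rw [Finset.sum_const, Finset.card_univ, Fintype.card_fin, nsmul_eq_mul, hKM]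
  simp_rw [← mul_div_assoc, ← Finset.sum_div]
  rw [← hA]
  have := pow_ne_zero (M - 2) hK
  field_simp

end Ensemble

/-! ### Words of prescribed joint type -/

section Words

/-- The index set is put in bijection with a disjoint union of blocks of sizes `c a`. -/
theorem exists_cnt_eq {ι Z : Type*} [Fintype ι] [Fintype Z] [DecidableEq Z] (c : Z → ℕ)
    (h : ∑ a, c a = Fintype.card ι) : ∃ z : ι → Z, cnt z = c := by
  have hc : Fintype.card ι = Fintype.card (Σ a, Fin (c a)) := by
    rw [Fintype.card_sigma]; simp [h]
  let e := Fintype.equivOfCardEq hc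
  refine ⟨fun i => (e i).1, ?_⟩
  funext a
  unfold cnt
  rw [← Fintype.card_subtype, Fintype.card_congr
    (e.subtypeEquiv (p := fun i => (e i).1 = a) (q := fun s => s.1 = a) fun _ => Iff.rfl),
    Fintype.card_congr (Equiv.sigmaSubtype (β := fun a => Fin (c a)) a), Fintype.card_fin]

variable [DecidableEq X] [DecidableEq Y]

theorem sum_cnt_pair_right {ι : Type*} [Fintype ι] (x : ι → X) (y : ι → Y) (a : X) :
    ∑ b, cnt (fun i => (x i, y i)) (a, b) = cnt x a := by
  unfold cnt
  rw [Finset.card_eq_sum_card_fiberwise (s := Finset.univ.filter fun i => x i = a)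
    (f := y) (t := Finset.univ) (fun _ _ => by simp)]
  refine Finset.sum_congr rfl fun b _ => ?_
  rw [Finset.filter_filter]
  simp only [Prod.mk.injEq]

theorem sum_cnt_pair_left {ι : Type*} [Fintype ι] (x : ι → X) (y : ι → Y) (b : Y) :
    ∑ a, cnt (fun i => (x i, y i)) (a, b) = cnt y b := by
  unfold cnt
  rw [Finset.card_eq_sum_card_fiberwise (s := Finset.univ.filter fun i => y i = b)
    (f := x) (t := Finset.univ) (fun _ _ => by simp)]
  refine Finset.sum_congr rfl fun a _ => ?_
  rw [Finset.filter_filter]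
  simp only [Prod.mk.injEq, and_comm]

/-- A matrix of natural numbers with prescribed row and column sums. -/
theorem exists_matrix_of_margins (r : X → ℕ) (c : Y → ℕ) (h : ∑ a, r a = ∑ b, c b) :
    ∃ R : X → Y → ℕ, (∀ a, ∑ b, R a b = r a) ∧ ∀ b, ∑ a, R a b = c b := by
  -- Two words with letter counts `r` and `c` are written side by side; their joint counts form the
  -- matrix.
  obtain ⟨α, hα⟩ := exists_cnt_eq (ι := Fin (∑ a, r a)) r (by simp)
  obtain ⟨β, hβ⟩ := exists_cnt_eq (ι := Fin (∑ a, r a)) c (by simp [h])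
  refine ⟨fun a b => cnt (fun i => (α i, β i)) (a, b), fun a => ?_, fun b => ?_⟩
  · rw [sum_cnt_pair_right, hα]
  · rw [sum_cnt_pair_left, hβ]

/-- On each fibre of `y`, a word with the prescribed column counts is chosen separately. -/
theorem exists_cnt_pair_eq {ι : Type*} [Fintype ι] (y : ι → Y) (N : X → Y → ℕ)
    (h : ∀ b, ∑ a, N a b = cnt y b) :
    ∃ x : ι → X, ∀ a b, cnt (fun i => (x i, y i)) (a, b) = N a b := by
  have h1 : ∀ b, ∃ x : {i // y i = b} → X, cnt x = fun a => N a b := by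
    intro b
    refine exists_cnt_eq _ ?_
    rw [h b, Fintype.card_subtype]; rfl
  choose x hx using h1
  refine ⟨fun i => x (y i) ⟨i, rfl⟩, fun a b => ?_⟩
  rw [← congrFun (hx b) a]
  unfold cnt
  symm
  refine Finset.card_bij (fun i _ => i.1) ?_ ?_ ?_
  · rintro ⟨i, rfl⟩ hi
    simpa using hi
  · intro i _ j _ hij
    exact Subtype.ext hij
  · intro i hi
    simp only [Finset.mem_filter, Finset.mem_univ, true_and, Prod.mk.injEq] at hi
    obtain ⟨h1, rfl⟩ := hi
    exact ⟨⟨i, rfl⟩, by simpa using h1, rfl⟩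

theorem jointType_eq_cnt {n : ℕ} (x : Fin n → X) (y : Fin n → Y) (a : X) (b : Y) :
    jointType x y a b = (cnt (fun i => (x i, y i)) (a, b) : ℝ) / n := jointType_eq_wtype x y a b

theorem exists_jointType_near {P : X → ℝ} {n : ℕ} (hn : n ≠ 0)
    (hne : (typeClass P n).Nonempty) (y : Fin n → Y) {Q : X → Y → ℝ} (hQ : Q ∈ jointDists P)
    (hy : margY Q = wtype y) :
    ∃ x ∈ typeClass P n, ∀ a b,
      |jointType x y a b - Q a b| ≤ ((Fintype.card X * Fintype.card Y : ℕ) + 1) / n := by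
  obtain ⟨x0, hx0⟩ := hne
  have hn0 : (0 : ℝ) < n := by exact_mod_cast Nat.pos_of_ne_zero hn
  have hP : ∀ a, n * P a = cnt x0 a := by
    intro a
    rw [← mem_typeClass.1 hx0]; unfold wtype; field_simp
  have hq : ∀ b, n * margY Q b = cnt y b := by
    intro b
    rw [hy]; unfold wtype; field_simp
  set N : X → Y → ℕ := fun a b => ⌊n * Q a b⌋₊ with hN
  have hQn : ∀ a b, 0 ≤ n * Q a b := fun a b => mul_nonneg hn0.le (hQ.1 a b)
  have hNle : ∀ a b, (N a b : ℝ) ≤ n * Q a b := fun a b => Nat.floor_le (hQn a b)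
  have hNlt : ∀ a b, n * Q a b < N a b + 1 := fun a b => Nat.lt_floor_add_one _
  have hrow : ∀ a, ∑ b, N a b ≤ cnt x0 a := by
    intro a
    have : ((∑ b, N a b : ℕ) : ℝ) ≤ cnt x0 a := by
      push_cast
      rw [← hP, ← hQ.2 a, Finset.mul_sum]
      exact Finset.sum_le_sum fun b _ => hNle a b
    exact_mod_cast this
  have hcol : ∀ b, ∑ a, N a b ≤ cnt y b := by
    intro b
    have : ((∑ a, N a b : ℕ) : ℝ) ≤ cnt y b := by
      push_cast
      rw [← hq]
      unfold margY
      rw [Finset.mul_sum]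
      exact Finset.sum_le_sum fun a _ => hNle a b
    exact_mod_cast this
  have hrs : ∑ a, (cnt x0 a - ∑ b, N a b) = n - ∑ a, ∑ b, N a b := by
    rw [Finset.sum_tsub_distrib _ fun a _ => hrow a, sum_cnt, Fintype.card_fin]
  have hcs : ∑ b, (cnt y b - ∑ a, N a b) = n - ∑ a, ∑ b, N a b := by
    rw [Finset.sum_tsub_distrib _ fun a _ => hcol a, sum_cnt, Fintype.card_fin,
      Finset.sum_comm]
  -- Rounding `n * Q` down leaves integer deficits in rows and columns with equal totals, at most
  -- `|X| |Y|`. A nonnegative integer matrix with these margins restores both margins exactly and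
  -- changes each entry boundedly.
  obtain ⟨R, hR1, hR2⟩ := exists_matrix_of_margins (fun a => cnt x0 a - ∑ b, N a b)
    (fun b => cnt y b - ∑ a, N a b) (hrs.trans hcs.symm)
  obtain ⟨x, hx⟩ := exists_cnt_pair_eq y (fun a b => N a b + R a b) (by
    intro b
    rw [Finset.sum_add_distrib, hR2]
    have := hcol b
    omega)
  have htot : (n : ℝ) ≤ ∑ a, ∑ b, (N a b : ℝ) + Fintype.card X * Fintype.card Y := by
    have h1 : (n : ℝ) = ∑ a, ∑ b, n * Q a b := by
      have := sum_cnt x0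
      rw [Fintype.card_fin] at this
      calc (n : ℝ) = ∑ a, (cnt x0 a : ℝ) := by exact_mod_cast this.symm
        _ = _ := by
          refine Finset.sum_congr rfl fun a _ => ?_
          rw [← hP, ← hQ.2 a, Finset.mul_sum]
    rw [h1]
    calc _ ≤ ∑ a, ∑ b, ((N a b : ℝ) + 1) :=
          Finset.sum_le_sum fun a _ => Finset.sum_le_sum fun b _ => (hNlt a b).le
      _ = _ := by
          simp only [Finset.sum_add_distrib, Finset.sum_const, Finset.card_univ, nsmul_eq_mul,
            mul_one]
  have hRle : ∀ a b, (R a b : ℝ) ≤ Fintype.card X * Fintype.card Y := by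
    intro a b
    have h1 : R a b ≤ n - ∑ a, ∑ b, N a b := by
      calc R a b ≤ ∑ b, R a b :=
            Finset.single_le_sum (f := fun b => R a b) (fun _ _ => Nat.zero_le _)
              (Finset.mem_univ b)
        _ = _ := hR1 a
        _ ≤ ∑ a, (cnt x0 a - ∑ b, N a b) :=
            Finset.single_le_sum (f := fun a => cnt x0 a - ∑ b, N a b)
              (fun _ _ => Nat.zero_le _) (Finset.mem_univ a)
        _ = _ := hrs
    have h2 : n ≤ (∑ a, ∑ b, N a b) + Fintype.card X * Fintype.card Y := by
      exact_mod_cast htot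
    have h3 : R a b ≤ Fintype.card X * Fintype.card Y := by omega
    exact_mod_cast h3
  refine ⟨x, ?_, fun a b => ?_⟩
  · rw [mem_typeClass, ← mem_typeClass.1 hx0, wtype_eq_iff]
    funext a
    rw [← sum_cnt_pair_right x y a]
    simp only [hx, Finset.sum_add_distrib, hR1]
    have := hrow a
    omega
  · rw [jointType_eq_cnt, hx]
    have h1 := hRle a b
    have h2 := hNle a b
    have h3 := hNlt a b
    have h4 : (0 : ℝ) ≤ R a b := by positivity
    have e : ((N a b + R a b : ℕ) : ℝ) / n - Q a b = (N a b + R a b - n * Q a b) / n := by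
      push_cast; field_simp
    rw [e, abs_div, abs_of_pos hn0]
    push_cast
    gcongr
    rw [abs_le]
    constructor
    · have : (0 : ℝ) ≤ Fintype.card X * Fintype.card Y := by positivity
      linarith
    · linarith

end Words

/-! ### Rational approximation -/

/-- Finitely many reals can be approximated by rationals that satisfy the same
rational linear relations. -/
theorem exists_rat_linearMap {ι : Type*} [Fintype ι] (v : ι → ℝ) {ε : ℝ} (hε : 0 < ε) :
    ∃ φ : ℝ →ₗ[ℚ] ℚ, φ 1 = 1 ∧ ∀ i, |(φ (v i) : ℝ) - v i| < ε := by
  classical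
  -- A basis of `ℝ` over `ℚ` containing 1 is used: each basis element is sent to a nearby rational,
  -- and 1 to itself. Rational linear relations then survive automatically. Only finitely many
  -- coefficients enter; their absolute sum `S` fixes the precision `ε / (S + 1)`.
  have hli : LinearIndepOn ℚ id ({1} : Set ℝ) :=
    LinearIndepOn.singleton (R := ℚ) (v := id) (i := (1 : ℝ)) one_ne_zero
  let b := Module.Basis.extend hli
  have h1 : (1 : ℝ) ∈ hli.extend (Set.subset_univ _) :=
    hli.subset_extend _ (Set.mem_singleton 1)
  let c : ι → ℝ := fun i => ∑ j ∈ (b.repr (v i)).support, |((b.repr (v i) j : ℚ) : ℝ)|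
  have hc : ∀ i, 0 ≤ c i := fun i => Finset.sum_nonneg fun _ _ => abs_nonneg _
  set S := ∑ i, c i
  have hS : 0 ≤ S := Finset.sum_nonneg fun i _ => hc i
  set δ := ε / (S + 1)
  have hδ : 0 < δ := by positivity
  have hρ : ∀ j : hli.extend (Set.subset_univ _), ∃ r : ℚ, |(r : ℝ) - j| < δ ∧
      ((j : ℝ) = 1 → r = 1) := by
    intro j
    by_cases hj : (j : ℝ) = 1
    · exact ⟨1, by simpa [hj] using hδ, fun _ => rfl⟩
    · obtain ⟨r, hr⟩ := exists_rat_near (j : ℝ) hδ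
      exact ⟨r, by rwa [abs_sub_comm], fun h => absurd h hj⟩
  choose ρ hρ1 hρ2 using hρ
  have hb : ∀ j, b j = (j : ℝ) := fun j => Module.Basis.extend_apply_self hli j
  refine ⟨b.constr ℚ ρ, ?_, fun i => ?_⟩
  · have := Module.Basis.constr_basis b ℚ ρ ⟨1, h1⟩
    rw [hb] at this
    rw [this]
    exact hρ2 _ rfl
  · have e1 : ((b.constr ℚ ρ (v i) : ℚ) : ℝ)
        = ∑ j ∈ (b.repr (v i)).support, ((b.repr (v i) j : ℚ) : ℝ) * ρ j := by
      rw [Module.Basis.constr_apply, Finsupp.sum]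
      push_cast [smul_eq_mul]
      rfl
    have e2 : v i = ∑ j ∈ (b.repr (v i)).support, ((b.repr (v i) j : ℚ) : ℝ) * j := by
      conv_lhs => rw [← b.linearCombination_repr (v i), Finsupp.linearCombination_apply,
        Finsupp.sum]
      refine Finset.sum_congr rfl fun j _ => ?_
      rw [hb, Rat.smul_def]
    have e3 : (b.constr ℚ ρ (v i) : ℝ) - v i
        = ∑ j ∈ (b.repr (v i)).support, ((b.repr (v i) j : ℚ) : ℝ) * (ρ j - j) := by
      simp only [mul_sub]
      rw [Finset.sum_sub_distrib, ← e1, ← e2]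
    rw [e3]
    calc _ ≤ ∑ j ∈ (b.repr (v i)).support, |((b.repr (v i) j : ℚ) : ℝ)| * δ := by
          refine (Finset.abs_sum_le_sum_abs _ _).trans (Finset.sum_le_sum fun j _ => ?_)
          rw [abs_mul]
          gcongr
          exact (hρ1 j).le
      _ = c i * δ := by rw [← Finset.sum_mul]
      _ ≤ S * δ := by
          gcongr
          exact Finset.single_le_sum (fun i _ => hc i) (Finset.mem_univ i)
      _ < (S + 1) * δ := by linarith
      _ = ε := by simp only [δ]; field_simp

/-- A pair of joint distributions with the same margins can be approximated by rational ones,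
without enlarging the supports. -/
theorem exists_rat_pair {P : X → ℝ} (hP_rat : ∀ x, ∃ r : ℚ, P x = r) {Q₁ Q₂ : X → Y → ℝ}
    (h₁ : Q₁ ∈ jointDists P) (h₂ : Q₂ ∈ jointDists P) (hY : margY Q₁ = margY Q₂)
    {ε : ℝ} (hε : 0 < ε) :
    ∃ R₁ R₂ : X → Y → ℚ, (fun x y => (R₁ x y : ℝ)) ∈ jointDists P ∧
      (fun x y => (R₂ x y : ℝ)) ∈ jointDists P ∧
      margY (fun x y => (R₁ x y : ℝ)) = margY (fun x y => (R₂ x y : ℝ)) ∧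
      (∀ x y, |(R₁ x y : ℝ) - Q₁ x y| < ε) ∧ (∀ x y, |(R₂ x y : ℝ) - Q₂ x y| < ε) ∧
      ∀ x y, Q₂ x y = 0 → R₂ x y = 0 := by
  classical
  let v : Bool × X × Y → ℝ := fun i => if i.1 then Q₁ i.2.1 i.2.2 else Q₂ i.2.1 i.2.2
  have hv : ∀ i, 0 ≤ v i := by
    rintro ⟨_ | _, x, y⟩
    · exact h₂.1 x y
    · exact h₁.1 x y
  -- A precision below the smallest positive entry keeps the approximations nonnegative; zeros are
  -- preserved by linearity.
  obtain ⟨η, hη, hηv⟩ : ∃ η > 0, ∀ i, v i = 0 ∨ η ≤ v i := by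
    have : ∀ s : Finset (Bool × X × Y), ∃ η > 0, ∀ i ∈ s, v i = 0 ∨ η ≤ v i := by
      intro s
      induction s using Finset.induction_on with
      | empty => exact ⟨1, one_pos, by simp⟩
      | insert i s _ ih =>
        obtain ⟨η, hη, h⟩ := ih
        rcases (hv i).eq_or_lt with h0 | h0
        · refine ⟨η, hη, fun j hj => ?_⟩
          rcases Finset.mem_insert.1 hj with rfl | hj
          · exact Or.inl h0.symm
          · exact h j hj
        · refine ⟨min η (v i), lt_min hη h0, fun j hj => ?_⟩
          rcases Finset.mem_insert.1 hj with rfl | hj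
          · exact Or.inr (min_le_right _ _)
          · exact (h j hj).imp_right fun h => (min_le_left _ _).trans h
    obtain ⟨η, hη, h⟩ := this Finset.univ
    exact ⟨η, hη, fun i => h i (Finset.mem_univ i)⟩
  obtain ⟨φ, hφ1, hφ⟩ := exists_rat_linearMap v (lt_min hε hη)
  have hφnn : ∀ i, (0 : ℝ) ≤ φ (v i) := by
    intro i
    rcases hηv i with h | h
    · rw [h, map_zero]; simp
    · have := (abs_lt.1 (hφ i)).1
      linarith [min_le_right ε η]
  have hφP : ∀ x, (φ (P x) : ℝ) = P x := by
    intro x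
    obtain ⟨r, hr⟩ := hP_rat x
    have : φ (r : ℝ) = r := by
      have h := φ.map_smul r 1
      rw [hφ1, Rat.smul_def, mul_one, smul_eq_mul, mul_one] at h
      exact h
    rw [hr, this]
  have hrow : ∀ Q : X → Y → ℝ, (∀ x, ∑ y, Q x y = P x) →
      ∀ x, ∑ y, ((φ (Q x y) : ℚ) : ℝ) = P x := by
    intro Q hQ x
    rw [← hφP x, ← hQ x, map_sum]
    push_cast
    rfl
  refine ⟨fun x y => φ (Q₁ x y), fun x y => φ (Q₂ x y),
    ⟨fun x y => hφnn (true, x, y), hrow Q₁ h₁.2⟩,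
    ⟨fun x y => hφnn (false, x, y), hrow Q₂ h₂.2⟩, ?_,
    fun x y => (hφ (true, x, y)).trans_le (min_le_left _ _),
    fun x y => (hφ (false, x, y)).trans_le (min_le_left _ _), fun x y h => by
      simp only [h, map_zero]⟩
  funext y
  have := congrArg φ (congrFun hY y)
  unfold margY at this ⊢
  rw [map_sum, map_sum] at this
  dsimp only
  exact_mod_cast this

theorem exists_common_denominator {ι : Type*} [Fintype ι] (v : ι → ℚ) (hv : ∀ i, 0 ≤ v i) :
    ∃ d : ℕ, 0 < d ∧ ∀ k : ℕ, ∃ N : ι → ℕ, ∀ i, ((N i : ℕ) : ℚ) = (k * d : ℕ) * v i := by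
  classical
  refine ⟨∏ i, (v i).den, Finset.prod_pos fun i _ => (v i).pos, fun k => ?_⟩
  refine ⟨fun i => k * ((v i).num.toNat * ∏ j ∈ Finset.univ.erase i, (v j).den), fun i => ?_⟩
  rw [← Finset.mul_prod_erase _ _ (Finset.mem_univ i)]
  have h1 : (((v i).num.toNat : ℕ) : ℚ) = (v i).den * v i := by
    rw [Rat.den_mul_eq_num]
    exact_mod_cast Int.toNat_of_nonneg (Rat.num_nonneg.2 (hv i))
  push_cast at h1 ⊢
  rw [h1]; ring

/-- At multiples of a common denominator, the rational pair is realized exactly, with one output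
word for both components. Infinitely many lengths suffice, because the exponents are lower limits.
-/
theorem frequently_jointType_eq [DecidableEq X] [DecidableEq Y] {P : X → ℝ}
    (hP_sum : ∑ x, P x = 1) {R₁ R₂ : X → Y → ℚ}
    (h₁ : (fun x y => (R₁ x y : ℝ)) ∈ jointDists P)
    (h₂ : (fun x y => (R₂ x y : ℝ)) ∈ jointDists P)
    (hY : margY (fun x y => (R₁ x y : ℝ)) = margY (fun x y => (R₂ x y : ℝ))) :
    ∃ᶠ n in blockLengths P, ∃ x₁ ∈ typeClass P n, ∃ x₂ ∈ typeClass P n, ∃ y : Fin n → Y,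
      jointType x₁ y = (fun x y => (R₁ x y : ℝ)) ∧ jointType x₂ y = fun x y => (R₂ x y : ℝ) := by
  obtain ⟨d, hd, hN⟩ := exists_common_denominator
    (fun i : Bool × X × Y => if i.1 then R₁ i.2.1 i.2.2 else R₂ i.2.1 i.2.2) (by
      rintro ⟨_ | _, x, y⟩
      · have := h₂.1 x y
        simpa using this
      · have := h₁.1 x y
        simpa using this)
  unfold blockLengths
  rw [Filter.frequently_inf_principal, Filter.frequently_atTop]
  intro n₀
  refine ⟨(n₀ + 1) * d, by nlinarith, ?_⟩
  obtain ⟨N, hN⟩ := hN (n₀ + 1)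
  set n := (n₀ + 1) * d with hn
  have hn0 : n ≠ 0 := by positivity
  have hn0' : (n : ℝ) ≠ 0 := by exact_mod_cast hn0
  have e₁ : ∀ x y, (N (true, x, y) : ℝ) = n * R₁ x y := fun x y => by
    have := hN (true, x, y)
    simp only [if_true] at this
    exact_mod_cast this
  have e₂ : ∀ x y, (N (false, x, y) : ℝ) = n * R₂ x y := fun x y => by
    have := hN (false, x, y)
    simp only [Bool.false_eq_true, if_false] at this
    exact_mod_cast this
  have hsum : ∑ b, ∑ a, N (true, a, b) = Fintype.card (Fin n) := by
    have : ((∑ b, ∑ a, N (true, a, b) : ℕ) : ℝ) = n := by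
      push_cast
      rw [Finset.sum_comm]
      simp only [e₁, ← Finset.mul_sum, h₁.2, hP_sum, mul_one]
    rw [Fintype.card_fin]
    exact_mod_cast this
  obtain ⟨y, hy⟩ := exists_cnt_eq (fun b => ∑ a, N (true, a, b)) hsum
  obtain ⟨x₁, hx₁⟩ := exists_cnt_pair_eq y (fun a b => N (true, a, b)) (fun b => by rw [hy])
  obtain ⟨x₂, hx₂⟩ := exists_cnt_pair_eq y (fun a b => N (false, a, b)) (fun b => by
    rw [hy]
    have := congrFun hY b
    unfold margY at this
    have h : ((∑ a, N (false, a, b) : ℕ) : ℝ) = (∑ a, N (true, a, b) : ℕ) := by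
      push_cast
      simp only [e₁, e₂, ← Finset.mul_sum, this]
    exact_mod_cast h)
  have j₁ : jointType x₁ y = fun x y => (R₁ x y : ℝ) := by
    funext a b
    rw [jointType_eq_cnt, hx₁, e₁]; field_simp
  have j₂ : jointType x₂ y = fun x y => (R₂ x y : ℝ) := by
    funext a b
    rw [jointType_eq_cnt, hx₂, e₂]; field_simp
  have t₁ : x₁ ∈ typeClass P n := by
    rw [mem_typeClass, ← margX_jointType x₁ y, j₁]; exact funext h₁.2
  have t₂ : x₂ ∈ typeClass P n := by
    rw [mem_typeClass, ← margX_jointType x₂ y, j₂]; exact funext h₂.2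
  exact ⟨⟨x₁, t₁⟩, x₁, t₁, x₂, t₂, y, j₁, j₂⟩

/-! ### Continuity and convexity of the single-letter quantities -/

theorem continuous_negEnt {Z : Type*} [Fintype Z] : Continuous (negEnt : (Z → ℝ) → ℝ) :=
  continuous_finsetSum _ fun a _ => Real.continuous_mul_log.comp (continuous_apply a)

theorem continuous_entry (x : X) (y : Y) : Continuous fun Q : X → Y → ℝ => Q x y :=
  (continuous_apply y).comp (continuous_apply x)

theorem continuous_jointNegEnt : Continuous (jointNegEnt : (X → Y → ℝ) → ℝ) :=
  continuous_finsetSum _ fun x _ => continuous_finsetSum _ fun y _ =>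
    Real.continuous_mul_log.comp (continuous_entry x y)

theorem continuous_margY : Continuous (margY : (X → Y → ℝ) → Y → ℝ) :=
  continuous_pi fun y => continuous_finsetSum _ fun x _ => continuous_entry x y

theorem continuous_logLik (W : X → Y → ℝ) : Continuous (logLik W) :=
  continuous_finsetSum _ fun x _ => continuous_finsetSum _ fun y _ =>
    (continuous_entry x y).mul continuous_const

theorem continuousOn_mutualInfo (P : X → ℝ) :
    ContinuousOn (mutualInfo : (X → Y → ℝ) → ℝ) (jointDists P) :=
  ((continuous_jointNegEnt.sub continuous_const).sub
    (continuous_negEnt.comp continuous_margY)).continuousOn.congr fun _ hQ => mutualInfo_eq hQ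

theorem continuousOn_condDiv {P : X → ℝ} {W : X → Y → ℝ} (hW : ∀ x, 0 < P x → ∀ y, 0 < W x y) :
    ContinuousOn (condDiv W) (jointDists P) :=
  ((continuous_jointNegEnt.sub continuous_const).sub
    (continuous_logLik W)).continuousOn.congr fun _ hQ => condDiv_eq hW hQ

theorem isClosed_jointDists (P : X → ℝ) : IsClosed (jointDists (Y := Y) P) := by
  have : jointDists (Y := Y) P = (⋂ x, ⋂ y, {Q | 0 ≤ Q x y}) ∩ ⋂ x, {Q | ∑ y, Q x y = P x} := by
    ext Q; simp [jointDists]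
  rw [this]
  refine (isClosed_iInter fun x => isClosed_iInter fun y =>
    isClosed_le continuous_const (continuous_entry x y)).inter (isClosed_iInter fun x =>
      isClosed_eq (continuous_finsetSum _ fun y _ => continuous_entry x y) continuous_const)

theorem isCompact_jointDists (P : X → ℝ) : IsCompact (jointDists (Y := Y) P) := by
  refine IsCompact.of_isClosed_subset
    (isCompact_univ_pi fun x => isCompact_univ_pi fun _ => isCompact_Icc (a := (0 : ℝ)) (b := P x))
    (isClosed_jointDists P) fun Q hQ => ?_
  simp only [Set.mem_pi, Set.mem_univ, true_implies]
  intro x y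
  exact ⟨hQ.1 x y, (le_margX hQ.1 x y).trans_eq (hQ.2 x)⟩

theorem margY_nonneg {P : X → ℝ} {Q : X → Y → ℝ} (hQ : Q ∈ jointDists P) (y : Y) :
    0 ≤ margY Q y := Finset.sum_nonneg fun x _ => hQ.1 x y

theorem sum_margY {P : X → ℝ} (hP : ∑ x, P x = 1) {Q : X → Y → ℝ} (hQ : Q ∈ jointDists P) :
    ∑ y, margY Q y = 1 := by
  unfold margY
  rw [Finset.sum_comm]
  simp only [hQ.2, hP]

/-- The mixture `(1 - t) Q + t Q'`. -/
def mix (t : ℝ) (Q Q' : X → Y → ℝ) : X → Y → ℝ := fun x y => (1 - t) * Q x y + t * Q' x y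

theorem mix_zero (Q Q' : X → Y → ℝ) : mix 0 Q Q' = Q := by
  funext x y; simp [mix]

theorem mix_mem {P : X → ℝ} {Q Q' : X → Y → ℝ} (hQ : Q ∈ jointDists P)
    (hQ' : Q' ∈ jointDists P) {t : ℝ} (h0 : 0 ≤ t) (h1 : t ≤ 1) : mix t Q Q' ∈ jointDists P := by
  refine ⟨fun x y => ?_, fun x => ?_⟩
  · have := hQ.1 x y
    have := hQ'.1 x y
    have : 0 ≤ 1 - t := by linarith
    unfold mix; positivity
  · simp only [mix, Finset.sum_add_distrib, ← Finset.mul_sum, hQ.2, hQ'.2]; ring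

theorem margY_mix (t : ℝ) (Q Q' : X → Y → ℝ) (y : Y) :
    margY (mix t Q Q') y = (1 - t) * margY Q y + t * margY Q' y := by
  simp only [mix, margY, Finset.sum_add_distrib, ← Finset.mul_sum]

theorem margY_mix_of_eq {Q Q' : X → Y → ℝ} (h : margY Q' = margY Q) (t : ℝ) :
    margY (mix t Q Q') = margY Q := by
  funext y; rw [margY_mix, h]; ring

theorem logLik_mix (W : X → Y → ℝ) (t : ℝ) (Q Q' : X → Y → ℝ) :
    logLik W (mix t Q Q') = (1 - t) * logLik W Q + t * logLik W Q' := by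
  simp only [logLik, mix, Finset.mul_sum, ← Finset.sum_add_distrib]
  refine Finset.sum_congr rfl fun x _ => Finset.sum_congr rfl fun y _ => ?_
  ring

theorem continuous_mix (Q Q' : X → Y → ℝ) : Continuous fun t : ℝ => mix t Q Q' := by
  refine continuous_pi fun x => continuous_pi fun y => ?_
  unfold mix; fun_prop

/-- The two-term log sum inequality. -/
theorem log_sum_two {a b c d : ℝ} (ha : 0 ≤ a) (hb : 0 ≤ b) (hc : 0 ≤ c) (hd : 0 ≤ d)
    (hca : c = 0 → a = 0) (hdb : d = 0 → b = 0) :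
    (a + b) * Real.log ((a + b) / (c + d)) ≤ a * Real.log (a / c) + b * Real.log (b / d) := by
  rcases hc.eq_or_lt with hc0 | hc0
  · simp [hca hc0.symm, ← hc0]
  rcases hd.eq_or_lt with hd0 | hd0
  · simp [hdb hd0.symm, ← hd0]
  have hcd : 0 < c + d := by positivity
  have hx : a / c ∈ Set.Ici (0 : ℝ) := Set.mem_Ici.2 (by positivity)
  have hy : b / d ∈ Set.Ici (0 : ℝ) := Set.mem_Ici.2 (by positivity)
  have hs : c / (c + d) + d / (c + d) = 1 := by field_simp
  have := Real.convexOn_mul_log.2 hx hy (by positivity) (by positivity) hs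
  simp only [smul_eq_mul] at this
  have e : c / (c + d) * (a / c) + d / (c + d) * (b / d) = (a + b) / (c + d) := by field_simp
  rw [e] at this
  calc _ = (c + d) * ((a + b) / (c + d) * Real.log ((a + b) / (c + d))) := by field_simp
    _ ≤ (c + d) * (c / (c + d) * (a / c * Real.log (a / c))
        + d / (c + d) * (b / d * Real.log (b / d))) := by gcongr
    _ = _ := by field_simp

theorem scaled_mul_log (t a c : ℝ) :
    t * a * Real.log (t * a / (t * c)) = t * (a * Real.log (a / c)) := by
  rcases eq_or_ne t 0 with rfl | ht
  · simp
  · rw [mul_div_mul_left _ _ ht]; ring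

/-- With the input marginal fixed, the reference product `P x * margY Q y` is linear in `Q`, so the
log sum inequality applies entry by entry. -/
theorem mutualInfo_mix_le {P : X → ℝ} {Q Q' : X → Y → ℝ} (hQ : Q ∈ jointDists P)
    (hQ' : Q' ∈ jointDists P) {t : ℝ} (h0 : 0 ≤ t) (h1 : t ≤ 1) :
    mutualInfo (mix t Q Q') ≤ (1 - t) * mutualInfo Q + t * mutualInfo Q' := by
  unfold mutualInfo
  rw [Finset.mul_sum, Finset.mul_sum, ← Finset.sum_add_distrib]
  refine Finset.sum_le_sum fun x _ => ?_
  rw [Finset.mul_sum, Finset.mul_sum, ← Finset.sum_add_distrib]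
  refine Finset.sum_le_sum fun y _ => ?_
  rw [margX_of_mem hQ, margX_of_mem hQ', margX_of_mem (mix_mem hQ hQ' h0 h1), margY_mix]
  have h1' : 0 ≤ 1 - t := by linarith
  have hPx : 0 ≤ P x := by
    rw [← hQ.2 x]; exact Finset.sum_nonneg fun y _ => hQ.1 x y
  have hz : ∀ {A : X → Y → ℝ}, A ∈ jointDists P → P x * margY A y = 0 → A x y = 0 := by
    intro A hA h
    rcases mul_eq_zero.1 h with h | h
    · exact le_antisymm ((le_margX hA.1 x y).trans_eq ((hA.2 x).trans h)) (hA.1 x y)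
    · exact le_antisymm ((le_margY hA.1 x y).trans_eq h) (hA.1 x y)
  have := log_sum_two (a := (1 - t) * Q x y) (b := t * Q' x y)
    (c := (1 - t) * (P x * margY Q y)) (d := t * (P x * margY Q' y))
    (mul_nonneg h1' (hQ.1 x y)) (mul_nonneg h0 (hQ'.1 x y))
    (mul_nonneg h1' (mul_nonneg hPx (margY_nonneg hQ y)))
    (mul_nonneg h0 (mul_nonneg hPx (margY_nonneg hQ' y)))
    (fun h => by
      rcases mul_eq_zero.1 h with h | h
      · rw [h, zero_mul]
      · rw [hz hQ h, mul_zero])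
    (fun h => by
      rcases mul_eq_zero.1 h with h | h
      · rw [h, zero_mul]
      · rw [hz hQ' h, mul_zero])
  rw [scaled_mul_log, scaled_mul_log] at this
  refine le_trans (le_of_eq ?_) this
  unfold mix
  congr 3; ring

theorem mul_log_mix_le {a u t : ℝ} (ha : 0 ≤ a) (hu : 0 ≤ u) (h0 : 0 ≤ t) (h1 : t ≤ 1) :
    ((1 - t) * a + t * u) * Real.log ((1 - t) * a + t * u)
      ≤ (1 - t) * (a * Real.log a) + t * (u * Real.log u) := by
  have hs : 1 - t + t = 1 := by ring
  have := Real.convexOn_mul_log.2 (Set.mem_Ici.2 ha) (Set.mem_Ici.2 hu) (sub_nonneg.2 h1) h0 hs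
  simpa only [smul_eq_mul] using this

theorem condDiv_mix_le {P : X → ℝ} {W : X → Y → ℝ} (hW : ∀ x, 0 < P x → ∀ y, 0 < W x y)
    {Q Q' : X → Y → ℝ} (hQ : Q ∈ jointDists P)
    (hQ' : Q' ∈ jointDists P) {t : ℝ} (h0 : 0 ≤ t) (h1 : t ≤ 1) :
    condDiv W (mix t Q Q') ≤ (1 - t) * condDiv W Q + t * condDiv W Q' := by
  rw [condDiv_eq hW hQ, condDiv_eq hW hQ', condDiv_eq hW (mix_mem hQ hQ' h0 h1), logLik_mix]
  have : jointNegEnt (mix t Q Q') ≤ (1 - t) * jointNegEnt Q + t * jointNegEnt Q' := by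
    unfold jointNegEnt
    rw [Finset.mul_sum, Finset.mul_sum, ← Finset.sum_add_distrib]
    refine Finset.sum_le_sum fun x _ => ?_
    rw [Finset.mul_sum, Finset.mul_sum, ← Finset.sum_add_distrib]
    exact Finset.sum_le_sum fun y _ => mul_log_mix_le (hQ.1 x y) (hQ'.1 x y) h0 h1
  linarith

/-- The divergence decreases when a zero of `Q` is filled by a small mixture. -/
theorem exists_condDiv_mix_le {P : X → ℝ} {W : X → Y → ℝ} (hW : ∀ x, 0 < P x → ∀ y, 0 < W x y)
    {Q U : X → Y → ℝ} (hQ : Q ∈ jointDists P) (hU : U ∈ jointDists P)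
    {x₀ : X} {y₀ : Y} (hQ0 : Q x₀ y₀ = 0) (hU0 : 0 < U x₀ y₀) :
    ∃ t, 0 < t ∧ t ≤ 1 ∧ condDiv W (mix t Q U) ≤ condDiv W Q := by
  classical
  -- The newly filled entry contributes `t * u * log t`. With `t = exp (-k)` this is `-t * |condDiv
  -- W U - condDiv W Q|`, which cancels the linear growth allowed by convexity.
  set u := U x₀ y₀
  set k := |condDiv W U - condDiv W Q| / u with hk
  have hk0 : 0 ≤ k := by positivity
  refine ⟨Real.exp (-k), Real.exp_pos _, Real.exp_le_one_iff.2 (by linarith), ?_⟩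
  set t := Real.exp (-k) with ht
  have h0 : 0 < t := Real.exp_pos _
  have h1 : t ≤ 1 := Real.exp_le_one_iff.2 (by linarith)
  have hS : jointNegEnt (mix t Q U) ≤
      (1 - t) * jointNegEnt Q + t * jointNegEnt U + t * u * Real.log t := by
    have hd : t * u * Real.log t = ∑ x, ∑ y, if x = x₀ ∧ y = y₀ then t * u * Real.log t else 0 := by
      rw [Finset.sum_eq_single x₀, Finset.sum_eq_single y₀] <;> simp +contextual
    rw [hd]
    unfold jointNegEnt
    rw [Finset.mul_sum, Finset.mul_sum, ← Finset.sum_add_distrib, ← Finset.sum_add_distrib]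
    refine Finset.sum_le_sum fun x _ => ?_
    rw [Finset.mul_sum, Finset.mul_sum, ← Finset.sum_add_distrib, ← Finset.sum_add_distrib]
    refine Finset.sum_le_sum fun y _ => ?_
    split_ifs with h
    · obtain ⟨rfl, rfl⟩ := h
      unfold mix
      rw [hQ0, mul_zero, zero_add, Real.log_mul h0.ne' hU0.ne']
      simp only [zero_mul, mul_zero, zero_add]
      refine le_of_eq ?_
      simp only [u]; ring
    · rw [add_zero]
      exact mul_log_mix_le (hQ.1 x y) (hU.1 x y) h0.le h1
  rw [condDiv_eq hW hQ, condDiv_eq hW (mix_mem hQ hU h0.le h1), logLik_mix]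
  have hlog : u * Real.log t = -|condDiv W U - condDiv W Q| := by
    rw [ht, Real.log_exp, hk]; field_simp
  have h2 := le_abs_self (condDiv W U - condDiv W Q)
  rw [condDiv_eq hW hQ, condDiv_eq hW hU] at h2 hlog
  have h3 : t * (u * Real.log t) ≤ -(t * (jointNegEnt U - negEnt P - logLik W U -
      (jointNegEnt Q - negEnt P - logLik W Q))) := by
    rw [hlog]
    nlinarith
  nlinarith

/-- The product of the input distribution with an output distribution. -/
def indep (P : X → ℝ) (q : Y → ℝ) : X → Y → ℝ := fun x y => P x * q y

theorem indep_mem {P : X → ℝ} (hP : ∀ x, 0 ≤ P x) {q : Y → ℝ} (hq : ∀ y, 0 ≤ q y)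
    (hq1 : ∑ y, q y = 1) : indep P q ∈ jointDists P :=
  ⟨fun x y => mul_nonneg (hP x) (hq y), fun x => by simp [indep, ← Finset.mul_sum, hq1]⟩

theorem margY_indep {P : X → ℝ} (hP : ∑ x, P x = 1) (q : Y → ℝ) : margY (indep P q) = q := by
  funext y; simp [margY, indep, ← Finset.sum_mul, hP]

theorem mutualInfo_indep {P : X → ℝ} (hP : ∑ x, P x = 1) {q : Y → ℝ} (hq1 : ∑ y, q y = 1) :
    mutualInfo (indep P q) = 0 := by
  unfold mutualInfo
  refine Finset.sum_eq_zero fun x _ => Finset.sum_eq_zero fun y _ => ?_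
  have hX : margX (indep P q) x = P x := by simp [margX, indep, ← Finset.mul_sum, hq1]
  rw [hX, margY_indep hP]
  unfold indep
  rcases eq_or_ne (P x * q y) 0 with h | h
  · simp [h]
  · rw [div_self h, Real.log_one, mul_zero]

theorem chan_mem {P : X → ℝ} (hP : ∀ x, 0 ≤ P x) {W : X → Y → ℝ} (hW : ∀ x y, 0 ≤ W x y)
    (hW1 : ∀ x, ∑ y, W x y = 1) : (fun x y => P x * W x y) ∈ jointDists P :=
  ⟨fun x y => mul_nonneg (hP x) (hW x y), fun x => by simp [← Finset.mul_sum, hW1]⟩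

theorem condDiv_chan {P : X → ℝ} {W : X → Y → ℝ}
    (hW1 : ∀ x, ∑ y, W x y = 1) : condDiv W (fun x y => P x * W x y) = 0 := by
  unfold condDiv
  refine Finset.sum_eq_zero fun x _ => Finset.sum_eq_zero fun y _ => ?_
  have hX : margX (fun x y => P x * W x y) x = P x := by simp [margX, ← Finset.mul_sum, hW1]
  rw [hX]
  rcases eq_or_ne (P x * W x y) 0 with h | h
  · simp [h]
  · rw [div_self h, Real.log_one, mul_zero]

theorem indep_margY_mem {P : X → ℝ} (hP : ∀ x, 0 ≤ P x) (hP1 : ∑ x, P x = 1)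
    {Q : X → Y → ℝ} (hQ : Q ∈ jointDists P) : indep P (margY Q) ∈ jointDists P :=
  indep_mem hP (margY_nonneg hQ) (sum_margY hP1 hQ)

/-- Divergence, mutual information and likelihood are linked on each output margin class. -/
theorem condDiv_swap {P : X → ℝ} {W : X → Y → ℝ} (hW : ∀ x, 0 < P x → ∀ y, 0 < W x y)
    {Q Q' : X → Y → ℝ} (hQ : Q ∈ jointDists P) (hQ' : Q' ∈ jointDists P)
    (hY : margY Q = margY Q') :
    condDiv W Q + mutualInfo Q' + logLik W Q = condDiv W Q' + mutualInfo Q + logLik W Q' := by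
  rw [condDiv_eq hW hQ, condDiv_eq hW hQ', mutualInfo_eq hQ, mutualInfo_eq hQ', hY]
  ring

/-- Optimality within an output margin class depends on the support only. -/
theorem logLik_le_of_support {P : X → ℝ} {W : X → Y → ℝ} {Q A B : X → Y → ℝ}
    (hQ : Q ∈ jointDists P)
    (hmax : ∀ Q' ∈ jointDists P, margY Q' = margY Q → logLik W Q' ≤ logLik W Q)
    (hA : A ∈ jointDists P) (hB : B ∈ jointDists P) (hAB : margY A = margY B)
    (hsupp : ∀ x y, Q x y = 0 → B x y = 0) : logLik W A ≤ logLik W B := by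
  -- With `t * B ≤ Q`, the perturbation `Q + t * (A - B)` is nonnegative and has the margins of `Q`;
  -- its likelihood may not exceed the maximum.
  obtain ⟨t, ht, hle⟩ : ∃ t > 0, ∀ x y, t * B x y ≤ Q x y := by
    have : ∀ s : Finset (X × Y), ∃ t > 0, ∀ i ∈ s, t * B i.1 i.2 ≤ Q i.1 i.2 := by
      classical
      intro s
      induction s using Finset.induction_on with
      | empty => exact ⟨1, one_pos, by simp⟩
      | insert i s _ ih =>
        obtain ⟨t, ht, h⟩ := ih
        rcases (hQ.1 i.1 i.2).eq_or_lt with h0 | h0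
        · refine ⟨t, ht, fun j hj => ?_⟩
          rcases Finset.mem_insert.1 hj with rfl | hj
          · rw [hsupp _ _ h0.symm, mul_zero]; exact hQ.1 _ _
          · exact h j hj
        · have hB1 : 0 < B i.1 i.2 + 1 := by linarith [hB.1 i.1 i.2]
          refine ⟨min t (Q i.1 i.2 / (B i.1 i.2 + 1)), lt_min ht (by positivity),
            fun j hj => ?_⟩
          rcases Finset.mem_insert.1 hj with rfl | hj
          · calc _ ≤ Q j.1 j.2 / (B j.1 j.2 + 1) * (B j.1 j.2 + 1) := by
                  have := hB.1 j.1 j.2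
                  refine mul_le_mul (min_le_right _ _) (by linarith) this (by positivity)
              _ = _ := by field_simp
          · exact (mul_le_mul_of_nonneg_right (min_le_left _ _) (hB.1 _ _)).trans (h j hj)
    obtain ⟨t, ht, h⟩ := this Finset.univ
    exact ⟨t, ht, fun x y => h (x, y) (Finset.mem_univ _)⟩
  have hf : logLik W (fun x y => Q x y + t * (A x y - B x y))
      = logLik W Q + t * (logLik W A - logLik W B) := by
    simp only [logLik, ← Finset.sum_sub_distrib, Finset.mul_sum, ← Finset.sum_add_distrib]
    refine Finset.sum_congr rfl fun x _ => Finset.sum_congr rfl fun y _ => ?_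
    ring
  have h := hmax (fun x y => Q x y + t * (A x y - B x y)) ⟨fun x y => ?_, fun x => ?_⟩ ?_
  · rw [hf] at h
    by_contra hlt
    push Not at hlt
    nlinarith
  · have := mul_nonneg ht.le (hA.1 x y)
    have := hle x y
    nlinarith
  · simp only [Finset.sum_add_distrib, ← Finset.mul_sum, Finset.sum_sub_distrib, hA.2, hB.2,
      hQ.2]; ring
  · funext y
    have := congrFun hAB y
    simp only [margY] at this ⊢
    simp only [Finset.sum_add_distrib, ← Finset.mul_sum, Finset.sum_sub_distrib, this]; ring

/-- The product distribution has information zero, so the feasible set is nonempty; it is compact,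
so the supremum in `maxLogLik` is a genuine maximum and not the default value of `sSup`. -/
theorem isGreatest_maxLogLik {P : X → ℝ} (hP : ∀ x, 0 ≤ P x) (hP1 : ∑ x, P x = 1)
    (W : X → Y → ℝ) {R : ℝ} (hR : 0 ≤ R) {Q : X → Y → ℝ} (hQ : Q ∈ jointDists P) :
    IsGreatest (logLik W '' {Q' ∈ jointDists (Y := Y) P | margY Q' = margY Q ∧ mutualInfo Q' ≤ R})
      (maxLogLik P W R (margY Q)) := by
  have hne : {Q' ∈ jointDists (Y := Y) P | margY Q' = margY Q ∧ mutualInfo Q' ≤ R}.Nonempty :=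
    ⟨indep P (margY Q), indep_margY_mem hP hP1 hQ, margY_indep hP1 _, by
      rw [mutualInfo_indep hP1 (sum_margY hP1 hQ)]; exact hR⟩
  have hc : IsCompact {Q' ∈ jointDists (Y := Y) P | margY Q' = margY Q ∧ mutualInfo Q' ≤ R} := by
    have h1 := (continuousOn_mutualInfo (Y := Y) P).preimage_isClosed_of_isClosed
      (isClosed_jointDists P) (isClosed_Iic (a := R))
    have h2 := h1.inter (isClosed_eq continuous_margY (continuous_const (y := margY Q)))
    refine (isCompact_jointDists P).of_isClosed_subset ?_ (Set.sep_subset _ _)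
    convert h2 using 1
    ext Q'
    simp only [Set.mem_ofPred_eq, Set.mem_inter_iff, Set.mem_preimage, Set.mem_Iic]
    tauto
  exact (hc.image (continuous_logLik W)).isGreatest_sSup (hne.image _)

/-! ### The single-letter optimization problems -/

/-- Pairs of joint distributions with the same output margin. -/
def marginPairs (P : X → ℝ) : Set ((X → Y → ℝ) × (X → Y → ℝ)) :=
  {p | p.1 ∈ jointDists P ∧ p.2 ∈ jointDists P ∧ margY p.1 = margY p.2}

/-- The exponent of the event that the sent codeword has joint type `p.1` with the output and
some other codeword has joint type `p.2`. -/
def errorCost (W : X → Y → ℝ) (R : ℝ) (p : (X → Y → ℝ) × (X → Y → ℝ)) : ℝ :=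
  condDiv W p.1 + max (mutualInfo p.2 - R) 0

/-- The exponent of the expected number of codewords of joint type `p.2` with the output, the
sent codeword having joint type `p.1`. -/
def listCost (W : X → Y → ℝ) (R : ℝ) (p : (X → Y → ℝ) × (X → Y → ℝ)) : ℝ :=
  condDiv W p.1 + mutualInfo p.2 - R

/-- The pairs `(Q̃, Q)` with `Q ∈ D(Q̃, R, T)`. -/
def listPairs (P : X → ℝ) (W : X → Y → ℝ) (R T : ℝ) : Set ((X → Y → ℝ) × (X → Y → ℝ)) :=
  {p ∈ marginPairs P | T + logLik W p.1 ≤ logLik W p.2 ∧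
    ∀ Q ∈ jointDists P, margY Q = margY p.2 → mutualInfo Q ≤ R →
      T + logLik W Q ≤ logLik W p.2}

theorem marginPairs_subset (P : X → ℝ) :
    marginPairs (Y := Y) P ⊆ jointDists P ×ˢ jointDists P := fun _ hp => ⟨hp.1, hp.2.1⟩

theorem isClosed_marginPairs (P : X → ℝ) : IsClosed (marginPairs (Y := Y) P) :=
  ((isClosed_jointDists P).preimage continuous_fst).inter
    (((isClosed_jointDists P).preimage continuous_snd).inter
      (isClosed_eq (continuous_margY.comp continuous_fst) (continuous_margY.comp continuous_snd)))

theorem isCompact_marginPairs (P : X → ℝ) : IsCompact (marginPairs (Y := Y) P) :=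
  ((isCompact_jointDists P).prod (isCompact_jointDists P)).of_isClosed_subset
    (isClosed_marginPairs P) (marginPairs_subset P)

theorem continuousOn_condDiv_fst {P : X → ℝ} {W : X → Y → ℝ}
    (hW : ∀ x, 0 < P x → ∀ y, 0 < W x y) :
    ContinuousOn (fun p : (X → Y → ℝ) × (X → Y → ℝ) => condDiv W p.1)
      (jointDists P ×ˢ jointDists P) :=
  (continuousOn_condDiv hW).comp continuousOn_fst fun _ hp => hp.1

theorem continuousOn_mutualInfo_snd (P : X → ℝ) :
    ContinuousOn (fun p : (X → Y → ℝ) × (X → Y → ℝ) => mutualInfo p.2)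
      (jointDists P ×ˢ jointDists P) :=
  (continuousOn_mutualInfo P).comp continuousOn_snd fun _ hp => hp.2

theorem continuousOn_errorCost {P : X → ℝ} {W : X → Y → ℝ}
    (hW : ∀ x, 0 < P x → ∀ y, 0 < W x y) (R : ℝ) :
    ContinuousOn (errorCost W R) (jointDists P ×ˢ jointDists P) :=
  (continuousOn_condDiv_fst hW).add
    (((continuousOn_mutualInfo_snd P).sub continuousOn_const).sup continuousOn_const)

theorem continuousOn_listCost {P : X → ℝ} {W : X → Y → ℝ}
    (hW : ∀ x, 0 < P x → ∀ y, 0 < W x y) (R : ℝ) :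
    ContinuousOn (listCost W R) (jointDists P ×ˢ jointDists P) :=
  ((continuousOn_condDiv_fst hW).add (continuousOn_mutualInfo_snd P)).sub continuousOn_const

theorem continuous_logLik_sub (W : X → Y → ℝ) :
    Continuous fun p : (X → Y → ℝ) × (X → Y → ℝ) => logLik W p.1 - logLik W p.2 :=
  ((continuous_logLik W).comp continuous_fst).sub ((continuous_logLik W).comp continuous_snd)

theorem chan_pair_mem {P : X → ℝ} (hP : ∀ x, 0 ≤ P x) (hP1 : ∑ x, P x = 1) {W : X → Y → ℝ}
    (hW0 : ∀ x y, 0 ≤ W x y) (hW1 : ∀ x, ∑ y, W x y = 1) :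
    ((fun x y => P x * W x y), indep P (margY fun x y => P x * W x y)) ∈ marginPairs P :=
  ⟨chan_mem hP hW0 hW1, indep_margY_mem hP hP1 (chan_mem hP hW0 hW1), (margY_indep hP1 _).symm⟩

theorem errorCost_chan_pair {P : X → ℝ} (hP : ∀ x, 0 ≤ P x) (hP1 : ∑ x, P x = 1)
    {W : X → Y → ℝ} (hW0 : ∀ x y, 0 ≤ W x y) (hW1 : ∀ x, ∑ y, W x y = 1) {R : ℝ} (hR : 0 ≤ R) :
    errorCost W R ((fun x y => P x * W x y), indep P (margY fun x y => P x * W x y)) = 0 := by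
  simp only [errorCost, condDiv_chan hW1,
    mutualInfo_indep hP1 (sum_margY hP1 (chan_mem hP hW0 hW1))]
  rw [max_eq_right (by linarith), add_zero]

/-- `p` solves the minimization problem that defines the optimal threshold. -/
def IsThresholdPair (P : X → ℝ) (W : X → Y → ℝ) (R E : ℝ) (p : (X → Y → ℝ) × (X → Y → ℝ)) :
    Prop :=
  p ∈ marginPairs P ∧ errorCost W R p ≤ E ∧ ∀ p' ∈ marginPairs P, errorCost W R p' ≤ E →
    logLik W p.1 - logLik W p.2 ≤ logLik W p'.1 - logLik W p'.2

theorem exists_isThresholdPair {P : X → ℝ} (hP : ∀ x, 0 ≤ P x) (hP1 : ∑ x, P x = 1)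
    {W : X → Y → ℝ} (hW0 : ∀ x y, 0 ≤ W x y) (hW1 : ∀ x, ∑ y, W x y = 1)
    (hW : ∀ x, 0 < P x → ∀ y, 0 < W x y) {R E : ℝ} (hR : 0 ≤ R) (hE : 0 ≤ E) :
    ∃ p, IsThresholdPair P W R E p := by
  have hcl : IsClosed (marginPairs P ∩ errorCost W R ⁻¹' Set.Iic E) :=
    ((continuousOn_errorCost hW R).mono (marginPairs_subset P)).preimage_isClosed_of_isClosed
      (isClosed_marginPairs P) isClosed_Iic
  have hco := (isCompact_marginPairs (Y := Y) P).of_isClosed_subset hcl Set.inter_subset_left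
  obtain ⟨p, hp, hmin⟩ := hco.exists_isMinOn
    ⟨_, chan_pair_mem hP hP1 hW0 hW1, by
      rw [Set.mem_preimage, errorCost_chan_pair hP hP1 hW0 hW1 hR]; exact hE⟩
    (continuous_logLik_sub W).continuousOn
  exact ⟨p, hp.1, hp.2, fun p' h h' => hmin ⟨h, h'⟩⟩

/-- The constraint in `hStar` is `errorCost W R (Q', Q) ≤ E` rewritten, so minimizing over `Q'` and
then over `Q` is one minimization over pairs. Infeasible `Q` give `⊤` and do not matter. -/
theorem IsThresholdPair.isLeast {P : X → ℝ} {W : X → Y → ℝ} {R E : ℝ}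
    {p : (X → Y → ℝ) × (X → Y → ℝ)} (hp : IsThresholdPair P W R E p) :
    IsLeast ((fun Q : X → Y → ℝ => hStar P W R E Q - (logLik W Q : EReal)) '' jointDists P)
      ((logLik W p.1 - logLik W p.2 : ℝ) : EReal) := by
  obtain ⟨⟨h1, h2, hY⟩, hc, hmin⟩ := hp
  unfold errorCost at hc hmin
  constructor
  · refine ⟨p.2, h2, ?_⟩
    have : hStar P W R E p.2 = (logLik W p.1 : EReal) := by
      unfold hStar gStar
      refine le_antisymm (iInf₂_le p.1 ⟨h1, hY, by linarith⟩) (le_iInf₂ ?_)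
      rintro Q ⟨hQ, hQY, hQD⟩
      have := hmin (Q, p.2) ⟨hQ, h2, hQY⟩ (by simp only; linarith)
      simp only at this
      exact_mod_cast (by linarith : logLik W p.1 ≤ logLik W Q)
    simp only [this, EReal.coe_sub]
  · rintro _ ⟨Q, hQ, rfl⟩
    simp only
    rw [EReal.le_sub_iff_add_le (Or.inl (EReal.coe_ne_bot _)) (Or.inl (EReal.coe_ne_top _)),
      ← EReal.coe_add]
    unfold hStar gStar
    refine le_iInf₂ ?_
    rintro Q' ⟨hQ', hQY, hQD⟩
    have := hmin (Q', Q) ⟨hQ', hQ, hQY⟩ (by simp only; linarith)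
    simp only at this
    exact_mod_cast (by linarith : logLik W p.1 - logLik W p.2 + logLik W Q ≤ logLik W Q')

theorem margY_mix_eq {Q₁ Q₂ Q₁' Q₂' : X → Y → ℝ} (h : margY Q₁ = margY Q₂)
    (h' : margY Q₁' = margY Q₂') (t : ℝ) : margY (mix t Q₁ Q₁') = margY (mix t Q₂ Q₂') := by
  funext y; rw [margY_mix, margY_mix, h, h']

/-- Above the optimal threshold, some competing pair has cost strictly less than `E`. -/
theorem IsThresholdPair.exists_lt {P : X → ℝ} (hP : ∀ x, 0 ≤ P x) (hP1 : ∑ x, P x = 1)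
    {W : X → Y → ℝ} (hW0 : ∀ x y, 0 ≤ W x y) (hW1 : ∀ x, ∑ y, W x y = 1)
    (hW : ∀ x, 0 < P x → ∀ y, 0 < W x y) {R E : ℝ} (hR : 0 ≤ R) (hE : 0 < E)
    {p : (X → Y → ℝ) × (X → Y → ℝ)} (hp : IsThresholdPair P W R E p) {T : ℝ}
    (hT : logLik W p.1 - logLik W p.2 < T) :
    ∃ p' ∈ marginPairs P, errorCost W R p' < E ∧ logLik W p'.1 - logLik W p'.2 < T := by
  obtain ⟨⟨h1, h2, hY⟩, hc, -⟩ := hp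
  have hu := chan_pair_mem hP hP1 hW0 hW1
  have huc := errorCost_chan_pair hP hP1 hW0 hW1 hR
  set U : X → Y → ℝ := fun x y => P x * W x y
  set V := indep P (margY U)
  -- A small step towards the zero-cost pair keeps the likelihood gap below `T`; by convexity it
  -- brings the cost down to at most `(1 - t) * E`.
  have hev : ∀ᶠ t in nhdsWithin (0 : ℝ) (Set.Ioi 0),
      (1 - t) * (logLik W p.1 - logLik W p.2) + t * (logLik W U - logLik W V) < T := by
    have hcont : Continuous fun t : ℝ =>
      (1 - t) * (logLik W p.1 - logLik W p.2) + t * (logLik W U - logLik W V) := by fun_prop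
    have := hcont.tendsto 0
    simp only [sub_zero, one_mul, zero_mul, add_zero] at this
    exact (this.mono_left nhdsWithin_le_nhds).eventually_lt_const hT
  obtain ⟨t, ht, ht0, ht1⟩ := (hev.and (Ioo_mem_nhdsGT (zero_lt_one' ℝ))).exists
  refine ⟨(mix t p.1 U, mix t p.2 V), ⟨mix_mem h1 hu.1 ht0.le ht1.le,
    mix_mem h2 hu.2.1 ht0.le ht1.le, margY_mix_eq hY hu.2.2 t⟩, ?_, ?_⟩
  · unfold errorCost at hc huc ⊢
    simp only at huc ⊢
    have e1 := condDiv_mix_le hW h1 hu.1 ht0.le ht1.le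
    have e2 := mutualInfo_mix_le h2 hu.2.1 ht0.le ht1.le
    have e3 : max (mutualInfo (mix t p.2 V) - R) 0
        ≤ (1 - t) * max (mutualInfo p.2 - R) 0 + t * max (mutualInfo V - R) 0 := by
      have a1 := le_max_left (mutualInfo p.2 - R) 0
      have a2 := le_max_right (mutualInfo p.2 - R) 0
      have b1 := le_max_left (mutualInfo V - R) 0
      have b2 := le_max_right (mutualInfo V - R) 0
      have h1t : 0 ≤ 1 - t := by linarith
      refine max_le ?_ (by positivity)
      calc _ ≤ (1 - t) * (mutualInfo p.2 - R) + t * (mutualInfo V - R) := by linarith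
        _ ≤ _ := by gcongr
    calc _ ≤ (1 - t) * (condDiv W p.1 + max (mutualInfo p.2 - R) 0)
          + t * (condDiv W U + max (mutualInfo V - R) 0) := by linarith
      _ ≤ (1 - t) * E + t * 0 := by
          rw [huc]
          have h1t : 0 ≤ 1 - t := by linarith
          gcongr
      _ < E := by nlinarith
  · simp only [logLik_mix]
    linarith

/-- The output margins near `q` dominate most of `q`. -/
theorem exists_margin_scale (q : Y → ℝ) (hq : ∀ y, 0 ≤ q y) :
    ∃ c : (Y → ℝ) → ℝ, Continuous c ∧ c q = 1 ∧
      ∀ r : Y → ℝ, (∀ y, 0 ≤ r y) → 0 ≤ c r ∧ c r ≤ 1 ∧ ∀ y, c r * q y ≤ r y := by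
  classical
  -- All factors lie in `[0, 1]`, so the product is at most each ratio `r y / q y`; letters with `q
  -- y = 0` impose nothing.
  refine ⟨fun r => ∏ y, if q y = 0 then 1 else min 1 (r y / q y), ?_, ?_, fun r hr => ?_⟩
  · refine continuous_finsetProd _ fun y _ => ?_
    split_ifs
    · exact continuous_const
    · exact continuous_const.min ((continuous_apply y).div_const _)
  · refine Finset.prod_eq_one fun y _ => ?_
    split_ifs with h
    · rfl
    · rw [div_self h, min_self]
  · have h0 : ∀ y, 0 ≤ (if q y = 0 then 1 else min 1 (r y / q y)) := by
      intro y
      split_ifs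
      · exact zero_le_one
      · exact le_min zero_le_one (div_nonneg (hr y) (hq y))
    have h1 : ∀ y, (if q y = 0 then 1 else min 1 (r y / q y)) ≤ 1 := by
      intro y
      split_ifs
      · exact le_rfl
      · exact min_le_left _ _
    refine ⟨Finset.prod_nonneg fun y _ => h0 y,
      Finset.prod_le_one (fun y _ => h0 y) fun y _ => h1 y, fun y => ?_⟩
    rcases (hq y).eq_or_lt with hy | hy
    · rw [← hy, mul_zero]; exact hr y
    · have : (∏ y, if q y = 0 then 1 else min 1 (r y / q y)) ≤ r y / q y := by
        rw [← Finset.mul_prod_erase _ _ (Finset.mem_univ y), if_neg hy.ne']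
        calc _ ≤ (r y / q y) * 1 := by
              refine mul_le_mul (min_le_right _ _) (Finset.prod_le_one (fun y _ => h0 y)
                fun y _ => h1 y) (Finset.prod_nonneg fun y _ => h0 y)
                (div_nonneg (hr y) (hq y))
          _ = _ := mul_one _
      calc _ ≤ r y / q y * q y := by gcongr
        _ = r y := by field_simp

/-- A joint distribution can be moved continuously to nearby output margins without
increasing the mutual information. -/
theorem exists_margin_transport {P : X → ℝ} (hP : ∀ x, 0 ≤ P x) (hP1 : ∑ x, P x = 1) {R : ℝ}
    (hR : 0 ≤ R) {Q : X → Y → ℝ} (hQ : Q ∈ jointDists P) (hI : mutualInfo Q ≤ R) :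
    ∃ Φ : (Y → ℝ) → X → Y → ℝ, Continuous Φ ∧ Φ (margY Q) = Q ∧
      ∀ A ∈ jointDists P, Φ (margY A) ∈ jointDists P ∧ margY (Φ (margY A)) = margY A ∧
        mutualInfo (Φ (margY A)) ≤ R := by
  obtain ⟨c, hcont, hc1, hc⟩ := exists_margin_scale (margY Q) (margY_nonneg hQ)
  refine ⟨fun r x y => c r * Q x y + P x * (r y - c r * margY Q y), ?_, ?_, fun A hA => ?_⟩
  · refine continuous_pi fun x => continuous_pi fun y => ?_
    fun_prop
  · funext x y
    simp only [hc1]; ring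
  · beta_reduce
    obtain ⟨c0, c1, hcq⟩ := hc (margY A) (margY_nonneg hA)
    -- The leftover margin is normalized by `1 - c`, so scale 1 is treated apart: there one
    -- probability vector dominates another, hence they are equal. Otherwise the result mixes `Q`
    -- with a product, which has information zero.
    rcases c1.eq_or_lt with h1 | h1
    · have hAQ : margY A = margY Q := by
        have hle : ∀ y ∈ Finset.univ, margY Q y ≤ margY A y := fun y _ => by
          have := hcq y
          rwa [h1, one_mul] at this
        have := (Finset.sum_eq_sum_iff_of_le hle).1
          ((sum_margY hP1 hQ).trans (sum_margY hP1 hA).symm)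
        exact funext fun y => (this y (Finset.mem_univ y)).symm
      have e : (fun x y => c (margY A) * Q x y + P x * (margY A y - c (margY A) * margY Q y))
          = Q := by
        funext x y; rw [h1, hAQ]; ring
      rw [e]
      exact ⟨hQ, hAQ.symm, hI⟩
    · set s := c (margY A)
      have hs : 0 < 1 - s := by linarith
      set r : Y → ℝ := fun y => (margY A y - s * margY Q y) / (1 - s) with hr
      have hr0 : ∀ y, 0 ≤ r y := fun y => div_nonneg (by linarith [hcq y]) hs.le
      have hr1 : ∑ y, r y = 1 := by
        rw [hr, ← Finset.sum_div, Finset.sum_sub_distrib, ← Finset.mul_sum, sum_margY hP1 hA,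
          sum_margY hP1 hQ, mul_one, div_self hs.ne']
      have e : (fun x y => s * Q x y + P x * (margY A y - s * margY Q y))
          = mix (1 - s) Q (indep P r) := by
        funext x y
        simp only [mix, indep, hr]
        field_simp
        ring
      have hi := indep_mem hP hr0 hr1
      rw [e]
      refine ⟨mix_mem hQ hi hs.le (by linarith), ?_, ?_⟩
      · funext y
        rw [margY_mix, margY_indep hP1, hr]
        field_simp
        ring
      · refine (mutualInfo_mix_le hQ hi hs.le (by linarith)).trans ?_
        rw [mutualInfo_indep hP1 hr1]
        nlinarith

/-- The difficulty is that the competitors vary with the output margin. Each competitor of the limit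
is transported continuously to nearby margins, so its constraint passes to the limit. -/
theorem isClosed_listPairs {P : X → ℝ} (hP : ∀ x, 0 ≤ P x) (hP1 : ∑ x, P x = 1)
    (W : X → Y → ℝ) {R : ℝ} (hR : 0 ≤ R) (T : ℝ) : IsClosed (listPairs P W R T) := by
  refine isClosed_of_closure_subset fun p hp => ?_
  have h1 : p ∈ marginPairs P :=
    (isClosed_marginPairs P).closure_subset_iff.2 (fun p hp => hp.1) hp
  have hc1 : Continuous fun p : (X → Y → ℝ) × (X → Y → ℝ) => logLik W p.1 :=
    (continuous_logLik W).comp continuous_fst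
  have hc2 : Continuous fun p : (X → Y → ℝ) × (X → Y → ℝ) => logLik W p.2 :=
    (continuous_logLik W).comp continuous_snd
  refine ⟨h1, ?_, fun Q hQ hQY hI => ?_⟩
  · exact (isClosed_le (continuous_const.add hc1) hc2).closure_subset_iff.2
      (fun p hp => hp.2.1) hp
  · obtain ⟨Φ, hΦ, hΦQ, hΦA⟩ := exists_margin_transport hP hP1 hR hQ hI
    have hcl : IsClosed {p : (X → Y → ℝ) × (X → Y → ℝ) |
        T + logLik W (Φ (margY p.2)) ≤ logLik W p.2} :=
      isClosed_le (continuous_const.add ((continuous_logLik W).comp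
        (hΦ.comp (continuous_margY.comp continuous_snd)))) hc2
    have hmem := hcl.closure_subset_iff.2 (fun p' hp' => by
      obtain ⟨a, b, c⟩ := hΦA p'.2 hp'.1.2.1
      exact hp'.2.2 _ a b c) hp
    simpa only [Set.mem_ofPred_eq, ← hQY, hΦQ] using hmem

theorem isCompact_listPairs {P : X → ℝ} (hP : ∀ x, 0 ≤ P x) (hP1 : ∑ x, P x = 1)
    (W : X → Y → ℝ) {R : ℝ} (hR : 0 ≤ R) (T : ℝ) : IsCompact (listPairs P W R T) :=
  (isCompact_marginPairs P).of_isClosed_subset (isClosed_listPairs hP hP1 W hR T)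
    fun _ hp => hp.1

theorem listCosts_eq_image {P : X → ℝ} (hP : ∀ x, 0 ≤ P x) (hP1 : ∑ x, P x = 1)
    (W : X → Y → ℝ) {R : ℝ} (hR : 0 ≤ R) (T : ℝ) :
    listCosts P W R T = listCost W R '' listPairs P W R T := by
  ext v
  constructor
  · rintro ⟨Qt, hQt, Q, ⟨hQ, hY, hle⟩, rfl⟩
    refine ⟨(Qt, Q), ⟨⟨hQt, hQ, hY.symm⟩, ?_, fun Q' hQ' hY' hI' => ?_⟩, rfl⟩
    · exact (add_le_add_right (le_max_right _ _) T).trans hle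
    · have := (isGreatest_maxLogLik hP hP1 W hR hQ).2 ⟨Q', ⟨hQ', hY', hI'⟩, rfl⟩
      exact (add_le_add_right (this.trans (le_max_left _ _)) T).trans hle
  · rintro ⟨⟨Qt, Q⟩, ⟨⟨hQt, hQ, hY⟩, hle, hall⟩, rfl⟩
    simp only at hQt hQ hY hle hall
    refine ⟨Qt, hQt, Q, ⟨hQ, hY.symm, ?_⟩, rfl⟩
    obtain ⟨Q', ⟨hQ', hY', hI'⟩, he⟩ := (isGreatest_maxLogLik hP hP1 W hR hQ).1
    have := hall Q' hQ' hY' hI'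
    rw [he] at this
    rcases max_cases (maxLogLik P W R (margY Q)) (logLik W Qt) with h | h
    · rw [h.1]; exact this
    · rw [h.1]; exact hle

theorem listPairs_anti {P : X → ℝ} {W : X → Y → ℝ} {R T T' : ℝ} (h : T' ≤ T) :
    listPairs P W R T ⊆ listPairs P W R T' := fun _ hp =>
  ⟨hp.1, by linarith [hp.2.1], fun Q hQ hY hI => by linarith [hp.2.2 Q hQ hY hI]⟩

/-- The minimal list cost is lower semicontinuous in the threshold. -/
theorem exists_listCost_ge {P : X → ℝ} (hP : ∀ x, 0 ≤ P x) (hP1 : ∑ x, P x = 1)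
    {W : X → Y → ℝ} (hW : ∀ x, 0 < P x → ∀ y, 0 < W x y) {R : ℝ} (hR : 0 ≤ R) {T e : ℝ}
    (he : ∀ p ∈ listPairs P W R T, e ≤ listCost W R p) {ε : ℝ} (hε : 0 < ε) :
    ∃ δ > 0, ∀ p ∈ listPairs P W R (T - δ), e - ε ≤ listCost W R p := by
  by_contra! hcon
  -- If the claim fails, the nested compact sets of cheap pairs at thresholds increasing to `T` are
  -- all nonempty; a common point is a list pair at `T` that is too cheap.
  let K : ℕ → Set ((X → Y → ℝ) × (X → Y → ℝ)) := fun k =>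
    listPairs P W R (T - 1 / (k + 1)) ∩ listCost W R ⁻¹' Set.Iic (e - ε)
  have hcl : ∀ k, IsClosed (K k) := fun k =>
    ((continuousOn_listCost hW R).mono
      (fun p hp => marginPairs_subset P hp.1)).preimage_isClosed_of_isClosed
      (isClosed_listPairs hP hP1 W hR _) isClosed_Iic
  have hne := IsCompact.nonempty_iInter_of_sequence_nonempty_isCompact_isClosed K
    (fun k p hp => ⟨listPairs_anti (by
      have : (1 : ℝ) / ((k : ℝ) + 1 + 1) ≤ 1 / (k + 1) := by gcongr; linarith
      push_cast
      linarith) hp.1, hp.2⟩)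
    (fun k => by
      obtain ⟨p, hp, hlt⟩ := hcon (1 / ((k : ℝ) + 1)) (by positivity)
      exact ⟨p, hp, hlt.le⟩)
    ((isCompact_listPairs hP hP1 W hR _).of_isClosed_subset (hcl 0) Set.inter_subset_left) hcl
  obtain ⟨p, hp⟩ := hne
  have hp : ∀ k, p ∈ K k := Set.mem_iInter.1 hp
  have hlim : ∀ a b : ℝ, (∀ k : ℕ, T - 1 / ((k : ℝ) + 1) + a ≤ b) → T + a ≤ b := by
    intro a b h
    have ht : Filter.Tendsto (fun k : ℕ => T - 1 / ((k : ℝ) + 1) + a) atTop (nhds (T - 0 + a)) :=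
      (tendsto_const_nhds.sub tendsto_one_div_add_atTop_nhds_zero_nat).add_const a
    rw [sub_zero] at ht
    exact le_of_tendsto' ht h
  have hmem : p ∈ listPairs P W R T := ⟨(hp 0).1.1, hlim _ _ fun k => (hp k).1.2.1,
    fun Q hQ hY hI => hlim _ _ fun k => (hp k).1.2.2 Q hQ hY hI⟩
  have h1 := he p hmem
  have h2 : listCost W R p ≤ e - ε := (hp 0).2
  linarith

/-! ### Rational pairs of nearly minimal list cost -/

/-- The competitors that would keep `Q` off the list have mutual information bounded away
from the rate. -/
def IsSafe (P : X → ℝ) (W : X → Y → ℝ) (R T : ℝ) (Q : X → Y → ℝ) : Prop :=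
  ∃ η > 0, ∀ Q' ∈ jointDists P, margY Q' = margY Q → logLik W Q < T + logLik W Q' →
    R + η ≤ mutualInfo Q'

/-- `p` is approximated by rational pairs that are reached by types and lie on the list. -/
def HasRatApprox (P : X → ℝ) (W : X → Y → ℝ) (R T : ℝ) (p : (X → Y → ℝ) × (X → Y → ℝ)) : Prop :=
  ∀ ε > 0, ∃ R₁ R₂ : X → Y → ℚ,
    ((fun x y => (R₁ x y : ℝ)), fun x y => (R₂ x y : ℝ)) ∈ marginPairs P ∧
    T + logLik W (fun x y => (R₁ x y : ℝ)) ≤ logLik W (fun x y => (R₂ x y : ℝ)) ∧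
    IsSafe P W R T (fun x y => (R₂ x y : ℝ)) ∧
    listCost W R ((fun x y => (R₁ x y : ℝ)), fun x y => (R₂ x y : ℝ)) < listCost W R p + ε

theorem exists_rat_pair_of_eventually {P : X → ℝ} (hP_rat : ∀ x, ∃ r : ℚ, P x = r)
    {p : (X → Y → ℝ) × (X → Y → ℝ)} (hp : p ∈ marginPairs P)
    {Φ : (X → Y → ℝ) × (X → Y → ℝ) → Prop}
    (hΦ : ∀ᶠ p' in nhdsWithin p (jointDists P ×ˢ jointDists P), Φ p') :
    ∃ R₁ R₂ : X → Y → ℚ,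
      ((fun x y => (R₁ x y : ℝ)), fun x y => (R₂ x y : ℝ)) ∈ marginPairs P ∧
      Φ ((fun x y => (R₁ x y : ℝ)), fun x y => (R₂ x y : ℝ)) ∧
      ∀ x y, p.2 x y = 0 → R₂ x y = 0 := by
  obtain ⟨ε, hε, hball⟩ := Metric.mem_nhdsWithin_iff.1 hΦ
  obtain ⟨R₁, R₂, h₁, h₂, hY, hd₁, hd₂, hs⟩ := exists_rat_pair hP_rat hp.1 hp.2.1 hp.2.2 hε
  have hdist : ∀ {A B : X → Y → ℝ}, (∀ x y, |A x y - B x y| < ε) → dist A B < ε := by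
    intro A B h
    rw [dist_pi_lt_iff hε]
    intro x
    rw [dist_pi_lt_iff hε]
    intro y
    rw [Real.dist_eq]
    exact h x y
  refine ⟨R₁, R₂, ⟨h₁, h₂, hY⟩, hball ⟨?_, h₁, h₂⟩, hs⟩
  rw [Metric.mem_ball, Prod.dist_eq]
  exact max_lt (hdist hd₁) (hdist hd₂)

theorem eventually_isSafe {P : X → ℝ} {W : X → Y → ℝ} {R T : ℝ} {Q : X → Y → ℝ}
    (hQ : ∀ Q' ∈ jointDists P, margY Q' = margY Q → mutualInfo Q' ≤ R →
      T + logLik W Q' < logLik W Q) :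
    ∀ᶠ Q₁ in nhds Q, Q₁ ∈ jointDists P → IsSafe P W R T Q₁ := by
  -- `K` holds the pairs (competitor, candidate), with the blocking condition relaxed to a closed
  -- one. A positive minimum on `K` of the larger of the distance to `Q` and the excess information
  -- gives one `η` for all nearby candidates.
  set K : Set ((X → Y → ℝ) × (X → Y → ℝ)) :=
    {p ∈ marginPairs P | logLik W p.2 ≤ T + logLik W p.1} with hK
  have hKc : IsCompact K := (isCompact_marginPairs P).of_isClosed_subset
    ((isClosed_marginPairs P).inter (isClosed_le ((continuous_logLik W).comp continuous_snd)
      (continuous_const.add ((continuous_logLik W).comp continuous_fst)))) (Set.sep_subset _ _)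
  rcases K.eq_empty_or_nonempty with hE | hne
  · refine Filter.Eventually.of_forall fun Q₁ hQ₁ => ⟨1, one_pos, fun Q' hQ' hY hf => ?_⟩
    have : (Q', Q₁) ∈ K := ⟨⟨hQ', hQ₁, hY⟩, hf.le⟩
    rw [hE] at this
    exact this.elim
  · have hcont : ContinuousOn (fun p : (X → Y → ℝ) × (X → Y → ℝ) =>
        max (dist p.2 Q) (mutualInfo p.1 - R)) K :=
      (continuous_snd.dist continuous_const).continuousOn.sup
        (((continuousOn_mutualInfo P).comp continuousOn_fst fun p hp => hp.1.1).sub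
          continuousOn_const)
    obtain ⟨p₀, hp₀, hmin⟩ := hKc.exists_isMinOn hne hcont
    have hmin : ∀ p ∈ K, max (dist p₀.2 Q) (mutualInfo p₀.1 - R)
        ≤ max (dist p.2 Q) (mutualInfo p.1 - R) := fun p hp => hmin hp
    set η := max (dist p₀.2 Q) (mutualInfo p₀.1 - R)
    have hη : 0 < η := by
      by_contra! h
      have h1 : dist p₀.2 Q ≤ 0 := (le_max_left _ _).trans h
      have h2 : mutualInfo p₀.1 - R ≤ 0 := (le_max_right _ _).trans h
      have h3 : p₀.2 = Q := dist_le_zero.1 h1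
      have h4 := hQ p₀.1 hp₀.1.1 (by rw [← h3]; exact hp₀.1.2.2) (by linarith)
      have h5 := hp₀.2
      rw [h3] at h5
      linarith
    filter_upwards [Metric.ball_mem_nhds Q hη] with Q₁ hd hQ₁
    refine ⟨η, hη, fun Q' hQ' hY hf => ?_⟩
    have := hmin (Q', Q₁) ⟨⟨hQ', hQ₁, hY⟩, hf.le⟩
    rcases le_max_iff.1 this with h | h
    · exact absurd hd (by rw [Metric.mem_ball]; exact not_lt.2 h)
    · simp only at h; linarith

/-- Strict constraints are open conditions, so every sufficiently close rational pair inherits them.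
-/
theorem hasRatApprox_of_lt {P : X → ℝ} (hP_rat : ∀ x, ∃ r : ℚ, P x = r) {W : X → Y → ℝ}
    (hW : ∀ x, 0 < P x → ∀ y, 0 < W x y) {R T : ℝ} {p : (X → Y → ℝ) × (X → Y → ℝ)}
    (hp : p ∈ marginPairs P) (hlt : T + logLik W p.1 < logLik W p.2)
    (hQ : ∀ Q' ∈ jointDists P, margY Q' = margY p.2 → mutualInfo Q' ≤ R →
      T + logLik W Q' < logLik W p.2) : HasRatApprox P W R T p := by
  intro ε hε
  have e1 : ∀ᶠ p' in nhdsWithin p (jointDists P ×ˢ jointDists P),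
      listCost W R p' < listCost W R p + ε :=
    (continuousOn_listCost hW R p (marginPairs_subset P hp)).eventually_lt_const (by linarith)
  have e2 : ∀ᶠ p' in nhdsWithin p (jointDists P ×ˢ jointDists P),
      T + logLik W p'.1 < logLik W p'.2 :=
    nhdsWithin_le_nhds ((isOpen_lt (continuous_const.add
      ((continuous_logLik W).comp continuous_fst))
      ((continuous_logLik W).comp continuous_snd)).mem_nhds hlt)
  have e3 : ∀ᶠ p' in nhdsWithin p (jointDists P ×ˢ jointDists P),
      p'.2 ∈ jointDists P → IsSafe P W R T p'.2 :=
    nhdsWithin_le_nhds (continuous_snd.continuousAt.eventually (eventually_isSafe hQ))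
  obtain ⟨R₁, R₂, hm, ⟨h1, h2, h3⟩, -⟩ :=
    exists_rat_pair_of_eventually hP_rat hp (e1.and (e2.and e3))
  exact ⟨R₁, R₂, hm, h2.le, h3 hm.2.1, h1⟩

/-- A pair that only satisfies its constraints weakly may be replaced by nearby mixtures, because
the list cost is continuous. -/
theorem HasRatApprox.of_mix {P : X → ℝ} {W : X → Y → ℝ}
    (hW : ∀ x, 0 < P x → ∀ y, 0 < W x y) {R T : ℝ} {p p' : (X → Y → ℝ) × (X → Y → ℝ)}
    (hp : p ∈ marginPairs P) (hp' : p' ∈ marginPairs P)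
    (h : ∀ t, 0 < t → t < 1 → HasRatApprox P W R T (mix t p.1 p'.1, mix t p.2 p'.2)) :
    HasRatApprox P W R T p := by
  intro ε hε
  have hcont : Tendsto (fun t : ℝ => (mix t p.1 p'.1, mix t p.2 p'.2))
      (nhdsWithin 0 (Set.Ioo 0 1)) (nhdsWithin p (jointDists P ×ˢ jointDists P)) := by
    refine tendsto_nhdsWithin_iff.2 ⟨?_, ?_⟩
    · have := ((continuous_mix p.1 p'.1).prodMk (continuous_mix p.2 p'.2)).tendsto 0
      simp only [mix_zero] at this
      exact this.mono_left nhdsWithin_le_nhds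
    · filter_upwards [self_mem_nhdsWithin] with t ht
      exact ⟨mix_mem hp.1 hp'.1 ht.1.le ht.2.le, mix_mem hp.2.1 hp'.2.1 ht.1.le ht.2.le⟩
  have hlt := ((continuousOn_listCost hW R p (marginPairs_subset P hp)).tendsto.comp
    hcont).eventually_lt_const (u := listCost W R p + ε / 2) (by linarith)
  have : (nhdsWithin (0 : ℝ) (Set.Ioo 0 1)).NeBot := by
    rw [nhdsWithin_Ioo_eq_nhdsGT zero_lt_one]; infer_instance
  obtain ⟨t, ht, ht01⟩ := (hlt.and self_mem_nhdsWithin).exists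
  obtain ⟨R₁, R₂, h1, h2, h3, h4⟩ := h t ht01.1 ht01.2 (ε / 2) (by linarith)
  refine ⟨R₁, R₂, h1, h2, h3, ?_⟩
  simp only [Function.comp] at ht
  linarith

theorem mix_self (t : ℝ) (Q : X → Y → ℝ) : mix t Q Q = Q := by
  funext x y; unfold mix; ring

/-- A minimizer of the list cost at a positive optimal threshold is not rigid. -/
theorem IsThresholdPair.not_rigid {P : X → ℝ} (hP : ∀ x, 0 ≤ P x) (hP1 : ∑ x, P x = 1)
    {W : X → Y → ℝ} (hW : ∀ x, 0 < P x → ∀ y, 0 < W x y) {R E : ℝ} (hR : 0 ≤ R)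
    {p : (X → Y → ℝ) × (X → Y → ℝ)} (hp : IsThresholdPair P W R E p)
    {T : ℝ} (hT : logLik W p.1 - logLik W p.2 = T) (hT0 : 0 < T)
    {p' : (X → Y → ℝ) × (X → Y → ℝ)} (hp' : p' ∈ listPairs P W R T)
    (hmin : ∀ p'' ∈ listPairs P W R T, listCost W R p' ≤ listCost W R p'')
    (hmax : ∀ Q ∈ jointDists P, margY Q = margY p'.2 → logLik W Q ≤ logLik W p'.2)
    {V : X → Y → ℝ} (hV : V ∈ jointDists P) (hVY : margY V = margY p'.2)
    (hVI : mutualInfo V ≤ R) (hVf : logLik W p'.2 = T + logLik W V) : False := by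
  obtain ⟨a, b⟩ := p
  obtain ⟨c, d⟩ := p'
  obtain ⟨⟨ha, hb, hab⟩, hcost, hopt⟩ := hp
  obtain ⟨⟨hc, hd, hcd⟩, hcdT, hdV⟩ := hp'
  simp only [errorCost, listCost] at *
  have hcost0 : condDiv W a ≤ E := by linarith [le_max_right (mutualInfo b - R) 0]
  have hcost1 : condDiv W a + (mutualInfo b - R) ≤ E := by
    linarith [le_max_left (mutualInfo b - R) 0]
  -- exchanging the two components of the threshold pair
  have h_swap : condDiv W c + mutualInfo d - R ≤ E + T := by
    have h := hmin (b, a) ⟨⟨hb, ha, hab.symm⟩, by simp only; linarith, fun Q hQ hQY hQI => by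
      have := hopt (a, Q) ⟨ha, hQ, hQY.symm⟩ (by
        simp only; rw [max_eq_right (by linarith), add_zero]; exact hcost0)
      simp only at this
      linarith⟩
    have := condDiv_swap hW hb ha hab.symm
    simp only at h
    linarith
  -- Otherwise `(d, V)` is feasible for the threshold problem. As `d` is strictly better than the
  -- product, it misses an entry of the product's support; filling that entry slightly lowers the
  -- likelihood without raising the divergence, and beats `T`.
  have hDd : E < condDiv W d := by
    by_contra! hle
    have hU := indep_margY_mem hP hP1 hd
    have hUY := margY_indep hP1 (margY d)
    have hUf := hdV _ hU hUY (by
      rw [mutualInfo_indep hP1 (sum_margY hP1 hd)]; exact hR)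
    have hex : ∃ x y, d x y = 0 ∧ indep P (margY d) x y ≠ 0 := by
      by_contra! hno
      have := logLik_le_of_support hd hmax hd hU hUY.symm hno
      linarith
    obtain ⟨x, y, hxy, hUxy⟩ := hex
    obtain ⟨t, ht0, ht1, hD⟩ :=
      exists_condDiv_mix_le hW hd hU hxy ((hU.1 x y).lt_of_ne hUxy.symm)
    have := hopt (mix t d (indep P (margY d)), V)
      ⟨mix_mem hd hU ht0.le ht1, hV, (margY_mix_of_eq hUY t).trans hVY.symm⟩ (by
        simp only; rw [max_eq_right (by linarith), add_zero]; linarith)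
    simp only [logLik_mix] at this
    nlinarith
  have hId : R < mutualInfo d := by
    by_contra! hle
    have := hdV d hd rfl hle
    linarith
  have hsw := condDiv_swap hW hc hd hcd
  -- If `c` has information at least `R`, `condDiv_swap` already gives a list cost of at least
  -- `condDiv W d + T`, which exceeds `E + T`.
  rcases le_or_gt R (mutualInfo c) with hIc | hIc
  · linarith
  set α := R - mutualInfo c with hα
  set β := mutualInfo d - R with hβ
  have hα0 : 0 < α := by linarith
  have hβ0 : 0 < β := by linarith
  have hαβ : 0 < α + β := by linarith
  have ht0 : 0 ≤ α / (α + β) := by positivity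
  have ht1 : α / (α + β) ≤ 1 := by rw [div_le_one hαβ]; linarith
  -- The weight is chosen so that convexity bounds the information of the mixture of `c` and `d` by
  -- exactly `R`; the mixture is therefore a competitor of `d`.
  have hseg : β * (logLik W d - T - logLik W c) ≥ α * T := by
    have h1 := hdV (mix (α / (α + β)) c d) (mix_mem hc hd ht0 ht1)
      ((margY_mix_of_eq hcd.symm _).trans hcd) (by
        refine (mutualInfo_mix_le hc hd ht0 ht1).trans (le_of_eq ?_)
        have : mutualInfo c = R - α := by rw [hα]; ring
        rw [this]
        have : mutualInfo d = R + β := by rw [hβ]; ring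
        rw [this]
        field_simp
        ring)
    rw [logLik_mix] at h1
    have e : (1 - α / (α + β)) * logLik W c + α / (α + β) * logLik W d
        = (β * logLik W c + α * logLik W d) / (α + β) := by field_simp; ring
    rw [e, ← le_sub_iff_add_le', div_le_iff₀ hαβ] at h1
    nlinarith
  -- If `β ≤ T`, the segment bound compensates the deficit `α` in `condDiv_swap`. If `β > T`, then
  -- `condDiv W c > E`, since otherwise `(c, V)` would be feasible with a nonpositive gap; the cost
  -- `condDiv W c + β` is again too large.
  rcases le_or_gt β T with hβT | hβT
  · have : α ≤ logLik W d - T - logLik W c := by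
      by_contra! hlt
      nlinarith
    linarith
  · have hDc : E < condDiv W c := by
      by_contra! hle
      have := hopt (c, V) ⟨hc, hV, hcd.trans hVY.symm⟩ (by
        simp only; rw [max_eq_right (by linarith), add_zero]; exact hle)
      simp only at this
      linarith
    linarith

/-- Minimizers of the list cost at the optimal threshold are limits of pairs of types. -/
theorem IsThresholdPair.hasRatApprox {P : X → ℝ} (hP : ∀ x, 0 ≤ P x) (hP1 : ∑ x, P x = 1)
    (hP_rat : ∀ x, ∃ r : ℚ, P x = r)
    {W : X → Y → ℝ} (hW : ∀ x, 0 < P x → ∀ y, 0 < W x y) {R E : ℝ} (hR : 0 ≤ R)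
    {p : (X → Y → ℝ) × (X → Y → ℝ)} (hp : IsThresholdPair P W R E p)
    {T : ℝ} (hT : logLik W p.1 - logLik W p.2 = T)
    {p' : (X → Y → ℝ) × (X → Y → ℝ)} (hp' : p' ∈ listPairs P W R T)
    (hmin : ∀ p'' ∈ listPairs P W R T, listCost W R p' ≤ listCost W R p'') :
    HasRatApprox P W R T p' := by
  obtain ⟨hm, hle, hall⟩ := id hp'
  by_cases hmax : ∀ Q ∈ jointDists P, margY Q = margY p'.2 → logLik W Q ≤ logLik W p'.2
  swap
  -- Moving the second component towards a better one raises its likelihood without changing the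
  -- margin, so all constraints become strict.
  · push Not at hmax
    obtain ⟨Q, hQ, hQY, hlt⟩ := hmax
    refine HasRatApprox.of_mix hW hm (p' := (p'.1, Q)) ⟨hm.1, hQ, hm.2.2.trans hQY.symm⟩
      fun t ht0 ht1 => ?_
    have hgt : logLik W p'.2 < logLik W (mix t p'.2 Q) := by
      rw [logLik_mix]; nlinarith
    have hY : margY (mix t p'.2 Q) = margY p'.2 := margY_mix_of_eq hQY t
    simp only [mix_self]
    refine hasRatApprox_of_lt hP_rat hW ⟨hm.1, mix_mem hm.2.1 hQ ht0.le ht1.le, ?_⟩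
      (by simp only; linarith) fun Q' hQ' hQY' hI => ?_
    · simp only; rw [hY, hm.2.2]
    · simp only at hQY' ⊢
      exact (hall Q' hQ' (hQY'.trans hY) hI).trans_lt hgt
  by_cases hstrict : ∀ Q ∈ jointDists P, margY Q = margY p'.2 → mutualInfo Q ≤ R →
      T + logLik W Q < logLik W p'.2
  · have hU := indep_margY_mem hP hP1 hm.2.1
    have hUY := margY_indep hP1 (margY p'.2)
    have hUf := hstrict _ hU hUY (by
      rw [mutualInfo_indep hP1 (sum_margY hP1 hm.2.1)]; exact hR)
    -- Only the constraint from the first component can be tight; mixing that component with the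
    -- product, a strict competitor, makes it strict.
    refine HasRatApprox.of_mix hW hm (p' := (indep P (margY p'.2), p'.2))
      ⟨hU, hm.2.1, hUY⟩ fun t ht0 ht1 => ?_
    simp only [mix_self]
    refine hasRatApprox_of_lt hP_rat hW ⟨mix_mem hm.1 hU ht0.le ht1.le, hm.2.1, ?_⟩ ?_ hstrict
    · exact (margY_mix_of_eq (hUY.trans hm.2.2.symm) t).trans hm.2.2
    · simp only [logLik_mix]
      nlinarith
  push Not at hstrict
  obtain ⟨V, hV, hVY, hVI, hVf⟩ := hstrict
  have hVf' : logLik W p'.2 = T + logLik W V := le_antisymm hVf (hall V hV hVY hVI)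
  have hT0 : 0 ≤ T := by linarith [hmax V hV hVY]
  -- At `T = 0` the rational second component stays maximal because its support has not grown, so it
  -- has no blocker at all.
  rcases hT0.eq_or_lt with hT0 | hT0
  · intro ε hε
    obtain ⟨R₁, R₂, hmem, hcost, hs⟩ := exists_rat_pair_of_eventually hP_rat hm
      ((continuousOn_listCost hW R p' (marginPairs_subset P hm)).eventually_lt_const
        (show listCost W R p' < listCost W R p' + ε by linarith))
    have hopt : ∀ Q ∈ jointDists P, margY Q = margY (fun x y => (R₂ x y : ℝ)) →
        logLik W Q ≤ logLik W (fun x y => (R₂ x y : ℝ)) := fun Q hQ hQY =>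
      logLik_le_of_support hm.2.1 hmax hQ hmem.2.1 hQY fun x y h => by rw [hs x y h]; simp
    refine ⟨R₁, R₂, hmem, ?_, ⟨1, one_pos, fun Q hQ hQY hlt => ?_⟩, hcost⟩
    · rw [← hT0, zero_add]; exact hopt _ hmem.1 hmem.2.2
    · have := hopt Q hQ hQY
      linarith
  · exact (hp.not_rigid hP hP1 hW hR hT hT0 hp' hmin hmax hV hVY hVI hVf').elim

/-- The channel distribution in the second slot has divergence zero, so every competitor of
information at most `R` forms a feasible error pair; the product is one such competitor and serves
as first component. -/
theorem IsThresholdPair.listPairs_nonempty {P : X → ℝ} (hP : ∀ x, 0 ≤ P x) (hP1 : ∑ x, P x = 1)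
    {W : X → Y → ℝ} (hW0 : ∀ x y, 0 ≤ W x y) (hW1 : ∀ x, ∑ y, W x y = 1)
    {R E : ℝ} (hR : 0 ≤ R) (hE : 0 ≤ E)
    {p : (X → Y → ℝ) × (X → Y → ℝ)} (hp : IsThresholdPair P W R E p) :
    (listPairs P W R (logLik W p.1 - logLik W p.2)).Nonempty := by
  have hu := chan_pair_mem hP hP1 hW0 hW1
  set U : X → Y → ℝ := fun x y => P x * W x y
  have key : ∀ Q ∈ jointDists P, margY Q = margY U → mutualInfo Q ≤ R →
      logLik W p.1 - logLik W p.2 + logLik W Q ≤ logLik W U := by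
    intro Q hQ hQY hI
    have := hp.2.2 (U, Q) ⟨hu.1, hQ, hQY.symm⟩ (by
      simp only [errorCost, U, condDiv_chan hW1]
      rw [max_eq_right (by linarith)]; linarith)
    simp only at this
    linarith
  refine ⟨(indep P (margY U), U), ⟨hu.2.1, hu.1, hu.2.2.symm⟩, ?_, key⟩
  exact key _ hu.2.1 hu.2.2.symm (by
    simp only
    rw [mutualInfo_indep hP1 (sum_margY hP1 hu.1)]; exact hR)

/-! ### Bounds at finite block length -/

section Finite

variable [DecidableEq X] [DecidableEq Y]

theorem two_le_polyFactor (n : ℕ) : 2 ≤ polyFactor n := by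
  unfold polyFactor
  have h1 : (2 : ℝ) ≤ Real.exp 1 := by linarith [Real.add_one_le_exp (1 : ℝ)]
  have h2 : (0 : ℝ) ≤ n := n.cast_nonneg
  nlinarith

theorem eventually_polyFactor_pow_le (k : ℕ) {ε : ℝ} (hε : 0 < ε) :
    ∀ᶠ n : ℕ in atTop, polyFactor n ^ k ≤ Real.exp (n * ε) := by
  -- The constant absorbs the factor `e ^ k` of `polyFactor n ^ k` and the shift from `n` to `n +
  -- 1`.
  have h := (isLittleO_pow_exp_pos_mul_atTop k hε).def
    (show 0 < Real.exp (-(k : ℝ) - ε) from Real.exp_pos _)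
  have ht : Tendsto (fun n : ℕ => (n : ℝ) + 1) atTop atTop :=
    tendsto_atTop_add_const_right _ _ tendsto_natCast_atTop_atTop
  filter_upwards [ht.eventually h] with n hn
  have h0 : (0 : ℝ) ≤ ((n : ℝ) + 1) ^ k := by positivity
  rw [Real.norm_of_nonneg h0, Real.norm_of_nonneg (Real.exp_pos _).le, ← Real.exp_add] at hn
  unfold polyFactor
  rw [mul_pow, ← Real.exp_nat_mul]
  calc _ ≤ Real.exp (k * 1) * Real.exp (-(k : ℝ) - ε + ε * (n + 1)) := by gcongr
    _ = Real.exp (n * ε) := by rw [← Real.exp_add]; congr 1; ring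

/-- With `s = m * p`, the right side is at least `1 - exp (-s) ≥ s / (1 + s)`. It reverses the union
bound and produces the positive part in `errorCost`. -/
theorem one_sub_pow_ge {p : ℝ} (h0 : 0 ≤ p) (h1 : p ≤ 1) (m : ℕ) :
    min 1 (m * p) / 2 ≤ 1 - (1 - p) ^ m := by
  have hs : (0 : ℝ) ≤ m * p := by positivity
  have h2 : (1 - p) ^ m ≤ Real.exp (-(m * p)) := by
    calc (1 - p) ^ m ≤ Real.exp (-p) ^ m :=
          pow_le_pow_left₀ (by linarith) (by linarith [Real.add_one_le_exp (-p)]) m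
      _ = _ := by rw [← Real.exp_nat_mul]; congr 1; ring
  have h3 : Real.exp (-(m * p)) ≤ 1 / (1 + m * p) := by
    rw [Real.exp_neg, inv_eq_one_div]
    refine one_div_le_one_div_of_le (by positivity) ?_
    linarith [Real.add_one_le_exp (m * p)]
  have h4 : min 1 (m * p) / 2 ≤ 1 - 1 / (1 + m * p) := by
    have e : 1 - 1 / (1 + m * p) = m * p / (1 + m * p) := by field_simp; ring
    rw [e, le_div_iff₀ (by positivity)]
    rcases le_total (m * p) 1 with h | h
    · rw [min_eq_right h]; nlinarith
    · rw [min_eq_left h]; nlinarith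
  linarith

theorem pow_le_exp_neg {p : ℝ} (h1 : p ≤ 1) (m : ℕ) :
    (1 - p) ^ m ≤ Real.exp (-(m * p)) := by
  calc (1 - p) ^ m ≤ Real.exp (-p) ^ m :=
        pow_le_pow_left₀ (by linarith) (by linarith [Real.add_one_le_exp (-p)]) m
    _ = _ := by rw [← Real.exp_nat_mul]; congr 1; ring

theorem le_numCodewords (R : ℝ) (n : ℕ) : Real.exp (n * R) ≤ numCodewords R n :=
  Nat.le_ceil _

theorem numCodewords_pred_le {R : ℝ} {n k : ℕ} (hk : 1 ≤ k) (hR : 0 ≤ R) :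
    ((numCodewords R n - k : ℕ) : ℝ) ≤ Real.exp (n * R) := by
  have h1 : (numCodewords R n : ℝ) < Real.exp (n * R) + 1 := Nat.ceil_lt_add_one (Real.exp_pos _).le
  have h2 : numCodewords R n - k ≤ numCodewords R n - 1 := by omega
  have h3 : (1 : ℝ) ≤ Real.exp (n * R) := Real.one_le_exp (by positivity)
  have h4 : 1 ≤ numCodewords R n := by
    exact_mod_cast h3.trans (le_numCodewords R n)
  calc _ ≤ ((numCodewords R n - 1 : ℕ) : ℝ) := by exact_mod_cast h2
    _ = (numCodewords R n : ℝ) - 1 := by push_cast [h4]; ring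
    _ ≤ _ := by linarith

theorem numCodewords_sub_ge {R : ℝ} {n k : ℕ} (hk : k ≤ 2) (h4 : 4 ≤ Real.exp (n * R)) :
    Real.exp (n * R) / 2 ≤ ((numCodewords R n - k : ℕ) : ℝ) := by
  have h1 := le_numCodewords R n
  have h2 : (4 : ℝ) ≤ numCodewords R n := h4.trans h1
  have h3 : 4 ≤ numCodewords R n := by exact_mod_cast h2
  rw [Nat.cast_sub (by omega)]
  have : (k : ℝ) ≤ 2 := by exact_mod_cast hk
  linarith

theorem two_le_numCodewords {R : ℝ} {n : ℕ} (hR : 0 < R) (hn : n ≠ 0) : 2 ≤ numCodewords R n := by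
  have h0 : (0 : ℝ) < n := by exact_mod_cast Nat.pos_of_ne_zero hn
  have h1 : (1 : ℝ) < Real.exp (n * R) := Real.one_lt_exp_iff.2 (by positivity)
  have h2 : (1 : ℝ) < numCodewords R n := h1.trans_le (le_numCodewords R n)
  exact_mod_cast h2

theorem jointType_pair_mem {P : X → ℝ} {n : ℕ} {x z : Fin n → X} (hx : x ∈ typeClass P n)
    (hz : z ∈ typeClass P n) (y : Fin n → Y) :
    (jointType x y, jointType z y) ∈ marginPairs P :=
  ⟨jointType_mem hx y, jointType_mem hz y, by simp only [margY_jointType]⟩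

theorem wordProb_nonneg {W : X → Y → ℝ} (hW0 : ∀ x y, 0 ≤ W x y) {n : ℕ} (x : Fin n → X)
    (y : Fin n → Y) : 0 ≤ wordProb W x y := Finset.prod_nonneg fun _ _ => hW0 _ _

/-- The union bound for the competitors of mutual information at least `r`. -/
theorem blockProb_le {P : X → ℝ} {W : X → Y → ℝ} {T : ℝ} {n : ℕ} (hn : n ≠ 0)
    (hne : (typeClass P n).Nonempty) (x : Fin n → X) (y : Fin n → Y) {r : ℝ}
    (hr : ∀ z ∈ typeClass P n, logLik W (jointType x y) < T + logLik W (jointType z y) →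
      r ≤ mutualInfo (jointType z y)) :
    blockProb P W T x y ≤ polyFactor n ^ (Fintype.card (X × Y) + 1 + Fintype.card X
      + Fintype.card Y) * Real.exp (-(n * r)) := by
  have hK : (0 : ℝ) < (typeClass P n).card := by exact_mod_cast Finset.card_pos.2 hne
  unfold blockProb
  rw [div_le_iff₀ hK, Finset.card_filter]
  push_cast
  calc _ ≤ ∑ z ∈ typeClass P n,
        Real.exp (-(n * r)) * Real.exp (n * mutualInfo (jointType z y)) := by
        refine Finset.sum_le_sum fun z hz => ?_
        split_ifs with h
        · rw [← Real.exp_add]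
          refine Real.one_le_exp ?_
          have := hr z hz h
          have hn0 : (0 : ℝ) ≤ n := n.cast_nonneg
          nlinarith
        · positivity
    _ ≤ Real.exp (-(n * r)) * ((typeClass P n).card * polyFactor n ^ (Fintype.card (X × Y) + 1 +
          Fintype.card X + Fintype.card Y)) := by
        rw [← Finset.mul_sum]
        gcongr
        exact sum_exp_mutualInfo_le hn hne y
    _ = _ := by ring

/-- A single competing type is drawn with at least its exponential rate. -/
theorem le_blockProb {P : X → ℝ} {W : X → Y → ℝ} {T : ℝ} {n : ℕ} (hn : n ≠ 0)
    {z : Fin n → X} (hz : z ∈ typeClass P n) (x : Fin n → X) (y : Fin n → Y)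
    (h : logLik W (jointType x y) < T + logLik W (jointType z y)) :
    Real.exp (-(n * mutualInfo (jointType z y)))
      ≤ polyFactor n ^ (Fintype.card (X × Y) + 2) * blockProb P W T x y := by
  have hK : (0 : ℝ) < (typeClass P n).card := by exact_mod_cast Finset.card_pos.2 ⟨z, hz⟩
  have hp := polyFactor_pos n
  have h1 := exp_neg_mutualInfo_le hn hz y
  unfold blockProb
  rw [← mul_div_assoc, le_div_iff₀ hK, mul_comm]
  refine h1.trans ?_
  gcongr with z' hz'
  intro hj
  rw [hj]; exact h

/-! ### Error probability at finite length -/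

theorem ensembleAvg_errorProb_le {P : X → ℝ} {W : X → Y → ℝ} (hW0 : ∀ x y, 0 ≤ W x y)
    (hW : ∀ x, 0 < P x → ∀ y, 0 < W x y) {R E T : ℝ} (hR : 0 < R)
    (hc : ∀ p ∈ marginPairs P, logLik W p.1 < T + logLik W p.2 → E ≤ errorCost W R p)
    {n : ℕ} (hn : n ≠ 0) (hne : (typeClass P n).Nonempty) :
    ensembleAvg P n (numCodewords R n) (errorProb W T)
      ≤ polyFactor n ^ ((Fintype.card (X × Y) + 1 + Fintype.card X + Fintype.card Y)
        + (Fintype.card (X × Y) + 1 + Fintype.card X)) * Real.exp (-(n * E)) := by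
  have hK : (0 : ℝ) < (typeClass P n).card := by exact_mod_cast Finset.card_pos.2 hne
  have hn0 : (0 : ℝ) ≤ n := n.cast_nonneg
  have hp := polyFactor_pos n
  have hM := two_le_numCodewords hR hn
  rw [ensembleAvg_errorProb P W T (by omega) hne, div_le_iff₀ hK]
  set k₁ := Fintype.card (X × Y) + 1 + Fintype.card X + Fintype.card Y
  have key : ∀ x ∈ typeClass P n, ∀ y : Fin n → Y,
      1 - passProb P W T x y ^ (numCodewords R n - 1)
        ≤ polyFactor n ^ k₁ * Real.exp (-(n * E)) *
          Real.exp (n * condDiv W (jointType x y)) := by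
    intro x hx y
    have h1 : (1 : ℝ) ≤ polyFactor n ^ k₁ := one_le_pow₀ (one_le_polyFactor n)
    rw [mul_assoc, ← Real.exp_add]
    -- If the channel already costs `E`, the trivial bound 1 suffices. Otherwise the positive part
    -- in `errorCost` must be active, so every blocker has information at least `R + E` minus the
    -- divergence, and Bernoulli's inequality gives the union bound.
    rcases le_or_gt E (condDiv W (jointType x y)) with h | h
    · have h2 : (1 : ℝ) ≤ Real.exp (-(n * E) + n * condDiv W (jointType x y)) :=
        Real.one_le_exp (by nlinarith)
      have h3 := pow_nonneg (passProb_nonneg P W T x y) (numCodewords R n - 1)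
      nlinarith
    · have hb := blockProb_le (W := W) (T := T) hn hne x y
        (r := R + E - condDiv W (jointType x y)) (fun z hz hlt => by
          have := hc _ (jointType_pair_mem hx hz y) hlt
          unfold errorCost at this
          simp only at this
          rcases max_cases (mutualInfo (jointType z y) - R) 0 with h' | h' <;> linarith)
      have hb1 := blockProb_le_one (W := W) (T := T) hne x y
      rw [passProb_eq hne]
      have hbern := one_add_mul_le_pow (a := -blockProb P W T x y) (by linarith)
        (numCodewords R n - 1)
      rw [← sub_eq_add_neg] at hbern
      calc 1 - (1 - blockProb P W T x y) ^ (numCodewords R n - 1)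
          ≤ ((numCodewords R n - 1 : ℕ) : ℝ) * blockProb P W T x y := by linarith
        _ ≤ Real.exp (n * R) * (polyFactor n ^ k₁ *
            Real.exp (-(n * (R + E - condDiv W (jointType x y))))) := by
          gcongr
          · exact blockProb_nonneg P W T x y
          · exact numCodewords_pred_le le_rfl hR.le
        _ = polyFactor n ^ k₁ * (Real.exp (n * R) *
            Real.exp (-(n * (R + E - condDiv W (jointType x y))))) := by ring
        _ = _ := by rw [← Real.exp_add]; congr 2; ring
  calc _ ≤ ∑ x ∈ typeClass P n, ∑ y, (polyFactor n ^ k₁ * Real.exp (-(n * E))) *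
          (wordProb W x y * Real.exp (n * condDiv W (jointType x y))) := by
        refine Finset.sum_le_sum fun x hx => Finset.sum_le_sum fun y _ => ?_
        calc _ ≤ wordProb W x y * (polyFactor n ^ k₁ * Real.exp (-(n * E)) *
              Real.exp (n * condDiv W (jointType x y))) :=
              mul_le_mul_of_nonneg_left (key x hx y) (wordProb_nonneg hW0 x y)
          _ = _ := by ring
    _ = (polyFactor n ^ k₁ * Real.exp (-(n * E))) * ∑ x ∈ typeClass P n, ∑ y,
          wordProb W x y * Real.exp (n * condDiv W (jointType x y)) := by
        simp only [Finset.mul_sum]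
    _ ≤ (polyFactor n ^ k₁ * Real.exp (-(n * E))) * ((typeClass P n).card *
          polyFactor n ^ (Fintype.card (X × Y) + 1 + Fintype.card X)) := by
        gcongr
        exact sum_wordProb_exp_condDiv_le hW hn hne
    _ = _ := by rw [pow_add]; ring

/-- The permutation that carries `y₀` to `y` is applied to `x₂` as well. -/
theorem exists_jointType_transport {P : X → ℝ} {n : ℕ} {x₁ x₂ : Fin n → X}
    (hx₂ : x₂ ∈ typeClass P n) {y₀ y : Fin n → Y} {x : Fin n → X}
    (h : jointType x y = jointType x₁ y₀) :
    ∃ z ∈ typeClass P n, jointType z y = jointType x₂ y₀ := by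
  have hy : wtype y₀ = wtype y := by
    rw [← margY_jointType x₁ y₀, ← h, margY_jointType]
  obtain ⟨σ, rfl⟩ := exists_perm_of_cnt_eq ((wtype_eq_iff _ _).1 hy)
  refine ⟨x₂ ∘ σ, ?_, jointType_comp x₂ y₀ σ⟩
  rw [mem_typeClass] at hx₂ ⊢
  rw [← hx₂, wtype_eq_iff]
  exact cnt_comp_perm x₂ σ

theorem le_ensembleAvg_errorProb {P : X → ℝ} {W : X → Y → ℝ} (hW0 : ∀ x y, 0 ≤ W x y)
    (hW : ∀ x, 0 < P x → ∀ y, 0 < W x y) {R T : ℝ}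
    {n : ℕ} (hn : n ≠ 0) (h4 : 4 ≤ Real.exp (n * R))
    {x₁ x₂ : Fin n → X} (hx₁ : x₁ ∈ typeClass P n) (hx₂ : x₂ ∈ typeClass P n) (y₀ : Fin n → Y)
    (hlt : logLik W (jointType x₁ y₀) < T + logLik W (jointType x₂ y₀)) :
    Real.exp (-(n * errorCost W R (jointType x₁ y₀, jointType x₂ y₀)))
      ≤ polyFactor n ^ ((Fintype.card (X × Y) + 1) + (Fintype.card (X × Y) + 2) + 2)
        * ensembleAvg P n (numCodewords R n) (errorProb W T) := by
  have hne : (typeClass P n).Nonempty := ⟨x₁, hx₁⟩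
  have hK : (0 : ℝ) < (typeClass P n).card := by exact_mod_cast Finset.card_pos.2 hne
  have hn0 : (0 : ℝ) ≤ n := n.cast_nonneg
  have hp := polyFactor_pos n
  have hM : 1 ≤ numCodewords R n := by
    have := h4.trans (le_numCodewords R n)
    have : 4 ≤ numCodewords R n := by exact_mod_cast this
    omega
  set k₂ := Fintype.card (X × Y) + 2
  set G := polyFactor n ^ k₂ with hG
  have hG1 : 1 ≤ G := one_le_pow₀ (one_le_polyFactor n)
  set D := condDiv W (jointType x₁ y₀)
  set I := mutualInfo (jointType x₂ y₀)
  have key : ∀ x ∈ typeClass P n, ∀ y : Fin n → Y, jointType x y = jointType x₁ y₀ →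
      Real.exp (-(n * max (I - R) 0)) ≤ 4 * G *
        (1 - passProb P W T x y ^ (numCodewords R n - 1)) := by
    intro x hx y hj
    obtain ⟨z, hz, hzj⟩ := exists_jointType_transport hx₂ hj
    have hb := le_blockProb (W := W) (T := T) hn hz x y (by rw [hj, hzj]; exact hlt)
    rw [hzj] at hb
    have hb0 := blockProb_nonneg P W T x y
    have hb1 := blockProb_le_one (W := W) (T := T) hne x y
    have h1 := one_sub_pow_ge hb0 hb1 (numCodewords R n - 1)
    rw [passProb_eq hne]
    have h2 : Real.exp (-(n * max (I - R) 0)) ≤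
        2 * G * min 1 (((numCodewords R n - 1 : ℕ) : ℝ) * blockProb P W T x y) := by
      rw [mul_min_of_nonneg _ _ (by positivity)]
      refine le_min ?_ ?_
      · have : Real.exp (-(n * max (I - R) 0)) ≤ 1 := by
          rw [Real.exp_le_one_iff]
          have := mul_nonneg hn0 (le_max_right (I - R) 0)
          linarith
        linarith
      · calc Real.exp (-(n * max (I - R) 0)) ≤ Real.exp (n * R + -(n * I)) := by
              gcongr
              have := mul_le_mul_of_nonneg_left (le_max_left (I - R) 0) hn0
              linarith
          _ = Real.exp (n * R) * Real.exp (-(n * I)) := Real.exp_add _ _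
          _ ≤ (2 * ((numCodewords R n - 1 : ℕ) : ℝ)) * (G * blockProb P W T x y) := by
              gcongr
              linarith [numCodewords_sub_ge (k := 1) (by norm_num) h4]
          _ = _ := by ring
    calc _ ≤ 2 * G * min 1 (((numCodewords R n - 1 : ℕ) : ℝ) * blockProb P W T x y) := h2
      _ = 4 * G * (min 1 (((numCodewords R n - 1 : ℕ) : ℝ) * blockProb P W T x y) / 2) := by ring
      _ ≤ _ := by gcongr
  have hD := exp_neg_condDiv_le hW hn hx₁ y₀
  rw [ensembleAvg_errorProb P W T hM hne, ← mul_div_assoc, le_div_iff₀ hK]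
  have hpos : ∀ x ∈ typeClass P n, ∀ y : Fin n → Y,
      0 ≤ 1 - passProb P W T x y ^ (numCodewords R n - 1) := by
    intro x hx y
    have : passProb P W T x y ≤ 1 := by
      rw [passProb_eq hne]; linarith [blockProb_nonneg P W T x y]
    linarith [pow_le_one₀ (passProb_nonneg P W T x y) this (n := numCodewords R n - 1)]
  have hcost : Real.exp (-(n * errorCost W R (jointType x₁ y₀, jointType x₂ y₀)))
      = Real.exp (-(n * D)) * Real.exp (-(n * max (I - R) 0)) := by
    rw [← Real.exp_add]; congr 1; unfold errorCost; simp only [D, I]; ring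
  rw [hcost]
  have hpf2 : (4 : ℝ) ≤ polyFactor n ^ 2 := by nlinarith [two_le_polyFactor n]
  calc _ = ((typeClass P n).card * Real.exp (-(n * D))) * Real.exp (-(n * max (I - R) 0)) := by
        ring
    _ ≤ (polyFactor n ^ (Fintype.card (X × Y) + 1) * ∑ x ∈ typeClass P n, ∑ y,
          (if jointType x y = jointType x₁ y₀ then wordProb W x y else 0))
          * Real.exp (-(n * max (I - R) 0)) := by gcongr
    _ = polyFactor n ^ (Fintype.card (X × Y) + 1) * ∑ x ∈ typeClass P n, ∑ y,
          (if jointType x y = jointType x₁ y₀ then wordProb W x y else 0)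
          * Real.exp (-(n * max (I - R) 0)) := by
        rw [mul_assoc, Finset.sum_mul]
        simp only [Finset.sum_mul]
    _ ≤ polyFactor n ^ (Fintype.card (X × Y) + 1) * ∑ x ∈ typeClass P n, ∑ y,
          (polyFactor n ^ 2 * G) *
          (wordProb W x y * (1 - passProb P W T x y ^ (numCodewords R n - 1))) := by
        refine mul_le_mul_of_nonneg_left ?_ (by positivity)
        refine Finset.sum_le_sum fun x hx => Finset.sum_le_sum fun y _ => ?_
        have hw := wordProb_nonneg hW0 x y
        have hq := hpos x hx y
        split_ifs with h
        · calc _ ≤ wordProb W x y * (4 * G *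
                (1 - passProb P W T x y ^ (numCodewords R n - 1))) := by
                gcongr; exact key x hx y h
            _ ≤ wordProb W x y * (polyFactor n ^ 2 * G *
                (1 - passProb P W T x y ^ (numCodewords R n - 1))) := by gcongr
            _ = _ := by ring
        · rw [zero_mul]; positivity
    _ = _ := by
        simp only [← Finset.mul_sum]
        rw [hG, pow_add, pow_add]; ring

/-! ### Expected list size at finite length -/

theorem ensembleAvg_listSize_le {P : X → ℝ} {W : X → Y → ℝ} (hW0 : ∀ x y, 0 ≤ W x y)
    (hW : ∀ x, 0 < P x → ∀ y, 0 < W x y) {R T e : ℝ} (hR : 0 < R)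
    {n : ℕ} (hn : n ≠ 0) (hne : (typeClass P n).Nonempty)
    (hc : ∀ x ∈ typeClass P n, ∀ z ∈ typeClass P n, ∀ y : Fin n → Y,
      T + logLik W (jointType x y) ≤ logLik W (jointType z y) →
      passProb P W T z y ^ (numCodewords R n - 2)
        ≤ Real.exp (n * (listCost W R (jointType x y, jointType z y) - e))) :
    ensembleAvg P n (numCodewords R n) (listSize W T)
      ≤ polyFactor n ^ ((Fintype.card (X × Y) + 1 + Fintype.card X + Fintype.card Y)
        + (Fintype.card (X × Y) + 1 + Fintype.card X)) * Real.exp (-(n * e)) := by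
  have hK : (0 : ℝ) < (typeClass P n).card := by exact_mod_cast Finset.card_pos.2 hne
  have hp := polyFactor_pos n
  rw [ensembleAvg_listSize P W T (two_le_numCodewords hR hn) hne, div_le_iff₀ hK]
  set k₁ := Fintype.card (X × Y) + 1 + Fintype.card X + Fintype.card Y
  have key : ∀ x ∈ typeClass P n, ∀ y : Fin n → Y,
      (∑ z ∈ typeClass P n, if T + logLik W (jointType x y) ≤ logLik W (jointType z y)
          then passProb P W T z y ^ (numCodewords R n - 2) else 0) / (typeClass P n).card
        ≤ polyFactor n ^ k₁ * Real.exp (-(n * (R + e))) *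
          Real.exp (n * condDiv W (jointType x y)) := by
    intro x hx y
    rw [div_le_iff₀ hK]
    calc _ ≤ ∑ z ∈ typeClass P n, Real.exp (n * (condDiv W (jointType x y) - R - e)) *
          Real.exp (n * mutualInfo (jointType z y)) := by
          refine Finset.sum_le_sum fun z hz => ?_
          split_ifs with h
          · refine (hc x hx z hz y h).trans (le_of_eq ?_)
            rw [← Real.exp_add]; congr 1; unfold listCost; ring
          · positivity
      _ ≤ Real.exp (n * (condDiv W (jointType x y) - R - e)) *
            ((typeClass P n).card * polyFactor n ^ k₁) := by
          rw [← Finset.mul_sum]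
          gcongr
          exact sum_exp_mutualInfo_le hn hne y
      _ = polyFactor n ^ k₁ * (Real.exp (-(n * (R + e))) *
          Real.exp (n * condDiv W (jointType x y))) * (typeClass P n).card := by
          rw [← Real.exp_add]
          have : (n : ℝ) * (condDiv W (jointType x y) - R - e)
            = -(n * (R + e)) + n * condDiv W (jointType x y) := by ring
          rw [this]; ring
      _ = _ := by ring
  calc _ ≤ Real.exp (n * R) * ∑ x ∈ typeClass P n, ∑ y,
          (polyFactor n ^ k₁ * Real.exp (-(n * (R + e)))) *
          (wordProb W x y * Real.exp (n * condDiv W (jointType x y))) := by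
        refine mul_le_mul (numCodewords_pred_le le_rfl hR.le) ?_ ?_ (Real.exp_pos _).le
        · refine Finset.sum_le_sum fun x hx => Finset.sum_le_sum fun y _ => ?_
          calc _ ≤ wordProb W x y * (polyFactor n ^ k₁ * Real.exp (-(n * (R + e))) *
                Real.exp (n * condDiv W (jointType x y))) :=
                mul_le_mul_of_nonneg_left (key x hx y) (wordProb_nonneg hW0 x y)
            _ = _ := by ring
        · refine Finset.sum_nonneg fun x _ => Finset.sum_nonneg fun y _ =>
            mul_nonneg (wordProb_nonneg hW0 x y) (div_nonneg (Finset.sum_nonneg fun z _ => ?_) hK.le)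
          split_ifs
          · exact pow_nonneg (passProb_nonneg P W T z y) _
          · exact le_rfl
    _ = Real.exp (n * R) * Real.exp (-(n * (R + e))) * polyFactor n ^ k₁ *
          ∑ x ∈ typeClass P n, ∑ y,
            wordProb W x y * Real.exp (n * condDiv W (jointType x y)) := by
        simp only [← Finset.mul_sum]; ring
    _ ≤ Real.exp (n * R) * Real.exp (-(n * (R + e))) * polyFactor n ^ k₁ *
          ((typeClass P n).card *
          polyFactor n ^ (Fintype.card (X × Y) + 1 + Fintype.card X)) := by
        gcongr
        exact sum_wordProb_exp_condDiv_le hW hn hne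
    _ = _ := by
        rw [← Real.exp_add, pow_add]
        have : (n : ℝ) * R + -(n * (R + e)) = -(n * e) := by ring
        rw [this]; ring

theorem le_ensembleAvg_listSize {P : X → ℝ} {W : X → Y → ℝ} (hW0 : ∀ x y, 0 ≤ W x y)
    (hW : ∀ x, 0 < P x → ∀ y, 0 < W x y) {R T : ℝ}
    {n : ℕ} (hn : n ≠ 0) (h4 : 4 ≤ Real.exp (n * R))
    {x₁ x₂ : Fin n → X} (hx₁ : x₁ ∈ typeClass P n) (hx₂ : x₂ ∈ typeClass P n) (y₀ : Fin n → Y)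
    (hle : T + logLik W (jointType x₁ y₀) ≤ logLik W (jointType x₂ y₀))
    (hpass : ∀ z ∈ typeClass P n, ∀ y : Fin n → Y, jointType z y = jointType x₂ y₀ →
      1 / 2 ≤ passProb P W T z y ^ (numCodewords R n - 2)) :
    Real.exp (-(n * listCost W R (jointType x₁ y₀, jointType x₂ y₀)))
      ≤ polyFactor n ^ ((Fintype.card (X × Y) + 1) + (Fintype.card (X × Y) + 2) + 2)
        * ensembleAvg P n (numCodewords R n) (listSize W T) := by
  have hne : (typeClass P n).Nonempty := ⟨x₁, hx₁⟩
  have hK : (0 : ℝ) < (typeClass P n).card := by exact_mod_cast Finset.card_pos.2 hne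
  have hp := polyFactor_pos n
  have hM : 2 ≤ numCodewords R n := by
    have := h4.trans (le_numCodewords R n)
    have : 4 ≤ numCodewords R n := by exact_mod_cast this
    omega
  set k₂ := Fintype.card (X × Y) + 2
  set D := condDiv W (jointType x₁ y₀)
  set I := mutualInfo (jointType x₂ y₀)
  set S : (Fin n → X) → (Fin n → Y) → ℝ := fun x y =>
    (∑ z ∈ typeClass P n, if T + logLik W (jointType x y) ≤ logLik W (jointType z y)
      then passProb P W T z y ^ (numCodewords R n - 2) else 0) / (typeClass P n).card with hS
  have hS0 : ∀ x y, 0 ≤ S x y := by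
    intro x y
    refine div_nonneg (Finset.sum_nonneg fun z _ => ?_) hK.le
    split_ifs
    · exact pow_nonneg (passProb_nonneg P W T z y) _
    · exact le_rfl
  have key : ∀ x ∈ typeClass P n, ∀ y : Fin n → Y, jointType x y = jointType x₁ y₀ →
      Real.exp (-(n * I)) ≤ 2 * polyFactor n ^ k₂ * S x y := by
    intro x hx y hj
    obtain ⟨z, hz, hzj⟩ := exists_jointType_transport hx₂ hj
    have h1 := exp_neg_mutualInfo_le hn hz y
    rw [hzj] at h1
    rw [hS]
    simp only
    rw [← mul_div_assoc, le_div_iff₀ hK, mul_comm]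
    refine h1.trans ?_
    rw [Finset.card_filter]
    push_cast
    rw [mul_comm 2, mul_assoc, Finset.mul_sum _ _ (2 : ℝ)]
    refine mul_le_mul_of_nonneg_left (Finset.sum_le_sum fun z' hz' => ?_) (by positivity)
    split_ifs with h2 h3
    · linarith [hpass z' hz' y h2]
    · rw [hj, h2] at h3
      exact absurd hle h3
    · have := pow_nonneg (passProb_nonneg P W T z' y) (numCodewords R n - 2)
      positivity
    · simp
  have hD := exp_neg_condDiv_le hW hn hx₁ y₀
  rw [ensembleAvg_listSize P W T hM hne, ← mul_div_assoc, le_div_iff₀ hK]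
  have hcost : Real.exp (-(n * listCost W R (jointType x₁ y₀, jointType x₂ y₀)))
      = Real.exp (n * R) * (Real.exp (-(n * D)) * Real.exp (-(n * I))) := by
    rw [← Real.exp_add, ← Real.exp_add]; congr 1; unfold listCost; simp only [D, I]; ring
  rw [hcost]
  have hpf2 : (4 : ℝ) ≤ polyFactor n ^ 2 := by nlinarith [two_le_polyFactor n]
  have hsum : (typeClass P n).card * (Real.exp (-(n * D)) * Real.exp (-(n * I)))
      ≤ polyFactor n ^ (Fintype.card (X × Y) + 1) * (2 * polyFactor n ^ k₂) *
        ∑ x ∈ typeClass P n, ∑ y, wordProb W x y * S x y := by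
    calc _ = ((typeClass P n).card * Real.exp (-(n * D))) * Real.exp (-(n * I)) := by ring
      _ ≤ (polyFactor n ^ (Fintype.card (X × Y) + 1) * ∑ x ∈ typeClass P n, ∑ y,
            (if jointType x y = jointType x₁ y₀ then wordProb W x y else 0))
            * Real.exp (-(n * I)) := by gcongr
      _ = polyFactor n ^ (Fintype.card (X × Y) + 1) * ∑ x ∈ typeClass P n, ∑ y,
            (if jointType x y = jointType x₁ y₀ then wordProb W x y else 0)
            * Real.exp (-(n * I)) := by
          rw [mul_assoc, Finset.sum_mul]
          simp only [Finset.sum_mul]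
      _ ≤ polyFactor n ^ (Fintype.card (X × Y) + 1) * ∑ x ∈ typeClass P n, ∑ y,
            (2 * polyFactor n ^ k₂) * (wordProb W x y * S x y) := by
          refine mul_le_mul_of_nonneg_left ?_ (by positivity)
          refine Finset.sum_le_sum fun x hx => Finset.sum_le_sum fun y _ => ?_
          have hw := wordProb_nonneg hW0 x y
          have hq := hS0 x y
          split_ifs with h
          · calc _ ≤ wordProb W x y * (2 * polyFactor n ^ k₂ * S x y) := by
                  gcongr; exact key x hx y h
              _ = _ := by ring
          · rw [zero_mul]; positivity
      _ = _ := by simp only [← Finset.mul_sum]; ring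
  have hA : 0 ≤ ∑ x ∈ typeClass P n, ∑ y, wordProb W x y * S x y :=
    Finset.sum_nonneg fun x _ => Finset.sum_nonneg fun y _ =>
      mul_nonneg (wordProb_nonneg hW0 x y) (hS0 x y)
  calc _ = Real.exp (n * R) *
        ((typeClass P n).card * (Real.exp (-(n * D)) * Real.exp (-(n * I)))) := by ring
    _ ≤ (2 * ((numCodewords R n - 1 : ℕ) : ℝ)) *
        (polyFactor n ^ (Fintype.card (X × Y) + 1) * (2 * polyFactor n ^ k₂) *
        ∑ x ∈ typeClass P n, ∑ y, wordProb W x y * S x y) := by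
        gcongr
        linarith [numCodewords_sub_ge (k := 1) (by norm_num) h4]
    _ = 4 * (polyFactor n ^ (Fintype.card (X × Y) + 1) * polyFactor n ^ k₂ *
        (((numCodewords R n - 1 : ℕ) : ℝ) *
          ∑ x ∈ typeClass P n, ∑ y, wordProb W x y * S x y)) := by ring
    _ ≤ polyFactor n ^ 2 * (polyFactor n ^ (Fintype.card (X × Y) + 1) * polyFactor n ^ k₂ *
        (((numCodewords R n - 1 : ℕ) : ℝ) *
          ∑ x ∈ typeClass P n, ∑ y, wordProb W x y * S x y)) := by gcongr
    _ = _ := by rw [pow_add _ _ 2, pow_add]; ring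

end Finite

/-! ### Exponents -/

section Exponents

variable [DecidableEq X] [DecidableEq Y]

theorem le_negRate {n : ℕ} (hn : n ≠ 0) {a c : ℝ} (ha : 0 ≤ a) (h : a ≤ Real.exp (-(n * c))) :
    (c : EReal) ≤ negRate n a := by
  unfold negRate
  split_ifs with h0
  · exact le_top
  · have hn0 : (0 : ℝ) < n := by exact_mod_cast Nat.pos_of_ne_zero hn
    have ha' : 0 < a := ha.lt_of_ne (Ne.symm h0)
    have := Real.log_le_log ha' h
    rw [Real.log_exp] at this
    rw [EReal.coe_le_coe_iff]
    have h2 : c = -(1 / n) * -(n * c) := by field_simp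
    rw [h2]
    refine mul_le_mul_of_nonpos_left this ?_
    rw [neg_nonpos]; positivity

theorem negRate_le {n : ℕ} (hn : n ≠ 0) {a c : ℝ} (h : Real.exp (-(n * c)) ≤ a) :
    negRate n a ≤ (c : EReal) := by
  have ha' : 0 < a := (Real.exp_pos _).trans_le h
  unfold negRate
  rw [if_neg ha'.ne', EReal.coe_le_coe_iff]
  have hn0 : (0 : ℝ) < n := by exact_mod_cast Nat.pos_of_ne_zero hn
  have := Real.log_le_log (Real.exp_pos _) h
  rw [Real.log_exp] at this
  have h2 : c = -(1 / n) * -(n * c) := by field_simp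
  rw [h2]
  refine mul_le_mul_of_nonpos_left this ?_
  rw [neg_nonpos]; positivity

theorem negRate_anti {n : ℕ} {a b : ℝ} (ha : 0 ≤ a) (h : a ≤ b) : negRate n b ≤ negRate n a := by
  unfold negRate
  by_cases h0 : a = 0
  · rw [if_pos h0]; exact le_top
  · have ha' : 0 < a := ha.lt_of_ne (Ne.symm h0)
    rw [if_neg h0, if_neg (ha'.trans_le h).ne', EReal.coe_le_coe_iff]
    refine mul_le_mul_of_nonpos_left (Real.log_le_log ha' h) ?_
    rw [neg_nonpos]; positivity

theorem blockLengths_le_atTop (P : X → ℝ) : blockLengths P ≤ atTop := inf_le_left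

theorem eventually_blockLengths (P : X → ℝ) :
    ∀ᶠ n in blockLengths P, n ≠ 0 ∧ (typeClass P n).Nonempty :=
  ((eventually_ne_atTop 0).filter_mono (blockLengths_le_atTop P)).and
    (mem_inf_of_right (mem_principal_self _))

/-- The polynomial factor is absorbed by lowering the rate slightly; the rates below `c` determine
the bound. -/
theorem le_liminf_negRate (P : X → ℝ) {a : ℕ → ℝ} {c : ℝ} (k : ℕ) (ha : ∀ n, 0 ≤ a n)
    (h : ∀ᶠ n : ℕ in blockLengths P, a n ≤ polyFactor n ^ k * Real.exp (-(n * c))) :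
    (c : EReal) ≤ liminf (fun n => negRate n (a n)) (blockLengths P) := by
  refine EReal.ge_of_forall_gt_iff_ge.1 fun c' hc' => le_liminf_of_le (by isBoundedDefault) ?_
  have hc : c' < c := by exact_mod_cast hc'
  filter_upwards [h, eventually_blockLengths P, (eventually_polyFactor_pow_le k
    (sub_pos.2 hc)).filter_mono (blockLengths_le_atTop P)] with n h1 h2 h3
  refine le_negRate h2.1 (ha n) (h1.trans ?_)
  calc _ ≤ Real.exp (n * (c - c')) * Real.exp (-(n * c)) := by gcongr
    _ = _ := by rw [← Real.exp_add]; congr 1; ring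

theorem liminf_negRate_le (P : X → ℝ) {a : ℕ → ℝ} {c : ℝ} (k : ℕ)
    (h : ∃ᶠ n : ℕ in blockLengths P, Real.exp (-(n * c)) ≤ polyFactor n ^ k * a n) :
    liminf (fun n => negRate n (a n)) (blockLengths P) ≤ (c : EReal) := by
  refine EReal.le_of_forall_lt_iff_le.1 fun c' hc' => Filter.liminf_le_of_frequently_le' ?_
  have hc : c < c' := by exact_mod_cast hc'
  refine (h.and_eventually ((eventually_blockLengths P).and ((eventually_polyFactor_pow_le k
    (sub_pos.2 hc)).filter_mono (blockLengths_le_atTop P)))).mono ?_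
  rintro n ⟨h1, ⟨hn, -⟩, h3⟩
  refine negRate_le hn ?_
  have hp : 0 < polyFactor n ^ k := pow_pos (polyFactor_pos n) k
  have ha : 0 ≤ a n := by
    by_contra! hneg
    have := (Real.exp_pos (-(n * c))).trans_le h1
    nlinarith
  have h4 : Real.exp (-(n * c)) ≤ Real.exp (n * (c' - c)) * a n :=
    h1.trans (mul_le_mul_of_nonneg_right h3 ha)
  have e : Real.exp (-(n * c)) = Real.exp (n * (c' - c)) * Real.exp (-(n * c')) := by
    rw [← Real.exp_add]; congr 1; ring
  rw [e] at h4
  exact le_of_mul_le_mul_left h4 (Real.exp_pos _)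

theorem ensembleAvg_nonneg (P : X → ℝ) (n M : ℕ) {F : (Fin M → Fin n → X) → ℝ}
    (hF : ∀ C, 0 ≤ F C) : 0 ≤ ensembleAvg P n M F := by
  rw [ensembleAvg_eq]
  exact div_nonneg (Finset.sum_nonneg fun C _ => hF C) (by positivity)

theorem ensembleAvg_mono (P : X → ℝ) (n M : ℕ) {F G : (Fin M → Fin n → X) → ℝ}
    (h : ∀ C, F C ≤ G C) : ensembleAvg P n M F ≤ ensembleAvg P n M G := by
  rw [ensembleAvg_eq, ensembleAvg_eq]
  exact div_le_div_of_nonneg_right (Finset.sum_le_sum fun C _ => h C) (by positivity)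

theorem errorProb_nonneg {W : X → Y → ℝ} (hW0 : ∀ x y, 0 ≤ W x y) (T : ℝ) {n M : ℕ}
    (C : Fin M → Fin n → X) : 0 ≤ errorProb W T C :=
  mul_nonneg (by positivity) (Finset.sum_nonneg fun m _ => Finset.sum_nonneg fun y _ =>
    Set.indicator_nonneg (fun y _ => wordProb_nonneg hW0 _ y) y)

theorem listSize_nonneg {W : X → Y → ℝ} (hW0 : ∀ x y, 0 ≤ W x y) (T : ℝ) {n M : ℕ}
    (C : Fin M → Fin n → X) : 0 ≤ listSize W T C :=
  mul_nonneg (by positivity) (Finset.sum_nonneg fun m _ => Finset.sum_nonneg fun l _ =>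
    Finset.sum_nonneg fun y _ => Set.indicator_nonneg (fun y _ => wordProb_nonneg hW0 _ y) y)

theorem listSize_anti {W : X → Y → ℝ} (hW0 : ∀ x y, 0 ≤ W x y) {T T' : ℝ} (h : T' ≤ T) {n M : ℕ}
    (C : Fin M → Fin n → X) : listSize W T C ≤ listSize W T' C := by
  unfold listSize
  refine mul_le_mul_of_nonneg_left (Finset.sum_le_sum fun m _ => Finset.sum_le_sum fun l _ =>
    Finset.sum_le_sum fun y _ => ?_) (by positivity)
  refine Set.indicator_le_indicator_of_subset (fun y hy k hk => ?_)
    (fun y => wordProb_nonneg hW0 _ y) y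
  linarith [hy k hk]

theorem listExponent_mono (P : X → ℝ) {W : X → Y → ℝ} (hW0 : ∀ x y, 0 ≤ W x y) (R : ℝ)
    {T T' : ℝ} (h : T' ≤ T) : listExponent P W R T' ≤ listExponent P W R T :=
  liminf_le_liminf (Filter.Eventually.of_forall fun n =>
    negRate_anti (ensembleAvg_nonneg P n _ fun C => listSize_nonneg hW0 T C)
      (ensembleAvg_mono P n _ fun C => listSize_anti hW0 h C))

theorem le_errorExponent {P : X → ℝ} {W : X → Y → ℝ} (hW0 : ∀ x y, 0 ≤ W x y)
    (hW : ∀ x, 0 < P x → ∀ y, 0 < W x y) {R E T : ℝ} (hR : 0 < R)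
    (hc : ∀ p ∈ marginPairs P, logLik W p.1 < T + logLik W p.2 → E ≤ errorCost W R p) :
    (E : EReal) ≤ errorExponent P W R T := by
  refine le_liminf_negRate P ((Fintype.card (X × Y) + 1 + Fintype.card X + Fintype.card Y)
    + (Fintype.card (X × Y) + 1 + Fintype.card X)) (fun n => ensembleAvg_nonneg P n _ fun C =>
    errorProb_nonneg hW0 T C) ?_
  filter_upwards [eventually_blockLengths P] with n hn
  exact ensembleAvg_errorProb_le hW0 hW hR hc hn.1 hn.2

theorem eventually_four_le_exp {R : ℝ} (hR : 0 < R) :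
    ∀ᶠ n : ℕ in atTop, 4 ≤ Real.exp (n * R) :=
  (Real.tendsto_exp_atTop.comp (tendsto_natCast_atTop_atTop.atTop_mul_const hR)).eventually_ge_atTop
    4

/-- Both strict inequalities persist at a nearby rational pair, which occurs as a pair of types at
infinitely many lengths and there forces many errors. -/
theorem errorExponent_lt {P : X → ℝ} (hP1 : ∑ x, P x = 1) (hP_rat : ∀ x, ∃ r : ℚ, P x = r)
    {W : X → Y → ℝ} (hW0 : ∀ x y, 0 ≤ W x y) (hW : ∀ x, 0 < P x → ∀ y, 0 < W x y)
    {R E T : ℝ} (hR : 0 < R) {p : (X → Y → ℝ) × (X → Y → ℝ)} (hp : p ∈ marginPairs P)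
    (hc : errorCost W R p < E) (hlt : logLik W p.1 - logLik W p.2 < T) :
    errorExponent P W R T < E := by
  have e1 : ∀ᶠ p' in nhdsWithin p (jointDists P ×ˢ jointDists P), errorCost W R p' < E :=
    (continuousOn_errorCost hW R p (marginPairs_subset P hp)).eventually_lt_const hc
  have e2 : ∀ᶠ p' in nhdsWithin p (jointDists P ×ˢ jointDists P),
      logLik W p'.1 - logLik W p'.2 < T :=
    (((continuous_logLik_sub W).tendsto p).mono_left nhdsWithin_le_nhds).eventually_lt_const hlt
  obtain ⟨R₁, R₂, hm, ⟨h1, h2⟩, -⟩ := exists_rat_pair_of_eventually hP_rat hp (e1.and e2)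
  refine lt_of_le_of_lt (liminf_negRate_le P
    ((Fintype.card (X × Y) + 1) + (Fintype.card (X × Y) + 2) + 2) ?_)
    (EReal.coe_lt_coe_iff.2 h1)
  refine ((frequently_jointType_eq hP1 hm.1 hm.2.1 hm.2.2).and_eventually
    ((eventually_blockLengths P).and ((eventually_four_le_exp hR).filter_mono
      (blockLengths_le_atTop P)))).mono ?_
  rintro n ⟨⟨x₁, hx₁, x₂, hx₂, y, j₁, j₂⟩, hn, h4⟩
  rw [← j₁, ← j₂]
  refine le_ensembleAvg_errorProb hW0 hW hn.1 h4 hx₁ hx₂ y ?_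
  rw [j₁, j₂]
  simp only at h2
  linarith

theorem listExponent_le {P : X → ℝ} (hP1 : ∑ x, P x = 1)
    {W : X → Y → ℝ} (hW0 : ∀ x y, 0 ≤ W x y) (hW : ∀ x, 0 < P x → ∀ y, 0 < W x y)
    {R T : ℝ} (hR : 0 < R) {p : (X → Y → ℝ) × (X → Y → ℝ)} (hp : HasRatApprox P W R T p) :
    listExponent P W R T ≤ (listCost W R p : EReal) := by
  refine EReal.le_of_forall_lt_iff_le.1 fun c hc => ?_
  have hc : listCost W R p < c := by exact_mod_cast hc
  obtain ⟨R₁, R₂, hm, hle, ⟨η, hη, hsafe⟩, hcost⟩ := hp _ (sub_pos.2 hc)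
  rw [add_sub_cancel] at hcost
  refine (liminf_negRate_le P
    ((Fintype.card (X × Y) + 1) + (Fintype.card (X × Y) + 2) + 2) ?_).trans
    (EReal.coe_le_coe_iff.2 hcost.le)
  -- Half of `η` absorbs the polynomial in the union bound; the other half brings the expected
  -- number of blockers below 1/4, so the candidate survives with probability at least 1/2.
  have hη2 : 0 < η / 2 := by linarith
  refine ((frequently_jointType_eq hP1 hm.1 hm.2.1 hm.2.2).and_eventually
    ((eventually_blockLengths P).and (((eventually_four_le_exp hR).and
      ((eventually_four_le_exp hη2).and (eventually_polyFactor_pow_le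
        (Fintype.card (X × Y) + 1 + Fintype.card X + Fintype.card Y) hη2))).filter_mono
      (blockLengths_le_atTop P)))).mono ?_
  rintro n ⟨⟨x₁, hx₁, x₂, hx₂, y₀, j₁, j₂⟩, ⟨hn, hne⟩, h4, h4η, hpoly⟩
  rw [← j₁, ← j₂]
  refine le_ensembleAvg_listSize hW0 hW hn h4 hx₁ hx₂ y₀ (by rw [j₁, j₂]; exact hle) ?_
  intro z hz y hzy
  have hb := blockProb_le (W := W) (T := T) hn hne z y (r := R + η) (fun z' hz' hlt => by
    refine hsafe _ (jointType_mem hz' y) ?_ ?_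
    · rw [← j₂, ← hzy, margY_jointType, margY_jointType]
    · rw [← j₂, ← hzy]; exact hlt)
  have hb0 := blockProb_nonneg P W T z y
  have hb1 := blockProb_le_one (W := W) (T := T) hne z y
  rw [passProb_eq hne]
  have hbern := one_add_mul_le_pow (a := -blockProb P W T z y) (by linarith)
    (numCodewords R n - 2)
  rw [← sub_eq_add_neg] at hbern
  have hmul : ((numCodewords R n - 2 : ℕ) : ℝ) * blockProb P W T z y ≤ 1 / 4 := by
    calc _ ≤ Real.exp (n * R) * (Real.exp (n * (η / 2)) * Real.exp (-(n * (R + η)))) := by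
          gcongr
          · exact numCodewords_pred_le (by norm_num) hR.le
          · refine hb.trans ?_
            gcongr
      _ = (Real.exp (n * (η / 2)))⁻¹ := by
          rw [← Real.exp_add, ← Real.exp_add, ← Real.exp_neg]; congr 1; ring
      _ ≤ 4⁻¹ := by gcongr
      _ = 1 / 4 := by norm_num
  linarith

/-- If `Q` is beaten by a joint distribution of rate at most `R` with the same output margin,
then it is on the list with doubly exponentially small probability. -/
theorem eventually_passProb_pow_le {P : X → ℝ} (hP : ∀ x, 0 ≤ P x) (hP1 : ∑ x, P x = 1)
    (W : X → Y → ℝ) {R : ℝ} (hR : 0 < R) (T : ℝ) {δ : ℝ} (hδ : 0 < δ) (A : ℝ) :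
    ∀ᶠ n : ℕ in atTop, ∀ z ∈ typeClass P n, ∀ y : Fin n → Y,
      (∃ Q ∈ jointDists P, margY Q = margY (jointType z y) ∧ mutualInfo Q ≤ R ∧
        logLik W (jointType z y) < T - δ + logLik W Q) →
      passProb P W T z y ^ (numCodewords R n - 2) ≤ Real.exp (-(n * A)) := by
  have hJ := isCompact_jointDists (Y := Y) P
  obtain ⟨C, hC⟩ := hJ.exists_bound_of_continuousOn (continuous_logLik W).continuousOn
  simp only [Real.norm_eq_abs] at hC
  -- Mixing with the product by weight `t` lowers the information to `(1 - t) * R` and costs at most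
  -- `δ / 2` in likelihood, uniformly in `Q`. Rounding to a type uses the other `δ / 2` and
  -- information `t * R / 2`; what remains makes the number of blockers exponentially large.
  set t : ℝ := min 1 (δ / (4 * (|C| + 1))) with ht
  have ht0 : 0 < t := lt_min one_pos (by positivity)
  have ht1 : t ≤ 1 := min_le_left _ _
  have htC : t * (2 * C) ≤ δ / 2 := by
    calc t * (2 * C) ≤ δ / (4 * (|C| + 1)) * (2 * (|C| + 1)) := by
          have := le_abs_self C
          have h0 : t ≤ δ / (4 * (|C| + 1)) := min_le_right _ _
          have h1 : 2 * C ≤ 2 * (|C| + 1) := by linarith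
          calc t * (2 * C) ≤ t * (2 * (|C| + 1)) := by gcongr
            _ ≤ _ := by gcongr
      _ = δ / 2 := by field_simp; ring
  have htR : 0 < t * R / 2 := by positivity
  obtain ⟨ρ₁, hρ₁, hI⟩ := Metric.uniformContinuousOn_iff.1
    (hJ.uniformContinuousOn_of_continuous (continuousOn_mutualInfo P)) _ htR
  obtain ⟨ρ₂, hρ₂, hf⟩ := Metric.uniformContinuousOn_iff.1
    (hJ.uniformContinuousOn_of_continuous (continuous_logLik W).continuousOn) (δ / 2) (by linarith)
  set k := Fintype.card (X × Y) + 2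
  have htR4 : 0 < t * R / 4 := by positivity
  have hnear : ∀ᶠ n : ℕ in atTop,
      ((Fintype.card X * Fintype.card Y : ℕ) + 1 : ℝ) / n < min ρ₁ ρ₂ :=
    (tendsto_const_div_atTop_nhds_zero_nat _).eventually_lt_const (lt_min hρ₁ hρ₂)
  have hgrow : ∀ᶠ n : ℕ in atTop, 2 * (n * A) ≤ Real.exp (n * (t * R / 4)) := by
    have h1 := (isLittleO_pow_exp_pos_mul_atTop 1 htR4).def
      (show 0 < 1 / (2 * (|A| + 1)) by positivity)
    filter_upwards [tendsto_natCast_atTop_atTop.eventually h1] with n hn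
    have hn0 : (0 : ℝ) ≤ n := n.cast_nonneg
    rw [pow_one, Real.norm_of_nonneg hn0, Real.norm_of_nonneg (Real.exp_pos _).le,
      mul_comm (t * R / 4), one_div, inv_mul_eq_div, le_div_iff₀ (by positivity)] at hn
    have := le_abs_self A
    nlinarith
  filter_upwards [eventually_ne_atTop 0, hnear, hgrow, eventually_four_le_exp hR,
    eventually_polyFactor_pow_le k htR4] with n hn hnear hgrow h4 hpoly
  rintro z hz y ⟨Q, hQ, hQY, hQI, hQf⟩
  have hne : (typeClass P n).Nonempty := ⟨z, hz⟩
  have hU := indep_margY_mem hP hP1 hQ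
  have hUY := margY_indep hP1 (margY Q)
  set Q' := mix t Q (indep P (margY Q)) with hQ'
  have hQ'm : Q' ∈ jointDists P := mix_mem hQ hU ht0.le ht1
  have hQ'Y : margY Q' = wtype y := by
    rw [hQ', margY_mix_of_eq hUY, hQY, margY_jointType]
  have hQ'I : mutualInfo Q' ≤ (1 - t) * R := by
    refine (mutualInfo_mix_le hQ hU ht0.le ht1).trans ?_
    rw [mutualInfo_indep hP1 (sum_margY hP1 hQ), mul_zero, add_zero]
    have : 0 ≤ 1 - t := by linarith
    gcongr
  have hQ'f : logLik W Q - δ / 2 ≤ logLik W Q' := by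
    rw [hQ', logLik_mix]
    have h1 := (abs_le.1 (hC Q hQ)).2
    have h2 := (abs_le.1 (hC _ hU)).1
    nlinarith
  obtain ⟨z', hz', hd⟩ := exists_jointType_near hn hne y hQ'm hQ'Y
  have hdist : dist (jointType z' y) Q' < min ρ₁ ρ₂ := by
    have hpos : 0 < min ρ₁ ρ₂ := lt_min hρ₁ hρ₂
    rw [dist_pi_lt_iff hpos]
    intro a
    rw [dist_pi_lt_iff hpos]
    intro b
    rw [Real.dist_eq]
    exact (hd a b).trans_lt hnear
  have hz'm := jointType_mem hz' y
  have hI' := hI _ hz'm _ hQ'm (hdist.trans_le (min_le_left _ _))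
  have hf' := hf _ hz'm _ hQ'm (hdist.trans_le (min_le_right _ _))
  rw [Real.dist_eq] at hI' hf'
  have hI'' := (abs_lt.1 hI').2
  have hf'' := (abs_lt.1 hf').1
  have hb := le_blockProb (W := W) (T := T) hn hz' z y (by linarith)
  have hb0 := blockProb_nonneg P W T z y
  have hb1 := blockProb_le_one (W := W) (T := T) hne z y
  rw [passProb_eq hne]
  refine (pow_le_exp_neg hb1 _).trans (Real.exp_le_exp.2 (neg_le_neg ?_))
  have hn0 : (0 : ℝ) ≤ n := n.cast_nonneg
  have hb2 : Real.exp (-(n * (R - t * R / 2)))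
      ≤ Real.exp (n * (t * R / 4)) * blockProb P W T z y := by
    calc _ ≤ Real.exp (-(n * mutualInfo (jointType z' y))) := by
          gcongr; linarith
      _ ≤ _ := hb.trans (by gcongr)
  have hb3 : Real.exp (-(n * R)) * Real.exp (n * (t * R / 4)) ≤ blockProb P W T z y := by
    have e : Real.exp (-(n * (R - t * R / 2))) = Real.exp (n * (t * R / 4)) *
        (Real.exp (-(n * R)) * Real.exp (n * (t * R / 4))) := by
      rw [← Real.exp_add, ← Real.exp_add]; congr 1; ring
    rw [e] at hb2
    exact le_of_mul_le_mul_left hb2 (Real.exp_pos _)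
  calc n * A ≤ Real.exp (n * (t * R / 4)) / 2 := by linarith
    _ = (Real.exp (n * R) / 2) * (Real.exp (-(n * R)) * Real.exp (n * (t * R / 4))) := by
        rw [Real.exp_neg]; field_simp
    _ ≤ _ := by
        gcongr
        exact numCodewords_sub_ge le_rfl h4

theorem le_listExponent {P : X → ℝ} (hP : ∀ x, 0 ≤ P x) (hP1 : ∑ x, P x = 1)
    {W : X → Y → ℝ} (hW0 : ∀ x y, 0 ≤ W x y) (hW : ∀ x, 0 < P x → ∀ y, 0 < W x y)
    {R T e : ℝ} (hR : 0 < R) (he : ∀ p ∈ listPairs P W R T, e ≤ listCost W R p) :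
    (e : EReal) ≤ listExponent P W R T := by
  refine EReal.ge_of_forall_gt_iff_ge.1 fun c hc => ?_
  have hc : c < e := by exact_mod_cast hc
  obtain ⟨δ, hδ, hcost⟩ := exists_listCost_ge hP hP1 hW hR.le he (sub_pos.2 hc)
  rw [sub_sub_cancel] at hcost
  obtain ⟨B, hB⟩ := ((isCompact_jointDists (Y := Y) P).prod
    (isCompact_jointDists P)).exists_bound_of_continuousOn (continuousOn_listCost hW R)
  refine le_liminf_negRate P ((Fintype.card (X × Y) + 1 + Fintype.card X + Fintype.card Y)
    + (Fintype.card (X × Y) + 1 + Fintype.card X)) (fun n => ensembleAvg_nonneg P n _ fun C =>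
    listSize_nonneg hW0 T C) ?_
  -- List costs are at least `-B`, so survival probability `exp (-n * (B + c))` makes every beaten
  -- pair negligible at rate `c`.
  filter_upwards [eventually_blockLengths P, (eventually_passProb_pow_le hP hP1 W hR T hδ
    (B + c)).filter_mono (blockLengths_le_atTop P)] with n hn hpass
  refine ensembleAvg_listSize_le hW0 hW hR hn.1 hn.2 fun x hx z hz y hle => ?_
  have hn0 : (0 : ℝ) ≤ n := n.cast_nonneg
  have hmem := jointType_pair_mem hx hz y
  by_cases h : ∃ Q ∈ jointDists P, margY Q = margY (jointType z y) ∧ mutualInfo Q ≤ R ∧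
        logLik W (jointType z y) < T - δ + logLik W Q
  · refine (hpass z hz y h).trans ?_
    gcongr
    have := (abs_le.1 (hB _ (marginPairs_subset P hmem))).1
    nlinarith
  · push Not at h
    have h1 := hcost (jointType x y, jointType z y)
      ⟨hmem, by simp only; linarith, fun Q hQ hQY hI => h Q hQ hQY hI⟩
    have h2 : passProb P W T z y ≤ 1 := by
      rw [passProb_eq hn.2]; linarith [blockProb_nonneg P W T z y]
    refine (pow_le_one₀ (passProb_nonneg P W T z y) h2).trans (Real.one_le_exp ?_)
    exact mul_nonneg hn0 (by linarith)

end Exponents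

end ErasureList

end

/-! ### Assembly of the theorem -/

theorem theorem4 {X Y : Type*} [Fintype X] [DecidableEq X] [Fintype Y] [DecidableEq Y]
    (P : X → ℝ) (hP_nonneg : ∀ x, 0 ≤ P x) (hP_sum : ∑ x, P x = 1)
    (hP_rat : ∀ x, ∃ r : ℚ, P x = r)
    (W : X → Y → ℝ) (hW_nonneg : ∀ x y, 0 ≤ W x y) (hW_sum : ∀ x, ∑ y, W x y = 1)
    (hW_pos : ∀ x, 0 < P x → ∀ y, 0 < W x y)
    (R E : ℝ) (hR : 0 < R) (hE : 0 < E) :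
    ∃ T : ℝ,
      IsLeast ((fun Q : X → Y → ℝ =>
          ErasureList.hStar P W R E Q - (ErasureList.logLik W Q : EReal)) ''
        ErasureList.jointDists P) (T : EReal) ∧
      ErasureList.IsOptimalParameter P W R E T ∧
      ∃ e : ℝ, IsLeast (ErasureList.listCosts P W R T) e ∧
        ErasureList.listExponent P W R T = (e : EReal) := by
  open ErasureList in
  obtain ⟨p, hp⟩ :=
    exists_isThresholdPair hP_nonneg hP_sum hW_nonneg hW_sum hW_pos hR.le hE.le
  set T := logLik W p.1 - logLik W p.2 with hT
  obtain ⟨p', hp', hmin⟩ := (isCompact_listPairs hP_nonneg hP_sum W hR.le T).exists_isMinOn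
    (hp.listPairs_nonempty hP_nonneg hP_sum hW_nonneg hW_sum hR.le hE.le)
    ((continuousOn_listCost hW_pos R).mono fun p hp => marginPairs_subset P hp.1)
  have hmin : ∀ p'' ∈ listPairs P W R T, listCost W R p' ≤ listCost W R p'' :=
    fun p'' h => hmin h
  refine ⟨T, hp.isLeast, ⟨?_, fun T' hT' => ?_⟩, listCost W R p', ?_, le_antisymm ?_ ?_⟩
  · refine le_errorExponent hW_nonneg hW_pos hR fun q hq hlt => ?_
    by_contra! h
    linarith [hp.2.2 q hq h.le]
  -- Raising the threshold only removes words from the list, so it is enough that every admissible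
  -- threshold is at most `T`.
  · refine listExponent_mono P hW_nonneg R ?_
    by_contra! h
    obtain ⟨q, hq, hc, hlt⟩ :=
      hp.exists_lt hP_nonneg hP_sum hW_nonneg hW_sum hW_pos hR.le hE h
    exact (errorExponent_lt hP_sum hP_rat hW_nonneg hW_pos hR hq hc hlt).not_ge hT'
  · rw [listCosts_eq_image hP_nonneg hP_sum W hR.le]
    exact ⟨⟨p', hp', rfl⟩, by rintro _ ⟨q, hq, rfl⟩; exact hmin q hq⟩
  · exact listExponent_le hP_sum hW_nonneg hW_pos hR
      (hp.hasRatApprox hP_nonneg hP_sum hP_rat hW_pos hR.le hT.symm hp' hmin)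
  · exact le_listExponent hP_nonneg hP_sum hW_nonneg hW_pos hR hmin
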